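/- **Setting.** Let $p,q,m,n,d\ge 0$ be integers, $\mathbf z=(z_1,\dots,z_{p+q+m+n})\in\mathbb C^{p+q+m+n}$ and $\mathbf w=(w_1,\dots,w_d)\in\mathbb C^d$. Let $\mathbf s=(s_1,\dots,s_{p+q+m+n})=(0^p,1^q,0^m,1^n)$ and $|i|=s_i\in\mathbb Z_2$. *Current superalgebras.* $\mathfrak{gl}_{p+q|m+n}$ (notation for the general linear Lie superalgebra on $\mathbb C^{p|q}\oplus\mathbb C^{m|n}$) has the basis $E^i_j$, $1\le i,j\le p+q+m+n$, of parity $|i|+|j|$, with $[E^i_j,E^k_l]=\delta_{jk}E^i_l-(-1)^{(|i|+|j|)(|k|+|l|)}\delta_{il}E^k_j$; $\mathfrak{gl}_d$ has the usual basis $e_{ab}$. For $\mathfrak g$ either of them, $\mathfrak g[t]=\mathfrak g\otimes\mathbb C[t]$, $A[k]=A\otimes t^k$, and $A(z)=\sum_{k\ge 0}A[k]z^{-k-1}$. *Pseudo-differential operators.* For an associative unital superalgebra $\mathcal A$, $\mathcal A(\!(z^{-1},\partial_z^{-1})\!)$ is the algebra of formal series $\sum_{i\le r,\,j\le s}a_{ij}z^i\partial_z^j$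 ($r,s\in\mathbb Z$, $a_{ij}\in\mathcal A$) in which $z,\partial_z$ commute with $\mathcal A$, $\partial_z\partial_z^{-1}=\partial_z^{-1}\partial_z=1$ and $\partial_z^iz^j=\sum_{k\ge0}\binom ik\binom jk k!\,z^{j-k}\partial_z^{i-k}$ for $i,j\in\mathbb Z$. Homomorphisms of coefficient algebras are extended coefficientwise, and rational functions of $z$ stand for their expansions at $\infty$. *Weyl superalgebra.* $\mathcal D$ is the Weyl superalgebra generated by variables $y^a_r$ ($1\le r\le p+q$, of parity $|r|$) and $x^a_i$ ($1\le i\le m+n$, of parity $|p+q+i|$), $1\le a\le d$, and their derivatives $\partial_{y^a_r},\partial_{x^a_i}$. Let $\omega:\mathcal D\to\mathcal D$ be the anti-involution ($\omega(fg)=\omega(g)\omega(f)$, without signs) with $x^a_i\leftrightarrow\partial_{x^a_i}$, $y^a_r\leftrightarrow\partial_{y^a_r}$, extended to $\mathcal D(\!(z^{-1},\partial_z^{-1})\!)$ by $\omega(f z^i\partial_z^j)=\omega(f)z^j\partial_z^i$. Let $\phi_{\mathbf z}:U(\mathfrak{gl}_d[t])\to\mathcal D$ and $\varphi_{\mathbf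 w}:U(\mathfrak{gl}_{p+q|m+n}[t])\to\mathcal D$ be the homomorphisms with $$\phi_{\mathbf z}(e_{ab}[k])=-\sum_{r=1}^{p+q}z_r^k\,y^b_r\partial_{y^a_r}+\sum_{i=1}^{m+n}z_{p+q+i}^k\,x^a_i\partial_{x^b_i},$$ $$\varphi_{\mathbf w}(E^r_s[k])=\sum_{a=1}^d(-1)^{|s|+1}w_a^k\,\partial_{y^a_r}y^a_s,\qquad \varphi_{\mathbf w}(E^r_{p+q+j}[k])=\sum_{a=1}^d w_a^k\,\partial_{y^a_r}\partial_{x^a_j},$$ $$\varphi_{\mathbf w}(E^{p+q+i}_s[k])=\sum_{a=1}^d(-1)^{|s|+1}w_a^k\,x^a_iy^a_s,\qquad \varphi_{\mathbf w}(E^{p+q+i}_{p+q+j}[k])=\sum_{a=1}^d w_a^k\,x^a_i\partial_{x^a_j},$$ for $1\le a,b\le d$, $1\le r,s\le p+q$, $1\le i,j\le m+n$, $k\ge0$. *Matrices and determinants.* Put $$\mathcal L_d^{\mathbf w}=\big[\delta_{ab}(\partial_z-w_a)-e_{ab}(z)\big]_{a,b=1}^d,\qquad \mathcal L_{p+q|m+n}^{\mathbf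 z}=\big[\delta_{ij}(\partial_z-z_i)-(-1)^{|i|}E^i_j(z)\big]_{i,j=1}^{p+q+m+n}.$$ For a $k\times k$ matrix $A$ over a ring, $\operatorname{cdet}(A)=\sum_{\sigma\in\mathfrak S_k}(-1)^{l(\sigma)}a_{\sigma(1),1}\cdots a_{\sigma(k),k}$. The principal quasiminor $d_i(A)$ is $\big((A_i^{-1})_{ii}\big)^{-1}$, where $A_i$ is the upper left $i\times i$ submatrix of $A$; it is defined if $A_i$ and $(A_i^{-1})_{ii}$ are invertible. $A$ is sufficiently invertible if all $d_i(A)$ are defined, and then $\operatorname{Ber}^{\mathbf s}(A)=d_1(A)^{(-1)^{s_1}}\cdots d_k(A)^{(-1)^{s_k}}$. Finally let $$R_{p|q}(z)=\frac{(z-z_1)\cdots(z-z_p)}{(z-z_{p+1})\cdots(z-z_{p+q})},\qquad R'_{m|n}(z)=\frac{(z-z_{p+q+1})\cdots(z-z_{p+q+m})}{(z-z_{p+q+m+1})\cdots(z-z_{p+q+m+n})}.$$ **Proposition.** The matrix $\mathcal L_{p+q|m+n}^{\mathbf z}$ over $U(\mathfrak{gl}_{p+q|m+n}[t])(\!(z^{-1},\partial_z^{-1})\!)$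 is sufficiently invertible, so that its Berezinian of type $\mathbf s$ is defined, and in $\mathcal D(\!(z^{-1},\partial_z^{-1})\!)$ $$(z-w_1)\cdots(z-w_d)\cdot\varphi_{\mathbf w}\operatorname{Ber}^{\mathbf s}\big(\mathcal L_{p+q|m+n}^{\mathbf z}\big)=\omega\Big(R'_{m|n}(z)\cdot\phi_{\mathbf z}\operatorname{cdet}\big(\mathcal L_d^{\mathbf w}\big)\cdot R_{p|q}(z)\Big).$$ -/

import Mathlib

noncomputable section

namespace BetheDuality

open scoped Nat

/-- Pseudo-differential operators `A((z⁻¹, ∂_z⁻¹))` over a ring `A`: the formal series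
`∑_{i ≤ r} ∑_{j ≤ s} a_{ij} z^i ∂_z^j` with integer exponents bounded above;
`coeff i j` is the coefficient `a_{ij} ∈ A` of `z^i ∂_z^j`. -/
@[ext]
structure PseudoDiff (A : Type*) [Ring A] where
  coeff : ℤ → ℤ → A
  bounded : ∃ r s : ℤ, ∀ i j : ℤ, (r < i ∨ s < j) → coeff i j = 0

namespace PseudoDiff

variable {A : Type*} [Ring A]

/-- The coefficient `binom(j,t) binom(k,t) t!` of `z^{k-t} ∂^{j-t}` in the expansion
`∂^j z^k = ∑_t binom(j,t) binom(k,t) t! z^{k-t} ∂^{j-t}`, for integers `j`, `k`. -/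
def contr (j k : ℤ) (t : ℕ) : ℤ := Ring.choose j t * Ring.choose k t * (t ! : ℤ)

/-- The coefficient of `z^M ∂^N` in the product of `f = ∑ f_{ij} z^i ∂^j` and `g = ∑ g_{kl} z^k ∂^l`,
where `∂^j z^k` is expanded as above: the terms are
`contr j k t • (f_{ij} g_{kl}) z^{i+k-t} ∂^{j+l-t}` with `k = M - i + t` and `l = N - j + t`.
Only finitely many of them are nonzero. -/
def mulCoeff (f g : ℤ → ℤ → A) (M N : ℤ) : A :=
  ∑ᶠ x : ℕ × ℤ × ℤ, contr x.2.2 (M - x.2.1 + x.1) x.1 •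
    (f x.2.1 x.2.2 * g (M - x.2.1 + x.1) (N - x.2.2 + x.1))

theorem contr_zero (j k : ℤ) : contr j k 0 = 1 := by simp [contr]

theorem contr_zero_left (k : ℤ) (t : ℕ) (ht : t ≠ 0) : contr 0 k t = 0 := by
  simp [contr, Ring.choose_zero_ite, ht]

theorem contr_zero_right (k : ℤ) (t : ℕ) (ht : t ≠ 0) : contr k 0 t = 0 := by
  simp [contr, Ring.choose_zero_ite, ht]

/-- The exponents of `f` are bounded above by `r` and `s`. -/
def Bdd (f : ℤ → ℤ → A) (r s : ℤ) : Prop := ∀ i j : ℤ, (r < i ∨ s < j) → f i j = 0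

theorem Bdd.le {f : ℤ → ℤ → A} {r s : ℤ} (h : Bdd f r s) {i j : ℤ} (hf : f i j ≠ 0) :
    i ≤ r ∧ j ≤ s := by
  constructor <;> by_contra! hc
  · exact hf (h i j (Or.inl hc))
  · exact hf (h i j (Or.inr hc))

theorem finite_mul_support {f g : ℤ → ℤ → A} {r s r' s' : ℤ} (hf : Bdd f r s) (hg : Bdd g r' s')
    (M N : ℤ) : (fun x : ℕ × ℤ × ℤ => contr x.2.2 (M - x.2.1 + x.1) x.1 •
    (f x.2.1 x.2.2 * g (M - x.2.1 + x.1) (N - x.2.2 + x.1))).support.Finite := by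
  refine ((Set.finite_Icc 0 (r + r' - M).toNat).prod ((Set.finite_Icc (M - r') r).prod
    (Set.finite_Icc (N - s') s))).subset ?_
  rintro ⟨t, i, j⟩ hx
  simp only [Function.mem_support] at hx
  have h0 := right_ne_zero_of_smul hx
  have h1 := hf.le (left_ne_zero_of_mul h0)
  have h2 := hg.le (right_ne_zero_of_mul h0)
  simp only [Set.mem_prod, Set.mem_Icc]
  omega

theorem bdd_mulCoeff {f g : ℤ → ℤ → A} {r s r' s' : ℤ} (hf : Bdd f r s) (hg : Bdd g r' s') :
    Bdd (mulCoeff f g) (r + r') (s + s') := by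
  intro M N h
  refine finsum_eq_zero_of_forall_eq_zero ?_
  rintro ⟨t, i, j⟩
  by_contra hx
  have h0 := right_ne_zero_of_smul hx
  have h1 := hf.le (left_ne_zero_of_mul h0)
  have h2 := hg.le (right_ne_zero_of_mul h0)
  simp only at h1 h2
  omega

theorem finsum_antidiag {P : Type*} (F : P × ℕ → A) (G : P × ℕ × ℕ → A)
    (hG : G.support.Finite)
    (h : ∀ p u, F (p, u) = ∑ bc ∈ Finset.HasAntidiagonal.antidiagonal u, G (p, bc)) :
    ∑ᶠ x, F x = ∑ᶠ y, G y := by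
  classical
  set S := hG.toFinset with hS
  set π : P × ℕ × ℕ → P × ℕ := fun y => (y.1, y.2.1 + y.2.2) with hπ
  have hF : ∀ x, F x = ∑ y ∈ S with π y = x, G y := by
    rintro ⟨p, u⟩
    rw [h p u]
    refine (Finset.sum_map (Finset.HasAntidiagonal.antidiagonal u)
      ⟨fun bc => (p, bc), fun _ _ h => (Prod.mk.inj h).2⟩ G).symm.trans ?_
    symm
    refine Finset.sum_subset ?_ ?_
    · rintro ⟨p', b, c⟩ hy
      simp only [Finset.mem_filter, hπ, Prod.mk.injEq] at hy
      obtain ⟨-, rfl, hu⟩ := hy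
      exact Finset.mem_map.2 ⟨(b, c), Finset.HasAntidiagonal.mem_antidiagonal.2 hu, rfl⟩
    · rintro ⟨p', b, c⟩ hy hn
      obtain ⟨⟨b', c'⟩, h1, h2⟩ := Finset.mem_map.1 hy
      rw [Finset.HasAntidiagonal.mem_antidiagonal] at h1
      obtain ⟨rfl, rfl, rfl⟩ : p = p' ∧ b' = b ∧ c' = c := by
        have h3 : (p, (b', c')) = (p', (b, c)) := h2
        simpa only [Prod.mk.injEq] using h3
      by_contra hne
      exact hn (by simp [hS, hπ, h1, hne])
  rw [finsum_eq_sum G hG, finsum_eq_sum_of_support_subset (s := S.image π) F,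
    ← Finset.sum_fiberwise_of_maps_to (s := S) (t := S.image π) (g := π)
      (fun y hy => Finset.mem_image_of_mem _ hy)]
  · exact Finset.sum_congr rfl fun x _ => hF x
  · intro x hx
    rw [Function.mem_support, hF x] at hx
    obtain ⟨y, hy, -⟩ := Finset.exists_ne_zero_of_sum_ne_zero hx
    rw [Finset.mem_filter] at hy
    exact Finset.mem_coe.2 (Finset.mem_image.2 ⟨y, hy.1, hy.2⟩)

theorem choose_fall (x : ℤ) (a c : ℕ) :
    Ring.choose x (a + c) * ((a + c)! : ℤ) =
      (Ring.choose x a * (a ! : ℤ)) * (Ring.choose (x - a) c * (c ! : ℤ)) := by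
  have h := Ring.choose_smul_choose x (Nat.le_add_right a c)
  have h2 : ((a + c).choose a * a ! * c ! : ℤ) = (a + c)! := by
    have := Nat.choose_mul_factorial_mul_factorial (Nat.le_add_right a c)
    rw [Nat.add_sub_cancel_left] at this
    exact_mod_cast this
  rw [Nat.add_sub_cancel_left, nsmul_eq_mul] at h
  rw [← h2]
  linear_combination (a ! * c ! : ℤ) * h

/-- Auxiliary weight in the proof of associativity. -/
def weight (j k l m : ℤ) (a b c : ℕ) : ℤ :=
  Ring.choose j a * Ring.choose (j - a) c * Ring.choose l b *
    (Ring.choose k a * (a ! : ℤ)) * (Ring.choose m (b + c) * ((b + c)! : ℤ))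

theorem contr_left (j k l m : ℤ) (t u : ℕ) :
    contr (j + l - t) m u * contr j k t =
      ∑ bc ∈ Finset.HasAntidiagonal.antidiagonal u, weight j k l m t bc.1 bc.2 := by
  have h : Ring.choose (j + l - t) u = ∑ bc ∈ Finset.HasAntidiagonal.antidiagonal u,
      Ring.choose l bc.1 * Ring.choose (j - t) bc.2 := by
    rw [← Ring.add_choose_eq u (Commute.all l (j - t))]
    congr 1; ring
  rw [contr, h, Finset.sum_mul, Finset.sum_mul, Finset.sum_mul]
  refine Finset.sum_congr rfl fun bc hbc => ?_
  rw [Finset.HasAntidiagonal.mem_antidiagonal] at hbc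
  rw [weight, contr, hbc]
  ring

theorem contr_right (j k l m : ℤ) (v w : ℕ) :
    contr j (k + m - v) w * contr l m v =
      ∑ ac ∈ Finset.HasAntidiagonal.antidiagonal w, weight j k l m ac.1 v ac.2 := by
  have h : Ring.choose (k + m - v) w = ∑ ac ∈ Finset.HasAntidiagonal.antidiagonal w,
      Ring.choose k ac.1 * Ring.choose (m - v) ac.2 := by
    rw [← Ring.add_choose_eq w (Commute.all k (m - v))]
    congr 1; ring
  rw [contr, h, Finset.mul_sum, Finset.sum_mul, Finset.sum_mul]
  refine Finset.sum_congr rfl fun ac hac => ?_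
  rw [Finset.HasAntidiagonal.mem_antidiagonal] at hac
  have h1 := choose_fall j ac.1 ac.2
  rw [hac] at h1
  rw [weight, contr, choose_fall m v ac.2]
  linear_combination (Ring.choose k ac.1 * Ring.choose (m - v) ac.2 *
    (Ring.choose l v * Ring.choose m v * (v ! : ℤ))) * h1

theorem finite_triple {Q : Type*} {f g h : ℤ → ℤ → A} {r s r' s' r'' s'' : ℤ} (hf : Bdd f r s)
    (hg : Bdd g r' s') (hh : Bdd h r'' s'') (M N : ℤ) (F : Q → A)
    (e : Q → (ℕ × ℤ × ℤ × ℤ × ℤ) × (ℕ × ℕ)) (he : Function.Injective e)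
    (hF : ∀ q, F q ≠ 0 → ∃ a i j k l b c, e q = ((a, i, j, k, l), (b, c)) ∧ f i j ≠ 0 ∧
      g k l ≠ 0 ∧ h (M - i - k + (a + b + c : ℕ)) (N - j - l + (a + b + c : ℕ)) ≠ 0) :
    F.support.Finite := by
  set K := (r + r' + r'' - M).toNat
  refine Set.Finite.subset (Set.Finite.preimage he.injOn
    (((Set.finite_Icc 0 K).prod ((Set.finite_Icc (M - r' - r'') r).prod
      ((Set.finite_Icc (N - s' - s'') s).prod ((Set.finite_Icc (M - r - r'') r').prod
      (Set.finite_Icc (N - s - s'') s'))))).prod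
      ((Set.finite_Icc 0 K).prod (Set.finite_Icc 0 K)))) ?_
  intro q hq
  obtain ⟨a, i, j, k, l, b, c, h0, h1, h2, h3⟩ := hF q hq
  have h1 := hf.le h1
  have h2 := hg.le h2
  have h3 := hh.le h3
  simp only [Set.mem_preimage, h0, Set.mem_prod, Set.mem_Icc]
  omega

/-- Auxiliary: the common expansion of `(f g) h` and `f (g h)`. -/
def triple (f g h : ℤ → ℤ → A) (M N : ℤ) (x : (ℕ × ℤ × ℤ × ℤ × ℤ) × (ℕ × ℕ)) : A :=
  match x with
  | ((a, i, j, k, l), (b, c)) =>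
    weight j k l (M - i - k + (a + b + c : ℕ)) a b c • (f i j * g k l *
      h (M - i - k + (a + b + c : ℕ)) (N - j - l + (a + b + c : ℕ)))

/-- Auxiliary reindexing. -/
def eqvL : (ℕ × ℤ × ℤ × ℤ × ℤ) × ℕ ≃ (ℕ × ℤ × ℤ) × (ℕ × ℤ × ℤ) where
  toFun x := ((x.2, x.1.2.1 + x.1.2.2.2.1 - x.1.1, x.1.2.2.1 + x.1.2.2.2.2 - x.1.1),
    (x.1.1, x.1.2.1, x.1.2.2.1))
  invFun y := ((y.2.1, y.2.2.1, y.2.2.2, y.1.2.1 - y.2.2.1 + y.2.1, y.1.2.2 - y.2.2.2 + y.2.1),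
    y.1.1)
  left_inv := by rintro ⟨⟨t, i, j, k, l⟩, u⟩; ext <;> simp <;> ring
  right_inv := by rintro ⟨⟨u, I, J⟩, ⟨t, i, j⟩⟩; ext <;> simp <;> ring

/-- Auxiliary reindexing. -/
def eqvR : (ℕ × ℤ × ℤ × ℤ × ℤ) × ℕ ≃ (ℕ × ℤ × ℤ) × (ℕ × ℤ × ℤ) where
  toFun x := ((x.2, x.1.2.1, x.1.2.2.1), (x.1.1, x.1.2.2.2.1, x.1.2.2.2.2))
  invFun y := ((y.2.1, y.1.2.1, y.1.2.2, y.2.2.1, y.2.2.2), y.1.1)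
  left_inv := by rintro ⟨⟨t, i, j, k, l⟩, u⟩; rfl
  right_inv := by rintro ⟨⟨u, I, J⟩, ⟨t, i, j⟩⟩; rfl

/-- Auxiliary reindexing. -/
def eqvS : (ℕ × ℤ × ℤ × ℤ × ℤ) × (ℕ × ℕ) ≃ (ℕ × ℤ × ℤ × ℤ × ℤ) × (ℕ × ℕ) where
  toFun x := ((x.2.1, x.1.2), (x.1.1, x.2.2))
  invFun x := ((x.2.1, x.1.2), (x.1.1, x.2.2))
  left_inv _ := rfl
  right_inv _ := rfl

theorem finite_triple_support {f g h : ℤ → ℤ → A} {r s r' s' r'' s'' : ℤ} (hf : Bdd f r s)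
    (hg : Bdd g r' s') (hh : Bdd h r'' s'') (M N : ℤ) : (triple f g h M N).support.Finite := by
  refine finite_triple hf hg hh M N _ id Function.injective_id ?_
  rintro ⟨⟨a, i, j, k, l⟩, b, c⟩ hq
  have h0 := right_ne_zero_of_smul hq
  exact ⟨a, i, j, k, l, b, c, rfl, left_ne_zero_of_mul (left_ne_zero_of_mul h0),
    right_ne_zero_of_mul (left_ne_zero_of_mul h0), right_ne_zero_of_mul h0⟩

theorem mulCoeff_left {f g h : ℤ → ℤ → A} {r s r' s' r'' s'' : ℤ} (hf : Bdd f r s)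
    (hg : Bdd g r' s') (hh : Bdd h r'' s'') (M N : ℤ) :
    mulCoeff (mulCoeff f g) h M N = ∑ᶠ x, triple f g h M N x := by
  let Φ : (ℕ × ℤ × ℤ) × (ℕ × ℤ × ℤ) → A := fun z =>
    (contr z.1.2.2 (M - z.1.2.1 + z.1.1) z.1.1 *
      contr z.2.2.2 (z.1.2.1 - z.2.2.1 + z.2.1) z.2.1) •
    (f z.2.2.1 z.2.2.2 * g (z.1.2.1 - z.2.2.1 + z.2.1) (z.1.2.2 - z.2.2.2 + z.2.1) *
      h (M - z.1.2.1 + z.1.1) (N - z.1.2.2 + z.1.1))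
  have h1 : mulCoeff (mulCoeff f g) h M N = ∑ᶠ x, ∑ᶠ y, Φ (x, y) := by
    rw [mulCoeff]
    refine finsum_congr fun x => ?_
    rw [mulCoeff, finsum_mul' _ _ (finite_mul_support hf hg _ _),
      smul_finsum' _ (((finite_mul_support hf hg _ _).subset
        (Function.support_mul_subset_left _ _)))]
    refine finsum_congr fun y => ?_
    simp only [Φ]
    rw [smul_mul_assoc, smul_smul]
  have h2 : ∀ p u, (Φ ∘ eqvL) (p, u) =
      ∑ bc ∈ Finset.HasAntidiagonal.antidiagonal u, triple f g h M N (p, bc) := by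
    rintro ⟨t, i, j, k, l⟩ u
    have e1 : i + k - (t : ℤ) - i + t = k := by ring
    have e2 : j + l - (t : ℤ) - j + t = l := by ring
    have e3 : M - (i + k - (t : ℤ)) + u = M - i - k + (t + u : ℕ) := by push_cast; ring
    have e4 : N - (j + l - (t : ℤ)) + u = N - j - l + (t + u : ℕ) := by push_cast; ring
    simp only [Φ, eqvL, Function.comp_apply, Equiv.coe_fn_mk]
    rw [e1, e2, e3, e4, contr_left, Finset.sum_smul]
    refine Finset.sum_congr rfl fun bc hbc => ?_
    rw [Finset.HasAntidiagonal.mem_antidiagonal] at hbc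
    obtain ⟨b, c⟩ := bc
    simp only at hbc
    subst hbc
    simp only [triple, add_assoc]
  have h3 : (Φ ∘ eqvL).support.Finite := by
    refine finite_triple hf hg hh M N _ (fun x => (x.1, (x.2, 0))) ?_ ?_
    · rintro ⟨p, u⟩ ⟨p', u'⟩ hx
      simp only [Prod.mk.injEq, and_true] at hx
      simp [hx]
    rintro ⟨⟨t, i, j, k, l⟩, u⟩ hq
    refine ⟨t, i, j, k, l, u, 0, rfl, ?_⟩
    rw [h2] at hq
    obtain ⟨⟨b, c⟩, hbc, hne⟩ := Finset.exists_ne_zero_of_sum_ne_zero hq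
    have h0 := right_ne_zero_of_smul hne
    rw [Finset.HasAntidiagonal.mem_antidiagonal] at hbc
    simp only at hbc
    subst hbc
    rw [add_assoc t b c] at h0
    exact ⟨left_ne_zero_of_mul (left_ne_zero_of_mul h0),
      right_ne_zero_of_mul (left_ne_zero_of_mul h0), right_ne_zero_of_mul h0⟩
  have h4 : Φ.support.Finite := by
    have : Φ = (Φ ∘ eqvL) ∘ eqvL.symm := by ext; simp
    rw [this, Function.support_comp_eq_preimage]
    exact h3.preimage eqvL.symm.injective.injOn
  rw [h1, ← finsum_curry _ h4, ← finsum_comp_equiv eqvL]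
  exact finsum_antidiag (Φ ∘ eqvL) _ (finite_triple_support hf hg hh M N) h2

theorem mulCoeff_right {f g h : ℤ → ℤ → A} {r s r' s' r'' s'' : ℤ} (hf : Bdd f r s)
    (hg : Bdd g r' s') (hh : Bdd h r'' s'') (M N : ℤ) :
    mulCoeff f (mulCoeff g h) M N = ∑ᶠ x, triple f g h M N x := by
  let Φ : (ℕ × ℤ × ℤ) × (ℕ × ℤ × ℤ) → A := fun z =>
    (contr z.1.2.2 (M - z.1.2.1 + z.1.1) z.1.1 *
      contr z.2.2.2 (M - z.1.2.1 + z.1.1 - z.2.2.1 + z.2.1) z.2.1) •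
    (f z.1.2.1 z.1.2.2 * g z.2.2.1 z.2.2.2 *
      h (M - z.1.2.1 + z.1.1 - z.2.2.1 + z.2.1) (N - z.1.2.2 + z.1.1 - z.2.2.2 + z.2.1))
  have h1 : mulCoeff f (mulCoeff g h) M N = ∑ᶠ x, ∑ᶠ y, Φ (x, y) := by
    rw [mulCoeff]
    refine finsum_congr fun x => ?_
    rw [mulCoeff, mul_finsum' _ _ (finite_mul_support hg hh _ _),
      smul_finsum' _ (((finite_mul_support hg hh _ _).subset
        (Function.support_mul_subset_right _ _)))]
    refine finsum_congr fun y => ?_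
    simp only [Φ]
    rw [mul_smul_comm, smul_smul, mul_assoc]
  have h2 : ∀ p u, (Φ ∘ eqvR) (p, u) =
      ∑ bc ∈ Finset.HasAntidiagonal.antidiagonal u, (triple f g h M N ∘ eqvS) (p, bc) := by
    rintro ⟨v, i, j, k, l⟩ w
    have e3 : M - i + w - k + v = M - i - k + (w + v : ℕ) := by push_cast; ring
    have e4 : N - j + w - l + v = N - j - l + (w + v : ℕ) := by push_cast; ring
    have e5 : M - i + w = k + (M - i - k + (w + v : ℕ)) - v := by push_cast; ring
    simp only [Φ, eqvR, Function.comp_apply, Equiv.coe_fn_mk]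
    rw [e3, e4, e5, contr_right, Finset.sum_smul]
    refine Finset.sum_congr rfl fun ac hac => ?_
    rw [Finset.HasAntidiagonal.mem_antidiagonal] at hac
    obtain ⟨a, c⟩ := ac
    simp only at hac
    subst hac
    have e6 : a + c + v = a + v + c := by ring
    simp only [triple, eqvS, Equiv.coe_fn_mk, e6]
  have h5 : (triple f g h M N ∘ eqvS).support.Finite := by
    rw [Function.support_comp_eq_preimage]
    exact (finite_triple_support hf hg hh M N).preimage eqvS.injective.injOn
  have h3 : (Φ ∘ eqvR).support.Finite := by
    refine finite_triple hf hg hh M N _ (fun x => (x.1, (x.2, 0))) ?_ ?_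
    · rintro ⟨p, u⟩ ⟨p', u'⟩ hx
      simp only [Prod.mk.injEq, and_true] at hx
      simp [hx]
    rintro ⟨⟨v, i, j, k, l⟩, w⟩ hq
    refine ⟨v, i, j, k, l, w, 0, rfl, ?_⟩
    rw [h2] at hq
    obtain ⟨⟨a, c⟩, hac, hne⟩ := Finset.exists_ne_zero_of_sum_ne_zero hq
    have h0 := right_ne_zero_of_smul hne
    rw [Finset.HasAntidiagonal.mem_antidiagonal] at hac
    simp only at hac
    subst hac
    have e6 : a + v + c = v + (a + c) + 0 := by ring
    change f i j * g k l * h (M - i - k + (a + v + c : ℕ)) (N - j - l + (a + v + c : ℕ)) ≠ 0 at h0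
    rw [e6] at h0
    exact ⟨left_ne_zero_of_mul (left_ne_zero_of_mul h0),
      right_ne_zero_of_mul (left_ne_zero_of_mul h0), right_ne_zero_of_mul h0⟩
  have h4 : Φ.support.Finite := by
    have : Φ = (Φ ∘ eqvR) ∘ eqvR.symm := by ext; simp
    rw [this, Function.support_comp_eq_preimage]
    exact h3.preimage eqvR.symm.injective.injOn
  rw [h1, ← finsum_curry _ h4, ← finsum_comp_equiv eqvR, ← finsum_comp_equiv eqvS]
  exact finsum_antidiag (Φ ∘ eqvR) _ h5 h2

theorem bdd_coeff (f : PseudoDiff A) : ∃ r s : ℤ, Bdd f.coeff r s := f.bounded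

instance : Zero (PseudoDiff A) := ⟨⟨fun _ _ => 0, 0, 0, fun _ _ _ => rfl⟩⟩

instance : Add (PseudoDiff A) := ⟨fun f g => ⟨fun i j => f.coeff i j + g.coeff i j, by
  obtain ⟨r, s, hf⟩ := f.bounded
  obtain ⟨r', s', hg⟩ := g.bounded
  refine ⟨max r r', max s s', fun i j h => ?_⟩
  rw [hf i j (by omega), hg i j (by omega), add_zero]⟩⟩

instance : Neg (PseudoDiff A) := ⟨fun f => ⟨fun i j => -f.coeff i j, by
  obtain ⟨r, s, hf⟩ := f.bounded
  exact ⟨r, s, fun i j h => by rw [hf i j h, neg_zero]⟩⟩⟩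

/-- The monomial `a z^i ∂^j`. -/
def mono (a : A) (i j : ℤ) : PseudoDiff A :=
  ⟨fun i' j' => if i' = i ∧ j' = j then a else 0, i, j, fun i' j' h => if_neg (by omega)⟩

instance : One (PseudoDiff A) := ⟨mono 1 0 0⟩

instance : Mul (PseudoDiff A) := ⟨fun f g => ⟨mulCoeff f.coeff g.coeff, by
  obtain ⟨r, s, hf⟩ := bdd_coeff f
  obtain ⟨r', s', hg⟩ := bdd_coeff g
  exact ⟨_, _, bdd_mulCoeff hf hg⟩⟩⟩

@[simp] theorem coeff_zero (i j : ℤ) : (0 : PseudoDiff A).coeff i j = 0 := rfl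
@[simp] theorem coeff_add (f g : PseudoDiff A) (i j : ℤ) :
    (f + g).coeff i j = f.coeff i j + g.coeff i j := rfl
@[simp] theorem coeff_neg (f : PseudoDiff A) (i j : ℤ) : (-f).coeff i j = -f.coeff i j := rfl
theorem coeff_one (i j : ℤ) : (1 : PseudoDiff A).coeff i j = if i = 0 ∧ j = 0 then 1 else 0 := rfl
theorem coeff_mul (f g : PseudoDiff A) : (f * g).coeff = mulCoeff f.coeff g.coeff := rfl

theorem ext_coeff {f g : PseudoDiff A} (h : ∀ i j, f.coeff i j = g.coeff i j) : f = g :=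
  PseudoDiff.ext (funext fun i => funext fun j => h i j)

theorem one_mul_aux (f : PseudoDiff A) : 1 * f = f := by
  refine ext_coeff fun M N => ?_
  rw [coeff_mul, mulCoeff, finsum_eq_single _ (0, 0, 0)]
  · simp [contr_zero, coeff_one]
  · rintro ⟨t, i, j⟩ hx
    by_cases h : i = 0 ∧ j = 0
    · obtain ⟨rfl, rfl⟩ := h
      have ht : t ≠ 0 := by rintro rfl; exact hx rfl
      simp [contr_zero_left _ _ ht]
    · simp [coeff_one, h]

theorem mul_one_aux (f : PseudoDiff A) : f * 1 = f := by
  refine ext_coeff fun M N => ?_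
  rw [coeff_mul, mulCoeff, finsum_eq_single _ (0, M, N)]
  · simp [contr_zero, coeff_one]
  · rintro ⟨t, i, j⟩ hx
    by_cases h : M - i + t = 0 ∧ N - j + t = 0
    · have ht : t ≠ 0 := by
        rintro rfl
        refine hx ?_
        simp only [Prod.mk.injEq, true_and]
        omega
      simp only [h.1]
      simp [contr_zero_right _ _ ht]
    · simp [coeff_one, h]

instance : Ring (PseudoDiff A) where
  add_assoc f g h := ext_coeff fun i j => by simp [add_assoc]
  zero_add f := ext_coeff fun i j => by simp
  add_zero f := ext_coeff fun i j => by simp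
  add_comm f g := ext_coeff fun i j => by simp [add_comm]
  neg_add_cancel f := ext_coeff fun i j => by simp
  nsmul := nsmulRec
  zsmul := zsmulRec
  zero_mul f := ext_coeff fun i j => by simp [coeff_mul, mulCoeff]
  mul_zero f := ext_coeff fun i j => by simp [coeff_mul, mulCoeff]
  one_mul := one_mul_aux
  mul_one := mul_one_aux
  left_distrib f g h := ext_coeff fun M N => by
    obtain ⟨r, s, hf⟩ := bdd_coeff f
    obtain ⟨r', s', hg⟩ := bdd_coeff g
    obtain ⟨r'', s'', hh⟩ := bdd_coeff h
    simp only [coeff_add, coeff_mul, mulCoeff]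
    rw [← finsum_add_distrib (finite_mul_support hf hg M N) (finite_mul_support hf hh M N)]
    simp only [mul_add, smul_add]
  right_distrib f g h := ext_coeff fun M N => by
    obtain ⟨r, s, hf⟩ := bdd_coeff f
    obtain ⟨r', s', hg⟩ := bdd_coeff g
    obtain ⟨r'', s'', hh⟩ := bdd_coeff h
    simp only [coeff_add, coeff_mul, mulCoeff]
    rw [← finsum_add_distrib (finite_mul_support hf hh M N) (finite_mul_support hg hh M N)]
    simp only [add_mul, smul_add]
  mul_assoc f g h := ext_coeff fun M N => by
    obtain ⟨r, s, hf⟩ := bdd_coeff f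
    obtain ⟨r', s', hg⟩ := bdd_coeff g
    obtain ⟨r'', s'', hh⟩ := bdd_coeff h
    rw [coeff_mul, coeff_mul, coeff_mul, coeff_mul, mulCoeff_left hf hg hh,
      mulCoeff_right hf hg hh]

/-- Coefficientwise extension to pseudo-differential operators of a homomorphism `F`. -/
def map {A' : Type*} [Ring A'] (F : A →+* A') (f : PseudoDiff A) : PseudoDiff A' :=
  ⟨fun i j => F (f.coeff i j), by
    obtain ⟨r, s, hf⟩ := f.bounded
    exact ⟨r, s, fun i j h => by rw [hf i j h, map_zero]⟩⟩

/-- The extension `a z^i ∂^j ↦ ω(a) z^j ∂^i` of an additive map `ω` (an anti-involution of `A`)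
to pseudo-differential operators. -/
def swap (ω : A →+ A) (f : PseudoDiff A) : PseudoDiff A :=
  ⟨fun i j => ω (f.coeff j i), by
    obtain ⟨r, s, hf⟩ := f.bounded
    exact ⟨s, r, fun i j h => by rw [hf j i h.symm, map_zero]⟩⟩

/-- The series `∑_{r ≥ 0} a_r z^{-r-1}`. -/
def negSeries (a : ℕ → A) : PseudoDiff A :=
  ⟨fun i j => if i < 0 ∧ j = 0 then a (-i - 1).toNat else 0, -1, 0,
    fun i j h => if_neg (by omega)⟩

section Scalars

variable (A) [Algebra ℂ A]

/-- The element `z - c`. -/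
def zSub (c : ℂ) : PseudoDiff A := mono 1 1 0 - mono (algebraMap ℂ A c) 0 0

/-- The element `∂_z - c`. -/
def dSub (c : ℂ) : PseudoDiff A := mono 1 0 1 - mono (algebraMap ℂ A c) 0 0

/-- The expansion at infinity `∑_{r ≥ 0} c^r z^{-r-1}` of `1 / (z - c)`. -/
def zSubInv (c : ℂ) : PseudoDiff A := negSeries fun r => algebraMap ℂ A (c ^ r)

end Scalars

end PseudoDiff

section Determinants

variable {R : Type*} [Ring R] {k : ℕ}

/-- The column determinant `∑_σ (-1)^{l(σ)} a_{σ(1),1} ⋯ a_{σ(k),k}` (factors in this order). -/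
def cdet (A : Matrix (Fin k) (Fin k) R) : R :=
  ∑ σ : Equiv.Perm (Fin k), (Equiv.Perm.sign σ : ℤ) • (List.ofFn fun i => A (σ i) i).prod

/-- The `(i,j)`th quasideterminant of `A` is defined: `A` has a two-sided inverse `B`, and the
entry `B_{ji}` is invertible. -/
def QuasidetDefined (A : Matrix (Fin k) (Fin k) R) (i j : Fin k) : Prop :=
  IsUnit A ∧ IsUnit (Ring.inverse A j i)

/-- The `(i,j)`th quasideterminant `((A⁻¹)_{ji})⁻¹` (meaningful if `QuasidetDefined A i j`). -/
def quasidet (A : Matrix (Fin k) (Fin k) R) (i j : Fin k) : R :=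
  Ring.inverse (Ring.inverse A j i)

/-- The upper left square submatrix of `A` whose last row and column are those of index `i`. -/
def leading (A : Matrix (Fin k) (Fin k) R) (i : Fin k) :
    Matrix (Fin (i + 1)) (Fin (i + 1)) R :=
  A.submatrix (Fin.castLE i.isLt) (Fin.castLE i.isLt)

/-- The principal quasiminor of `A`: the quasideterminant of the leading submatrix at its lower
right corner. -/
def quasiminor (A : Matrix (Fin k) (Fin k) R) (i : Fin k) : R :=
  quasidet (leading A i) (Fin.last i) (Fin.last i)

/-- Every principal quasiminor of `A` is well defined. -/
def SufficientlyInvertible (A : Matrix (Fin k) (Fin k) R) : Prop :=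
  ∀ i : Fin k, QuasidetDefined (leading A i) (Fin.last i) (Fin.last i)

/-- The Berezinian of type `s`: the ordered product `d_1(A)^{±1} ⋯ d_k(A)^{±1}` of the principal
quasiminors, with exponent `1` at the even indices (`s i = 0`) and `-1` at the odd indices.
It is meaningful if `A` is sufficiently invertible. -/
def Ber (s : Fin k → ZMod 2) (A : Matrix (Fin k) (Fin k) R) : R :=
  (List.ofFn fun i => if s i = 0 then quasiminor A i else Ring.inverse (quasiminor A i)).prod

end Determinants

/-- The sign `(-1)^a` for a parity `a`. -/
def superSign (a : ZMod 2) : ℂ := if a = 0 then 1 else -1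

/-- The relations `[E^i_j[a], E^k_l[b]] = δ_{jk} E^i_l[a+b] - (-1)^{(|i|+|j|)(|k|+|l|)} δ_{il} E^k_j[a+b]`
of the current superalgebra `gl[t]`, where `|i| = s i`, `A[r] = A ⊗ t^r`, and `[x, y]` is the
supercommutator `x y - (-1)^{|x||y|} y x`. -/
inductive CurrentRel {N : ℕ} (s : Fin N → ZMod 2) :
    FreeAlgebra ℂ (Fin N × Fin N × ℕ) → FreeAlgebra ℂ (Fin N × Fin N × ℕ) → Prop
  | comm (i j k l : Fin N) (a b : ℕ) : CurrentRel s
      (FreeAlgebra.ι ℂ (i, j, a) * FreeAlgebra.ι ℂ (k, l, b))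
      (superSign ((s i + s j) * (s k + s l)) •
          (FreeAlgebra.ι ℂ (k, l, b) * FreeAlgebra.ι ℂ (i, j, a)) +
        ((if j = k then FreeAlgebra.ι ℂ (i, l, a + b) else 0) -
          superSign ((s i + s j) * (s k + s l)) •
            (if i = l then FreeAlgebra.ι ℂ (k, j, a + b) else 0)))

/-- The universal enveloping superalgebra `U(gl[t])` of the current superalgebra of the general
linear Lie superalgebra on a superspace with a basis of parities `s`: it is the associative unital
algebra generated by the basis `E^i_j[k]` of `gl[t]` subject to the supercommutation relations.
If `s = 0`, it is the universal enveloping algebra of the current Lie algebra `gl_N[t]`. -/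
abbrev CurrentEnv {N : ℕ} (s : Fin N → ZMod 2) : Type := RingQuot (CurrentRel s)

/-- The generator `E^i_j[k] = E^i_j ⊗ t^k`. -/
def CurrentEnv.E {N : ℕ} (s : Fin N → ZMod 2) (i j : Fin N) (k : ℕ) : CurrentEnv s :=
  RingQuot.mkAlgHom ℂ (CurrentRel s) (FreeAlgebra.ι ℂ (i, j, k))

/-- The defining relations of the Weyl superalgebra: the variables supercommute, the derivatives
supercommute, and `[∂_u, x_v] = δ_{uv}` (supercommutators; `x_u` and `∂_u` have parity `s u`;
the generator `Sum.inl u` is the variable `x_u` and `Sum.inr u` is the derivative `∂_u`). -/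
inductive WeylRel {κ : Type} [DecidableEq κ] (s : κ → ZMod 2) :
    FreeAlgebra ℂ (κ ⊕ κ) → FreeAlgebra ℂ (κ ⊕ κ) → Prop
  | var_var (u v : κ) : WeylRel s
      (FreeAlgebra.ι ℂ (Sum.inl u) * FreeAlgebra.ι ℂ (Sum.inl v))
      (superSign (s u * s v) • (FreeAlgebra.ι ℂ (Sum.inl v) * FreeAlgebra.ι ℂ (Sum.inl u)))
  | der_der (u v : κ) : WeylRel s
      (FreeAlgebra.ι ℂ (Sum.inr u) * FreeAlgebra.ι ℂ (Sum.inr v))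
      (superSign (s u * s v) • (FreeAlgebra.ι ℂ (Sum.inr v) * FreeAlgebra.ι ℂ (Sum.inr u)))
  | der_var (u v : κ) : WeylRel s
      (FreeAlgebra.ι ℂ (Sum.inr u) * FreeAlgebra.ι ℂ (Sum.inl v))
      (superSign (s u * s v) • (FreeAlgebra.ι ℂ (Sum.inl v) * FreeAlgebra.ι ℂ (Sum.inr u)) +
        if u = v then 1 else 0)

/-- The Weyl superalgebra in variables indexed by `κ` with parities `s`. -/
abbrev Weyl {κ : Type} [DecidableEq κ] (s : κ → ZMod 2) : Type := RingQuot (WeylRel s)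

namespace Weyl
variable {κ : Type} [DecidableEq κ] (s : κ → ZMod 2)

/-- The variable with index `u`. -/
def var (u : κ) : Weyl s := RingQuot.mkAlgHom ℂ (WeylRel s) (FreeAlgebra.ι ℂ (Sum.inl u))

/-- The derivative with respect to the variable with index `u`. -/
def der (u : κ) : Weyl s := RingQuot.mkAlgHom ℂ (WeylRel s) (FreeAlgebra.ι ℂ (Sum.inr u))

theorem var_mul_var (u v : κ) :
    var s u * var s v = superSign (s u * s v) • (var s v * var s u) := by
  simpa [var] using RingQuot.mkAlgHom_rel ℂ (WeylRel.var_var (s := s) u v)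

theorem der_mul_der (u v : κ) :
    der s u * der s v = superSign (s u * s v) • (der s v * der s u) := by
  simpa [der] using RingQuot.mkAlgHom_rel ℂ (WeylRel.der_der (s := s) u v)

theorem der_mul_var (u v : κ) :
    der s u * var s v = superSign (s u * s v) • (var s v * der s u) + if u = v then 1 else 0 := by
  have h := RingQuot.mkAlgHom_rel ℂ (WeylRel.der_var (s := s) u v)
  split_ifs at h ⊢ <;> simpa [der, var] using h

/-- The map `ω` as an algebra homomorphism to the opposite algebra. -/
def omegaHom : Weyl s →ₐ[ℂ] (Weyl s)ᵐᵒᵖ :=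
  RingQuot.liftAlgHom ℂ ⟨FreeAlgebra.lift ℂ (Sum.elim (fun u => MulOpposite.op (der s u))
    (fun u => MulOpposite.op (var s u))), by
    rintro x y (⟨u, v⟩ | ⟨u, v⟩ | ⟨u, v⟩)
    · simp only [map_mul, map_smul, FreeAlgebra.lift_ι_apply, Sum.elim_inl, ← MulOpposite.op_mul,
        ← MulOpposite.op_smul]
      rw [der_mul_der s v u, mul_comm (s v)]
    · simp only [map_mul, map_smul, FreeAlgebra.lift_ι_apply, Sum.elim_inr, ← MulOpposite.op_mul,
        ← MulOpposite.op_smul]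
      rw [var_mul_var s v u, mul_comm (s v)]
    · have h := der_mul_var s v u
      rw [mul_comm (s v)] at h
      by_cases huv : u = v
      · subst huv
        simp only [if_true] at h
        simp only [map_mul, map_smul, map_add, map_one, FreeAlgebra.lift_ι_apply, Sum.elim_inr,
          Sum.elim_inl, ← MulOpposite.op_mul, ← MulOpposite.op_smul, if_true]
        rw [h]; simp
      · simp only [if_neg huv, if_neg (Ne.symm huv)] at h ⊢
        simp only [map_mul, map_smul, map_add, map_zero, FreeAlgebra.lift_ι_apply, Sum.elim_inr,
          Sum.elim_inl, ← MulOpposite.op_mul, ← MulOpposite.op_smul]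
        rw [h]; simp⟩

/-- The anti-involution `ω` of the Weyl superalgebra which exchanges every variable with the
corresponding derivative; `ω(ab) = ω(b) ω(a)` without signs. -/
def omega : Weyl s →+ Weyl s where
  toFun a := (omegaHom s a).unop
  map_zero' := by simp
  map_add' := by simp

theorem omega_var (u : κ) : omega s (var s u) = der s u := by
  simp [omega, omegaHom, var]

theorem omega_der (u : κ) : omega s (der s u) = var s u := by
  simp [omega, omegaHom, der]

theorem omega_mul (a b : Weyl s) : omega s (a * b) = omega s b * omega s a := by
  simp [omega]

end Weyl

theorem superSign_add (a b : ZMod 2) : superSign (a + b) = superSign a * superSign b := by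
  have h : ∀ x : ZMod 2, x = 0 ∨ x = 1 := by decide
  have h2 : (1 + 1 : ZMod 2) = 0 := by decide
  rcases h a with rfl | rfl <;> rcases h b with rfl | rfl <;> simp [superSign, h2]

theorem superSign_mul_self (a : ZMod 2) : superSign a * superSign a = 1 := by
  rw [superSign]; split_ifs <;> norm_num

theorem oscillator_quad {B κ : Type} [Ring B] [Algebra ℂ B] [DecidableEq κ] (s : κ → ZMod 2)
    (R C : κ → B)
    (hRR : ∀ u v, R u * R v = superSign (s u * s v) • (R v * R u))
    (hCC : ∀ u v, C u * C v = superSign (s u * s v) • (C v * C u))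
    (hCR : ∀ u v, C u * R v = superSign (s u * s v) • (R v * C u) + if u = v then 1 else 0)
    (u v x y : κ) :
    R u * C v * (R x * C y) = superSign ((s u + s v) * (s x + s y)) • (R x * C y * (R u * C v)) +
      ((if v = x then R u * C y else 0) -
        superSign ((s u + s v) * (s x + s y)) • (if u = y then R x * C v else 0)) := by
  have h1 : R u * C v * (R x * C y) = superSign (s v * s x) • (R u * R x * (C v * C y)) +
      (if v = x then R u * C y else 0) := by
    have : R u * C v * (R x * C y) = R u * (C v * R x) * C y := by noncomm_ring
    rw [this, hCR]
    split_ifs <;> simp [mul_add, add_mul, mul_assoc]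
  have h2 : R x * C y * (R u * C v) = superSign (s y * s u) • (R x * R u * (C y * C v)) +
      (if u = y then R x * C v else 0) := by
    have : R x * C y * (R u * C v) = R x * (C y * R u) * C v := by noncomm_ring
    rw [this, hCR]
    simp only [eq_comm (a := u)]
    split_ifs <;> simp [mul_add, add_mul, mul_assoc]
  rw [h1, h2, hRR u x, hCC v y]
  have h3 : superSign ((s u + s v) * (s x + s y)) * superSign (s y * s u) =
      superSign (s v * s x) * (superSign (s u * s x) * superSign (s v * s y)) := by
    rw [add_mul, mul_add, mul_add, superSign_add, superSign_add, superSign_add, mul_comm (s y)]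
    linear_combination (superSign (s u * s x) * superSign (s v * s x) * superSign (s v * s y)) *
      superSign_mul_self (s u * s y)
  rw [smul_add, smul_smul, h3]
  simp only [smul_mul_assoc, mul_smul_comm, smul_smul]
  rw [mul_comm (superSign (s v * s y))]
  abel

theorem lift_ite {X B : Type} [Ring B] [Algebra ℂ B] (f : X → B) (P : Prop) [Decidable P] (x : X) :
    FreeAlgebra.lift ℂ f (if P then FreeAlgebra.ι ℂ x else 0) = if P then f x else 0 := by
  split_ifs <;> simp

section Duality

variable (p q m n d : ℕ)

/-- The sequence `s = (0^p, 1^q, 0^m, 1^n)` of parities of the index set `{1, …, p+q+m+n}`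
(indices are counted from `0` here). -/
def superType (i : Fin (p + q + m + n)) : ZMod 2 :=
  if (i : ℕ) < p ∨ (p + q ≤ (i : ℕ) ∧ (i : ℕ) < p + q + m) then 0 else 1

/-- The Weyl superalgebra `𝔻[x, y, η, ζ]`. Its variables are indexed by pairs `(i, a)`: for
`i < p + q` (counted from `0`) the variable `(i, a)` is `y_{i+1}^a`, with `y_{p+s}^a = ζ_s^a`, and
for `i ≥ p + q` it is `x_{i+1-p-q}^a`, with `x_{m+j}^a = η_j^a`. -/
abbrev WeylD : Type := Weyl (fun u : Fin (p + q + m + n) × Fin d => superType p q m n u.1)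

/-- The operator `∂_{y_i^a}` if `i ≤ p + q` (counted from `1`), and `x_{i-p-q}^a` otherwise. -/
def rowOp (i : Fin (p + q + m + n)) (a : Fin d) : WeylD p q m n d :=
  if (i : ℕ) < p + q then Weyl.der _ (i, a) else Weyl.var _ (i, a)

/-- The operator `(-1)^{|j|+1} y_j^a` if `j ≤ p + q` (counted from `1`), and `∂_{x_{j-p-q}^a}`
otherwise. -/
def colOp (j : Fin (p + q + m + n)) (a : Fin d) : WeylD p q m n d :=
  if (j : ℕ) < p + q then superSign (superType p q m n j + 1) • Weyl.var _ (j, a)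
  else Weyl.der _ (j, a)

/-- The image of `E^i_j[k]` under `φ_w`:
`∑_a w_a^k · {∂_{y_i^a} or x_{i-p-q}^a} · {(-1)^{|j|+1} y_j^a or ∂_{x_{j-p-q}^a}}`. -/
def varphiGen (w : Fin d → ℂ) (i j : Fin (p + q + m + n)) (k : ℕ) : WeylD p q m n d :=
  ∑ a, w a ^ k • (rowOp p q m n d i a * colOp p q m n d j a)

/-- The image of `e_{ab}[k]` under `φ_z`:
`-∑_{r ≤ p+q} z_r^k y_r^b ∂_{y_r^a} + ∑_{i ≤ m+n} z_{p+q+i}^k x_i^a ∂_{x_i^b}`. -/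
def phiGen (z : Fin (p + q + m + n) → ℂ) (a b : Fin d) (k : ℕ) : WeylD p q m n d :=
  -(∑ r with (r : Fin (p + q + m + n)).val < p + q,
      z r ^ k • (Weyl.var _ (r, b) * Weyl.der _ (r, a))) +
    ∑ i with p + q ≤ (i : Fin (p + q + m + n)).val,
      z i ^ k • (Weyl.var _ (i, a) * Weyl.der _ (i, b))

theorem Weyl.var_mul_der {κ : Type} [DecidableEq κ] (s : κ → ZMod 2) (u v : κ) :
    Weyl.var s u * Weyl.der s v = superSign (s u * s v) • (Weyl.der s v * Weyl.var s u) -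
      superSign (s u * s v) • if u = v then 1 else 0 := by
  rw [Weyl.der_mul_var, mul_comm (s v), smul_add, smul_smul, superSign_mul_self, one_smul]
  simp only [eq_comm (a := u), add_sub_cancel_right]

theorem row_row (u v : Fin (p + q + m + n) × Fin d) :
    rowOp p q m n d u.1 u.2 * rowOp p q m n d v.1 v.2 =
      superSign (superType p q m n u.1 * superType p q m n v.1) •
        (rowOp p q m n d v.1 v.2 * rowOp p q m n d u.1 u.2) := by
  simp only [rowOp]
  split_ifs with h1 h2 h2
  · exact Weyl.der_mul_der _ u v
  · refine (Weyl.der_mul_var _ u v).trans ?_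
    rw [if_neg (by rintro rfl; exact h2 h1), add_zero]
  · refine (Weyl.var_mul_der _ u v).trans ?_
    rw [if_neg (by rintro rfl; exact h1 h2), smul_zero, sub_zero]
  · exact Weyl.var_mul_var _ u v

theorem col_col (u v : Fin (p + q + m + n) × Fin d) :
    colOp p q m n d u.1 u.2 * colOp p q m n d v.1 v.2 =
      superSign (superType p q m n u.1 * superType p q m n v.1) •
        (colOp p q m n d v.1 v.2 * colOp p q m n d u.1 u.2) := by
  simp only [colOp]
  split_ifs with h1 h2 h2
  · have h := Weyl.var_mul_var (fun u : Fin (p + q + m + n) × Fin d => superType p q m n u.1) u v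
    simp only [Prod.mk.eta, smul_mul_assoc, mul_smul_comm, h]
    simp only [smul_smul]
    congr 1; ring
  · have h := Weyl.var_mul_der (fun u : Fin (p + q + m + n) × Fin d => superType p q m n u.1) u v
    rw [if_neg (by rintro rfl; exact h2 h1), smul_zero, sub_zero] at h
    simp only [Prod.mk.eta, smul_mul_assoc, mul_smul_comm, h]
    simp only [smul_smul]
    congr 1; ring
  · have h := Weyl.der_mul_var (fun u : Fin (p + q + m + n) × Fin d => superType p q m n u.1) u v
    rw [if_neg (by rintro rfl; exact h1 h2), add_zero] at h
    simp only [Prod.mk.eta, smul_mul_assoc, mul_smul_comm, h]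
    simp only [smul_smul]
    congr 1; ring
  · exact Weyl.der_mul_der _ u v

theorem superSign_add_one (a : ZMod 2) : superSign (a + 1) * superSign (a * a) = -1 := by
  have h : ∀ x : ZMod 2, x = 0 ∨ x = 1 := by decide
  have h2 : (1 + 1 : ZMod 2) = 0 := by decide
  rcases h a with rfl | rfl <;> simp [superSign, h2]

theorem col_row (u v : Fin (p + q + m + n) × Fin d) :
    colOp p q m n d u.1 u.2 * rowOp p q m n d v.1 v.2 =
      superSign (superType p q m n u.1 * superType p q m n v.1) •
        (rowOp p q m n d v.1 v.2 * colOp p q m n d u.1 u.2) + if u = v then 1 else 0 := by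
  set t : Fin (p + q + m + n) × Fin d → ZMod 2 := fun u => superType p q m n u.1 with ht
  by_cases h1 : (u.1 : ℕ) < p + q <;> by_cases h2 : (v.1 : ℕ) < p + q
  · have h := Weyl.var_mul_der t u v
    simp only [rowOp, colOp, h1, h2, if_true, Prod.mk.eta, smul_mul_assoc, mul_smul_comm]
    rw [h, smul_sub, smul_smul, smul_smul,
      mul_comm (superSign (superType p q m n u.1 + 1))]
    by_cases huv : u = v
    · subst huv
      have h3 := superSign_add_one (superType p q m n u.1)
      rw [mul_comm] at h3
      have h4 : superSign (t u * t u) * superSign (superType p q m n u.1 + 1) = -1 := h3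
      rw [if_pos rfl, smul_smul, h4]
      simp only [neg_smul, one_smul, sub_neg_eq_add]
      rfl
    · rw [if_neg huv, smul_zero, sub_zero, add_zero, smul_smul]
  · have h := Weyl.var_mul_var t u v
    have huv : u ≠ v := by rintro rfl; exact h2 h1
    simp only [rowOp, colOp, h1, h2, if_true, if_false, Prod.mk.eta, smul_mul_assoc,
      mul_smul_comm, huv, add_zero]
    rw [h, smul_smul, smul_smul, mul_comm]
  · have h := Weyl.der_mul_der t u v
    have huv : u ≠ v := by rintro rfl; exact h1 h2
    simp only [rowOp, colOp, h1, h2, if_true, if_false, Prod.mk.eta, huv, add_zero]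
    exact h
  · simp only [rowOp, colOp, h1, h2, if_false]
    exact Weyl.der_mul_var t u v

theorem varphiGen_rel (w : Fin d → ℂ) (i j k l : Fin (p + q + m + n)) (a b : ℕ) :
    varphiGen p q m n d w i j a * varphiGen p q m n d w k l b =
      superSign ((superType p q m n i + superType p q m n j) *
          (superType p q m n k + superType p q m n l)) •
        (varphiGen p q m n d w k l b * varphiGen p q m n d w i j a) +
      ((if j = k then varphiGen p q m n d w i l (a + b) else 0) -
        superSign ((superType p q m n i + superType p q m n j) *
          (superType p q m n k + superType p q m n l)) •
        (if i = l then varphiGen p q m n d w k j (a + b) else 0)) := by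
  have key := fun e f => oscillator_quad
    (fun u : Fin (p + q + m + n) × Fin d => superType p q m n u.1)
    (fun u => rowOp p q m n d u.1 u.2) (fun u => colOp p q m n d u.1 u.2)
    (row_row p q m n d) (col_col p q m n d) (col_row p q m n d) (i, e) (j, e) (k, f) (l, f)
  simp only at key
  set ε := superSign ((superType p q m n i + superType p q m n j) *
          (superType p q m n k + superType p q m n l))
  have h1 : varphiGen p q m n d w i j a * varphiGen p q m n d w k l b = ∑ e, ∑ f,
      (w e ^ a * w f ^ b) • (rowOp p q m n d i e * colOp p q m n d j e *
        (rowOp p q m n d k f * colOp p q m n d l f)) := by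
    rw [varphiGen, varphiGen, Finset.sum_mul_sum]
    simp only [smul_mul_smul_comm]
  have h2 : varphiGen p q m n d w k l b * varphiGen p q m n d w i j a = ∑ e, ∑ f,
      (w e ^ a * w f ^ b) • (rowOp p q m n d k f * colOp p q m n d l f *
        (rowOp p q m n d i e * colOp p q m n d j e)) := by
    rw [varphiGen, varphiGen, Finset.sum_mul_sum, Finset.sum_comm]
    simp only [smul_mul_smul_comm, mul_comm (w _ ^ b)]
  have h3 : (if j = k then varphiGen p q m n d w i l (a + b) else 0) = ∑ e, ∑ f,
      (w e ^ a * w f ^ b) • (if ((j, e) : Fin (p + q + m + n) × Fin d) = (k, f) then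
        rowOp p q m n d i e * colOp p q m n d l f else 0) := by
    by_cases hjk : j = k
    · simp [hjk, varphiGen, pow_add]
    · simp [hjk]
  have h4 : (if i = l then varphiGen p q m n d w k j (a + b) else 0) = ∑ e, ∑ f,
      (w e ^ a * w f ^ b) • (if ((i, e) : Fin (p + q + m + n) × Fin d) = (l, f) then
        rowOp p q m n d k f * colOp p q m n d j e else 0) := by
    by_cases hjk : i = l
    · simp [hjk, varphiGen, pow_add]
    · simp [hjk]
  rw [h1, h2, h3, h4]
  simp only [Finset.smul_sum, ← Finset.sum_add_distrib, ← Finset.sum_sub_distrib]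
  refine Finset.sum_congr rfl fun e _ => Finset.sum_congr rfl fun f _ => ?_
  rw [key, smul_add, smul_sub, smul_comm ε, smul_comm ε]

/-- The homomorphism `φ_w : U(gl_{p+q|m+n}[t]) → 𝔻`, `E^i_j[k] ↦ varphiGen w i j k`. -/
def varphi (w : Fin d → ℂ) : CurrentEnv (superType p q m n) →ₐ[ℂ] WeylD p q m n d :=
  RingQuot.liftAlgHom ℂ ⟨FreeAlgebra.lift ℂ (fun x => varphiGen p q m n d w x.1 x.2.1 x.2.2), by
    rintro _ _ ⟨i, j, k, l, a, b⟩
    have h := varphiGen_rel p q m n d w i j k l a b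
    simp only [map_add, map_sub, map_smul, map_mul, FreeAlgebra.lift_ι_apply, lift_ite]
    exact h⟩

theorem phiGen_eq (z : Fin (p + q + m + n) → ℂ) (a b : Fin d) (k : ℕ) :
    phiGen p q m n d z a b k = (∑ i, z i ^ k • (rowOp p q m n d i a * colOp p q m n d i b)) +
      if a = b then (∑ i : Fin (p + q + m + n), if (i : ℕ) < p + q then
        (superSign (superType p q m n i) * z i ^ k) • (1 : WeylD p q m n d) else 0) else 0 := by
  have h0 : (if a = b then (∑ i : Fin (p + q + m + n), if (i : ℕ) < p + q then
        (superSign (superType p q m n i) * z i ^ k) • (1 : WeylD p q m n d) else 0) else 0) =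
      ∑ i : Fin (p + q + m + n), if (i : ℕ) < p + q then
        if a = b then (superSign (superType p q m n i) * z i ^ k) • (1 : WeylD p q m n d) else 0
        else 0 := by
    split_ifs <;> simp
  rw [h0, phiGen, Finset.sum_filter, Finset.sum_filter, ← Finset.sum_neg_distrib,
    ← Finset.sum_add_distrib, ← Finset.sum_add_distrib]
  refine Finset.sum_congr rfl fun i _ => ?_
  by_cases hi : (i : ℕ) < p + q
  · have h := Weyl.var_mul_der
      (fun u : Fin (p + q + m + n) × Fin d => superType p q m n u.1) (i, b) (i, a)
    simp only [hi, if_true, not_le.2 hi, if_false, add_zero, rowOp, colOp]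
    rw [h]
    have hs : superSign (superType p q m n i + 1) = -superSign (superType p q m n i) := by
      rw [superSign_add]; simp [superSign]
    have hs2 : superSign (superType p q m n i * superType p q m n i) =
        superSign (superType p q m n i) := by
      have h : ∀ x : ZMod 2, x * x = x := by decide
      rw [h]
    simp only [hs, hs2, mul_smul_comm, Prod.mk.injEq, true_and, eq_comm (a := b)]
    by_cases hab : a = b
    · simp only [hab, if_true]
      module
    · simp only [hab, if_false]
      module
  · simp [hi, not_lt.1 hi, rowOp, colOp]

theorem phiGen_rel (z : Fin (p + q + m + n) → ℂ) (a b c e : Fin d) (k l : ℕ) :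
    phiGen p q m n d z a b k * phiGen p q m n d z c e l =
      phiGen p q m n d z c e l * phiGen p q m n d z a b k +
      ((if b = c then phiGen p q m n d z a e (k + l) else 0) -
        (if a = e then phiGen p q m n d z c b (k + l) else 0)) := by
  set Q : Fin d → Fin d → ℕ → WeylD p q m n d := fun a b k =>
    ∑ i, z i ^ k • (rowOp p q m n d i a * colOp p q m n d i b) with hQ
  set K : ℕ → ℂ := fun k => ∑ i : Fin (p + q + m + n), if (i : ℕ) < p + q then
        (superSign (superType p q m n i) * z i ^ k) else 0 with hK
  have hphi : ∀ a b k, phiGen p q m n d z a b k =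
      Q a b k + if a = b then K k • (1 : WeylD p q m n d) else 0 := by
    intro a b k
    rw [phiGen_eq]
    simp only [hQ, hK, Finset.sum_smul, ite_smul, zero_smul]
  have key := fun i j => oscillator_quad
    (fun u : Fin (p + q + m + n) × Fin d => superType p q m n u.1)
    (fun u => rowOp p q m n d u.1 u.2) (fun u => colOp p q m n d u.1 u.2)
    (row_row p q m n d) (col_col p q m n d) (col_row p q m n d) (i, a) (i, b) (j, c) (j, e)
  have h2z : ∀ x : ZMod 2, x + x = 0 := by decide
  have hs0 : superSign 0 = 1 := by simp [superSign]
  simp only [h2z, zero_mul, hs0, one_smul] at key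
  have hQQ : Q a b k * Q c e l = Q c e l * Q a b k +
      ((if b = c then Q a e (k + l) else 0) - (if a = e then Q c b (k + l) else 0)) := by
    have h1 : Q a b k * Q c e l = ∑ i, ∑ j,
        (z i ^ k * z j ^ l) • (rowOp p q m n d i a * colOp p q m n d i b *
          (rowOp p q m n d j c * colOp p q m n d j e)) := by
      simp only [hQ]
      rw [Finset.sum_mul_sum]
      simp only [smul_mul_smul_comm]
    have h2 : Q c e l * Q a b k = ∑ i, ∑ j,
        (z i ^ k * z j ^ l) • (rowOp p q m n d j c * colOp p q m n d j e *
          (rowOp p q m n d i a * colOp p q m n d i b)) := by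
      simp only [hQ]
      rw [Finset.sum_mul_sum, Finset.sum_comm]
      simp only [smul_mul_smul_comm, mul_comm (z _ ^ l)]
    have h3 : (if b = c then Q a e (k + l) else 0) = ∑ i, ∑ j,
        (z i ^ k * z j ^ l) • (if ((i, b) : Fin (p + q + m + n) × Fin d) = (j, c) then
          rowOp p q m n d i a * colOp p q m n d j e else 0) := by
      by_cases hjk : b = c
      · simp [hjk, hQ, pow_add]
      · simp [hjk]
    have h4 : (if a = e then Q c b (k + l) else 0) = ∑ i, ∑ j,
        (z i ^ k * z j ^ l) • (if ((i, a) : Fin (p + q + m + n) × Fin d) = (j, e) then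
          rowOp p q m n d j c * colOp p q m n d i b else 0) := by
      by_cases hjk : a = e
      · simp [hjk, hQ, pow_add]
      · simp [hjk]
    rw [h1, h2, h3, h4]
    simp only [← Finset.sum_add_distrib, ← Finset.sum_sub_distrib]
    refine Finset.sum_congr rfl fun i _ => Finset.sum_congr rfl fun j _ => ?_
    rw [key, smul_add, smul_sub]
  simp only [hphi]
  have hcomm : (Q a b k + if a = b then K k • (1 : WeylD p q m n d) else 0) *
      (Q c e l + if c = e then K l • (1 : WeylD p q m n d) else 0) -
      (Q c e l + if c = e then K l • (1 : WeylD p q m n d) else 0) *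
      (Q a b k + if a = b then K k • (1 : WeylD p q m n d) else 0) =
      Q a b k * Q c e l - Q c e l * Q a b k := by
    split_ifs <;> simp [mul_add, add_mul, smul_smul, mul_comm] <;> abel
  rw [← sub_eq_iff_eq_add', hcomm, hQQ, add_sub_cancel_left]
  by_cases h1 : b = c <;> by_cases h2 : a = e
  · subst h1 h2
    simp
  · subst h1
    simp [h2]
  · subst h2
    simp [h1, eq_comm (a := c)]
  · simp [h1, h2]

/-- The homomorphism `φ_z : U(gl_d[t]) → 𝔻`, `e_{ab}[k] ↦ phiGen z a b k`. -/
def phi (z : Fin (p + q + m + n) → ℂ) :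
    CurrentEnv (fun _ : Fin d => (0 : ZMod 2)) →ₐ[ℂ] WeylD p q m n d :=
  RingQuot.liftAlgHom ℂ ⟨FreeAlgebra.lift ℂ (fun x => phiGen p q m n d z x.1 x.2.1 x.2.2), by
    rintro _ _ ⟨i, j, k, l, a, b⟩
    have h := phiGen_rel p q m n d z i j k l a b
    have hs0 : superSign ((0 + 0) * (0 + 0)) = 1 := by simp [superSign]
    simp only [hs0, one_smul]
    simp only [map_add, map_sub, map_mul, FreeAlgebra.lift_ι_apply, lift_ite]
    exact h⟩

theorem varphi_E (w : Fin d → ℂ) (i j : Fin (p + q + m + n)) (k : ℕ) :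
    varphi p q m n d w (CurrentEnv.E _ i j k) = varphiGen p q m n d w i j k := by
  simp [varphi, CurrentEnv.E]

theorem phi_E (z : Fin (p + q + m + n) → ℂ) (a b : Fin d) (k : ℕ) :
    phi p q m n d z (CurrentEnv.E _ a b k) = phiGen p q m n d z a b k := by
  simp [phi, CurrentEnv.E]

/-- The matrix `𝓛_d^w = [δ_{ab} (∂_z - w_a) - e_{ab}(z)]`, where `A(z) = ∑_{r ≥ 0} A[r] z^{-r-1}`. -/
def Lgl {d : ℕ} (w : Fin d → ℂ) :
    Matrix (Fin d) (Fin d) (PseudoDiff (CurrentEnv (fun _ : Fin d => (0 : ZMod 2)))) :=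
  fun a b => (if a = b then PseudoDiff.dSub _ (w a) else 0) -
    PseudoDiff.negSeries fun r => CurrentEnv.E _ a b r

/-- The matrix `𝓛_{p+q|m+n}^z = [δ_{ij} (∂_z - z_i) - (-1)^{|i|} E^i_j(z)]`. -/
def Lsuper (z : Fin (p + q + m + n) → ℂ) :
    Matrix (Fin (p + q + m + n)) (Fin (p + q + m + n))
      (PseudoDiff (CurrentEnv (superType p q m n))) :=
  fun i j => (if i = j then PseudoDiff.dSub _ (z i) else 0) -
    PseudoDiff.negSeries fun r =>
      superSign (superType p q m n i) • CurrentEnv.E (superType p q m n) i j r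

/-- `R_{p|q}(z) = (z - z_1) ⋯ (z - z_p) / ((z - z_{p+1}) ⋯ (z - z_{p+q}))`, expanded at infinity. -/
def ratR (z : Fin (p + q + m + n) → ℂ) : PseudoDiff (WeylD p q m n d) :=
  (List.ofFn fun r : Fin p => PseudoDiff.zSub _ (z ⟨r, by omega⟩)).prod *
    (List.ofFn fun s : Fin q => PseudoDiff.zSubInv _ (z ⟨p + s, by omega⟩)).prod

/-- `(z - z_{p+q+1}) ⋯ (z - z_{p+q+m}) / ((z - z_{p+q+m+1}) ⋯ (z - z_{p+q+m+n}))`, the function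
`R'_{m|n}(z)`, expanded at infinity. -/
def ratRPrime (z : Fin (p + q + m + n) → ℂ) : PseudoDiff (WeylD p q m n d) :=
  (List.ofFn fun i : Fin m => PseudoDiff.zSub _ (z ⟨p + q + i, by omega⟩)).prod *
    (List.ofFn fun j : Fin n => PseudoDiff.zSubInv _ (z ⟨p + q + m + j, by omega⟩)).prod

end Duality

end BetheDuality

end

open BetheDuality

/-! Both sides arise by eliminating one or the other diagonal block of a single block matrix. Put
Δ_i = ∂_z - z_i and W_a = z - w_a, so that [Δ_i, W_a] = 1, and let ρ, χ be the operators `rowOp`,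
`colOp`, which satisfy canonical supercommutation relations. Take the block matrix with diagonal
blocks W, Δ and off-diagonal blocks χ, ρ. Eliminating W gives Δ - (-1)^s ρ W⁻¹ χ, the image of
`Lsuper` under φ_w (`map_Lsuper`). Eliminating Δ gives the d×d matrix W - ∑ (-1)^{s_i} χ_i Δ_i⁻¹ ρ_i
(`Oscillators.lax`), which is ω applied to the image of `Lgl` up to a diagonal shift
(`swap_phi_Lgl`).

The oscillators are added one at a time. Let X be the d×d matrix built from the first k of them, X'
the next one, and θ = Δ_k - (-1)^{s_k} ρ_k X⁻¹ χ_k. Then cdet(X) θ = Δ_k cdet(X') if the index is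
even (`Bordering.cdet_even`), and cdet(X') θ = Δ_k cdet(X) if it is odd (`Bordering.cdet_odd`). By
`Oscillators.quasiminor_dual`, θ is a principal quasiminor of the dual matrix, so multiplying these
identities (`Oscillators.cdet_mul_prod`) gives cdet(W) · Ber = ∏ Δ_k^{±1} · cdet(X_N).

For the one-step identities, column b of X is encoded by the operator Ψ_b = ∑ ψ_a X_{ab} on P ⊗
Λ(R^d); the column determinant is the top coefficient of Ψ_1 ⋯ Ψ_d. The matrices that occur are
Manin matrices: the Ψ_b anticommute, and a rank one update preserves this. In the even case an extra
fermion κ turns the border into a (d+1)-st anticommuting column, and the product of all d+1 columns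
is computed in two ways. In the odd case the extra generator Δ + γ commutes with the shifted
columns, and a comparison of degrees replaces the (d+1)-fold product.

The diagonal shift is ∑ (-1)^{s_i} Δ_i⁻¹ over the x-indices, the logarithmic derivative of R'(∂).
Conjugation by R'(∂) removes it (`swap_ratRPrime_mul_lax`), which accounts for R' and R standing on
opposite sides of cdet. All needed inverses come from geometric series: up to a leading term ∂_z or
z on the diagonal, the matrices have entries with nonpositive exponents. -/

noncomputable section
namespace BetheDuality

/-! ### Exchange identities for anticommuting families -/

section Anticommuting

variable {G β : Type*} [Ring G]

theorem neg_one_pow_mul_self (n : ℕ) : (-1 : G) ^ n * (-1) ^ n = 1 := by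
  rw [← pow_add, ← two_mul, pow_mul, neg_one_sq, one_pow]

theorem mul_prod_of_anticomm {x : G} {f : β → G} (h : ∀ b, x * f b = -(f b * x)) (l : List β) :
    x * (l.map f).prod = (-1) ^ l.length * ((l.map f).prod * x) := by
  induction l with
  | nil => simp
  | cons b l ih =>
    simp only [List.map_cons, List.prod_cons, List.length_cons]
    rw [← mul_assoc, h, neg_mul, mul_assoc, ih, pow_succ,
      ((Commute.neg_one_left (f b)).pow_left l.length).symm.left_comm]
    noncomm_ring

theorem mul_prod_of_comm {x : G} {f : β → G} (h : ∀ b, x * f b = f b * x) (l : List β) :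
    x * (l.map f).prod = (l.map f).prod * x := by
  induction l with
  | nil => simp
  | cons b l ih =>
    simp only [List.map_cons, List.prod_cons]
    rw [← mul_assoc, h, mul_assoc, ih, mul_assoc]

/-- The factor on the right moves left, up to sign, until it meets its twin inside the product and
squares to zero. -/
theorem prod_mul_eq_zero {f : β → G} (h : ∀ b c, f b * f c = -(f c * f b))
    (h0 : ∀ b, f b * f b = 0) (l : List β) (b : β) (hb : b ∈ l) : (l.map f).prod * f b = 0 := by
  induction l with
  | nil => simp at hb
  | cons c l ih =>
    simp only [List.map_cons, List.prod_cons]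
    by_cases hbl : b ∈ l
    · rw [mul_assoc, ih hbl, mul_zero]
    · obtain rfl : b = c := by simpa [hbl] using hb
      have h1 := mul_prod_of_anticomm (h b) l
      have h2 : (l.map f).prod * f b = (-1) ^ l.length * (f b * (l.map f).prod) := by
        rw [h1, ← mul_assoc, neg_one_pow_mul_self, one_mul]
      rw [mul_assoc, h2, ((Commute.neg_one_left (f b)).pow_left l.length).symm.left_comm,
        ← mul_assoc (f b), h0]
      simp

/-- A square-zero element anticommuting with the factors absorbs perturbations by its
multiples. -/
theorem mul_prod_add_mul {x : G} {f g : β → G} (h : ∀ b, x * f b = -(f b * x)) (hx : x * x = 0)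
    (l : List β) : x * (l.map fun b => f b + x * g b).prod = x * (l.map f).prod := by
  induction l with
  | nil => simp
  | cons b l ih =>
    simp only [List.map_cons, List.prod_cons]
    rw [← mul_assoc, mul_add, ← mul_assoc x x, hx, zero_mul, add_zero, h, neg_mul, mul_assoc, ih,
      ← mul_assoc x, h, ← mul_assoc, neg_mul]

/-- The product of the updated generators `Ψ b - ε γ D r b`. -/
theorem update_mul_update {ε : ℤ} (hε : ε * ε = 1) {γ Δ D : G} (hΔD : Δ * D = 1) (hDΔ : D * Δ = 1)
    {Ψ ψ r : β → G} (hγΨ : ∀ b, γ * Ψ b = -ε • (Ψ b * γ)) (hrγ : ∀ b, r b * γ = γ * r b - ψ b)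
    (hrΨ : ∀ b c, r b * Ψ c = ε • (Ψ c * r b)) (hΔΨ : ∀ b, Δ * Ψ b = Ψ b * Δ + ψ b)
    (hΔr : ∀ b, Δ * r b = r b * Δ) (hΔγ : Δ * γ = γ * Δ) (hΔψ : ∀ b, Δ * ψ b = ψ b * Δ) (b c : β) :
    (Ψ b - ε • (γ * D * r b)) * (Ψ c - ε • (γ * D * r c)) =
      Ψ b * Ψ c + γ * D * (Ψ b * r c - Ψ c * r b) + γ * γ * (D * D) * (r b * r c) := by
  -- The rule [x, Δ⁻¹] = Δ⁻¹ [Δ, x] Δ⁻¹, used below with [Δ, x] equal to 0 or ψ.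
  have inv : ∀ x y : G, Δ * x = x * Δ + y → x * D = D * x + D * y * D := by
    intro x y h
    calc x * D = D * (Δ * x) * D := by rw [← mul_assoc, hDΔ, one_mul]
      _ = D * x * (Δ * D) + D * y * D := by rw [h]; noncomm_ring
      _ = _ := by rw [hΔD, mul_one]
  have hDr : ∀ b, D * r b = r b * D := fun b => by
    have := inv (r b) 0 (by simpa using hΔr b); simpa using this.symm
  have hDγ : D * γ = γ * D := by
    have := inv γ 0 (by simpa using hΔγ); simpa using this.symm
  have hDψ : ∀ b, D * ψ b = ψ b * D := fun b => by
    have := inv (ψ b) 0 (by simpa using hΔψ b); simpa using this.symm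
  have hΨD : ∀ b, Ψ b * D = D * Ψ b + ψ b * (D * D) := fun b => by
    rw [inv _ _ (hΔΨ b), hDψ, mul_assoc]
  have hΨγ : ∀ b, ε • (Ψ b * γ) = -(γ * Ψ b) := fun b => by rw [hγΨ]; simp
  have e1 : Ψ b * (ε • (γ * D * r c)) =
      -(γ * D * (Ψ b * r c)) - γ * ψ b * (D * D) * r c := by
    calc Ψ b * (ε • (γ * D * r c)) = ε • (Ψ b * γ) * (D * r c) := by
          rw [mul_smul_comm, smul_mul_assoc]; noncomm_ring
      _ = -(γ * (Ψ b * D) * r c) := by rw [hΨγ]; noncomm_ring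
      _ = _ := by rw [hΨD]; noncomm_ring
  have e2 : ε • (γ * D * r b) * Ψ c = γ * D * (Ψ c * r b) := by
    rw [smul_mul_assoc, mul_assoc, hrΨ, mul_smul_comm, smul_smul, hε, one_smul]
  have e3 : ε • (γ * D * r b) * (ε • (γ * D * r c)) =
      γ * γ * (D * D) * (r b * r c) - γ * ψ b * (D * D) * r c := by
    rw [smul_mul_smul_comm, hε, one_smul]
    calc γ * D * r b * (γ * D * r c) = γ * D * (r b * γ) * (D * r c) := by noncomm_ring
      _ = γ * (D * γ) * (r b * D) * r c - γ * (D * ψ b) * D * r c := by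
          rw [hrγ]; noncomm_ring
      _ = γ * γ * D * (D * r b) * r c - γ * ψ b * (D * D) * r c := by
          rw [hDγ, ← hDr, hDψ]; noncomm_ring
      _ = _ := by noncomm_ring
  -- The terms γ ψ D² r from moving D past Ψ (`e1`) and from moving r past γ (`e3`) cancel.
  rw [sub_mul, mul_sub, mul_sub, e1, e2, e3]
  noncomm_ring

/-- Exchange of an even generator `κ` with an anticommuting family. -/
theorem even_exchange {Ψ ψ r u : β → G} {κ γ Δ D : G} (l : List β) (hl : ∀ b, b ∈ l) [Fintype β]
    (hκΨ : ∀ b, κ * Ψ b = -(Ψ b * κ)) (hκr : ∀ b, κ * r b = r b * κ) (hκ : κ * κ = 0)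
    (hκγ : κ * γ = -(γ * κ)) (hκΔ : κ * Δ = Δ * κ) (hΔD : Δ * D = 1) 
    (hΨΨ : ∀ b c, Ψ b * Ψ c = -(Ψ c * Ψ b)) (hΨ0 : ∀ b, Ψ b * Ψ b = 0)
    (hrΨ : ∀ b c, r b * Ψ c = Ψ c * r b)
    (hγγ : γ * γ = 0) (hΔγ : Δ * γ = γ * Δ)
    (hγΨ : ∀ b, γ * Ψ b = -(Ψ b * γ)) (hrγ : ∀ b, r b * γ = γ * r b - ψ b)
    (hΔΨ : ∀ b, Δ * Ψ b = Ψ b * Δ + ψ b) 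
    (hγ : γ = ∑ b, Ψ b * u b) :
    κ * ((l.map Ψ).prod * (Δ - ∑ b, r b * u b)) =
      (γ + κ * Δ) * (l.map fun b => Ψ b - γ * D * r b).prod := by
  have hΨκ : ∀ b, Ψ b * κ = -(κ * Ψ b) := fun b => by rw [hκΨ, neg_neg]
  -- Φ and Ψ' are the d+1 columns of the bordered matrix, with κ as the generator of the new row.
  set Φ := γ + κ * Δ with hΦ
  set Ψ' : β → G := fun b => Ψ b + κ * r b with hΨ'
  have hκκ : ∀ x, κ * (κ * x) = 0 := fun x => by rw [← mul_assoc, hκ, zero_mul]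
  have a1 : ∀ b c, Ψ' b * Ψ' c = -(Ψ' c * Ψ' b) := by
    intro b c
    have e : ∀ b c, Ψ' b * Ψ' c = Ψ b * Ψ c - κ * (Ψ b * r c) + κ * (Ψ c * r b) := by
      intro b c
      have e1 : Ψ b * (κ * r c) = -(κ * (Ψ b * r c)) := by
        rw [← mul_assoc, hΨκ]; noncomm_ring
      have e2 : κ * r b * (κ * r c) = 0 := by
        rw [mul_assoc, ← mul_assoc (r b), ← hκr, mul_assoc, hκκ]
      simp only [hΨ', add_mul, mul_add, e1, e2, mul_assoc, hrΨ]
      abel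
    rw [e, e, hΨΨ b c]; abel
  have a2 : ∀ b, Ψ' b * Ψ' b = 0 := by
    intro b
    have e1 : Ψ b * (κ * r b) = -(κ * (Ψ b * r b)) := by
      rw [← mul_assoc, hΨκ]; noncomm_ring
    have e2 : κ * r b * (κ * r b) = 0 := by
      rw [mul_assoc, ← mul_assoc (r b), ← hκr, mul_assoc, hκκ]
    simp only [hΨ', add_mul, mul_add, e1, e2, mul_assoc, hrΨ, hΨ0]
    abel
  -- The defect κψ of Δ against Ψ cancels the defect of r against γ; this is where the two canonical
  -- relations balance.
  have a3 : ∀ b, Φ * Ψ' b = -(Ψ' b * Φ) := by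
    intro b
    have e1 : γ * (κ * r b) = -(κ * γ * r b) := by rw [hκγ]; noncomm_ring
    have e2 : κ * Δ * (κ * r b) = 0 := by rw [hκΔ, mul_assoc, hκκ, mul_zero]
    have e3 : Ψ b * (κ * Δ) = -(κ * (Ψ b * Δ)) := by rw [← mul_assoc, hΨκ]; noncomm_ring
    have e4 : κ * r b * (κ * Δ) = 0 := by
      rw [mul_assoc, ← mul_assoc (r b), ← hκr, mul_assoc, hκκ]
    have e5 : κ * r b * γ = κ * γ * r b - κ * ψ b := by rw [mul_assoc, hrγ]; noncomm_ring
    have e6 : κ * Δ * Ψ b = κ * (Ψ b * Δ) + κ * ψ b := by rw [mul_assoc, hΔΨ]; noncomm_ring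
    simp only [hΦ, hΨ', add_mul, mul_add, e1, e2, e3, e4, e5, e6, hγΨ]
    abel
  have a4 : Φ * Φ = 0 := by
    have e1 : γ * (κ * Δ) = -(κ * γ * Δ) := by rw [hκγ]; noncomm_ring
    have e2 : κ * Δ * (κ * Δ) = 0 := by
      rw [mul_assoc, ← mul_assoc Δ, ← hκΔ, mul_assoc, hκκ]
    have e3 : κ * Δ * γ = κ * γ * Δ := by rw [mul_assoc, hΔγ]; noncomm_ring
    simp only [hΦ, add_mul, mul_add, e1, e2, e3, hγγ]
    abel
  -- Since κ² = 0, the κ-components of the Ψ' are invisible next to κ.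
  have a5 : (l.map Ψ').prod * κ = (l.map Ψ).prod * κ := by
    have h : ∀ l : List β, κ * (l.map Ψ').prod = κ * (l.map Ψ).prod :=
      fun l => mul_prod_add_mul hκΨ hκ l
    have hκΨ' : ∀ b, κ * Ψ' b = -(Ψ' b * κ) := by
      intro b
      have e2 : κ * r b * κ = 0 := by rw [mul_assoc, ← hκr, hκκ]
      simp only [hΨ', add_mul, mul_add, e2, hκκ, hκΨ]
      abel
    have h1 := h l
    rw [mul_prod_of_anticomm hκΨ', mul_prod_of_anticomm hκΨ] at h1
    have h3 := congrArg (fun x => (-1 : G) ^ l.length * x) h1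
    simpa only [← mul_assoc, neg_one_pow_mul_self, one_mul] using h3
  -- Column operation: subtracting ∑ Ψ'_b u_b from Φ clears its upper part and leaves the Schur
  -- complement in the κ-row. The subtracted terms are killed by the product of all Ψ'.
  have a6 : (l.map Ψ').prod * Φ = (l.map Ψ').prod * (κ * (Δ - ∑ b, r b * u b)) := by
    have e : Φ = κ * (Δ - ∑ b, r b * u b) + ∑ b, Ψ' b * u b := by
      simp only [hΦ, hΨ', add_mul, Finset.sum_add_distrib, mul_sub, Finset.mul_sum, hγ, mul_assoc]
      abel
    rw [e, mul_add, Finset.mul_sum (f := fun b => Ψ' b * u b), add_eq_left]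
    refine Finset.sum_eq_zero fun b _ => ?_
    rw [← mul_assoc, prod_mul_eq_zero a1 a2 l b (hl b), zero_mul]
  -- The opposite elimination: subtracting multiples of Φ clears the κ-row of every Ψ', and Φ in
  -- front absorbs the change.
  have a7 : (fun b => Ψ b - γ * D * r b) = fun b => Ψ' b + Φ * (-(D * r b)) := by
    funext b
    have : κ * Δ * (D * r b) = κ * r b := by
      rw [mul_assoc, ← mul_assoc Δ, hΔD, one_mul]
    simp only [hΦ, hΨ', add_mul, mul_neg, this, mul_assoc]
    abel
  rw [a7, mul_prod_add_mul a3 a4, mul_prod_of_anticomm a3, a6, ← mul_assoc _ κ, a5, ← mul_assoc κ,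
    mul_prod_of_anticomm hκΨ]
  noncomm_ring

/-- The commutator of Δ with Ψ is ψ, that of γ with -r is -ψ, and the two cancel. -/
theorem odd_shift_comm {Ψ ψ r : β → G} {γ Δ : G} (hΔr : ∀ b, Δ * r b = r b * Δ)
    (hγΨ : ∀ b, γ * Ψ b = Ψ b * γ) (hrγ : ∀ b, r b * γ = γ * r b - ψ b)
    (hΔΨ : ∀ b, Δ * Ψ b = Ψ b * Δ + ψ b) (b : β) :
    (Δ + γ) * (Ψ b - r b) = (Ψ b - r b) * (Δ + γ) := by
  have e : (Ψ b - r b) * (Δ + γ) = Ψ b * Δ + Ψ b * γ - r b * Δ - r b * γ := by noncomm_ring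
  rw [e, hrγ, ← hΔr, ← hγΨ]
  have e2 : (Δ + γ) * (Ψ b - r b) = Δ * Ψ b - Δ * r b + γ * Ψ b - γ * r b := by noncomm_ring
  rw [e2, hΔΨ]
  abel

theorem odd_shift_anticomm {Ψ r : β → G} (hΨΨ : ∀ b c, Ψ b * Ψ c = -(Ψ c * Ψ b))
    (hrr : ∀ b c, r b * r c = -(r c * r b)) (hrΨ : ∀ b c, r b * Ψ c = -(Ψ c * r b)) (b c : β) :
    (Ψ b - r b) * (Ψ c - r c) = -((Ψ c - r c) * (Ψ b - r b)) := by
  simp only [sub_mul, mul_sub, hrΨ, hΨΨ b c, hrr b c]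
  abel

/-- Exchange of the even generator `Φ = Δ + γ` with an anticommuting family. -/
theorem odd_exchange [Fintype β] {Ψ r u : β → G} {γ Δ : G} (l : List β) (hl : ∀ b, b ∈ l)
    (hc : ∀ b, (Δ + γ) * (Ψ b - r b) = (Ψ b - r b) * (Δ + γ))
    (ha : ∀ b c, (Ψ b - r b) * (Ψ c - r c) = -((Ψ c - r c) * (Ψ b - r b)))
    (h0 : ∀ b, (Ψ b - r b) * (Ψ b - r b) = 0) (hγ : γ = ∑ b, Ψ b * u b) :
    (Δ + γ) * (l.map fun b => Ψ b - r b).prod =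
      (l.map fun b => Ψ b - r b).prod * (Δ + ∑ b, r b * u b) := by
  have e : Δ + γ = (Δ + ∑ b, r b * u b) + ∑ b, (Ψ b - r b) * u b := by
    simp only [sub_mul, Finset.sum_sub_distrib, hγ]; abel
  rw [mul_prod_of_comm hc, e, mul_add _ (Δ + _), add_eq_left, Finset.mul_sum]
  refine Finset.sum_eq_zero fun b _ => ?_
  rw [← mul_assoc, prod_mul_eq_zero (f := fun b => Ψ b - r b) ha h0 l b (hl b), zero_mul]

end Anticommuting
end BetheDuality
end

/-! ### The Fock module, its degrees, and column determinants as top coefficients -/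

noncomputable section
namespace BetheDuality

open scoped TensorProduct

/-- The module `P ⊗ Λ(R^d)` on which the coefficient ring `P` and `d` fermions act. -/
abbrev Fock (R P : Type*) [CommRing R] [Ring P] [Algebra R P] (d : ℕ) : Type _ := P ⊗[R] ExteriorAlgebra R (Fin d → R)

namespace Fock

variable {R P : Type*} [CommRing R] [Ring P] [Algebra R P] {d : ℕ}

variable (R) in
/-- The generator of the exterior algebra with index `a`. -/
def gen (a : Fin d) : ExteriorAlgebra R (Fin d → R) := ExteriorAlgebra.ι R (Pi.single a 1)

variable (R d) in
/-- Left multiplication by a coefficient. -/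
def coef : P →+* Module.End R (Fock R P d) :=
  (Algebra.lmul R (Fock R P d)).toRingHom.comp Algebra.TensorProduct.includeLeftRingHom

variable (R P) in
/-- The creation operator with index `a`. -/
def psi (a : Fin d) : Module.End R (Fock R P d) := Algebra.lmul R (Fock R P d) (1 ⊗ₜ gen R a)

variable (R P d) in
/-- The operator `(-1)^degree`. -/
def par : Module.End R (Fock R P d) :=
  LinearMap.lTensor P (CliffordAlgebra.involute (Q := (0 : QuadraticForm R (Fin d → R)))).toLinearMap

@[simp] theorem coef_tmul (p q : P) (v : ExteriorAlgebra R (Fin d → R)) :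
    coef R d p (q ⊗ₜ v) = (p * q) ⊗ₜ v := by
  simp [coef]

@[simp] theorem psi_tmul (a : Fin d) (q : P) (v : ExteriorAlgebra R (Fin d → R)) :
    psi R P a (q ⊗ₜ v) = q ⊗ₜ (gen R a * v) := by
  simp [psi]

@[simp] theorem par_tmul (q : P) (v : ExteriorAlgebra R (Fin d → R)) :
    par R P d (q ⊗ₜ v) = q ⊗ₜ CliffordAlgebra.involute (Q := (0 : QuadraticForm R (Fin d → R))) v := by
  simp [par]

theorem end_ext {f g : Module.End R (Fock R P d)} (h : ∀ q v, f (q ⊗ₜ v) = g (q ⊗ₜ v)) : f = g :=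
  TensorProduct.ext' h

theorem involute_gen (a : Fin d) :
    CliffordAlgebra.involute (Q := (0 : QuadraticForm R (Fin d → R))) (gen R a) = -gen R a :=
  CliffordAlgebra.involute_ι _

theorem psi_mul_psi (a b : Fin d) : psi R P a * psi R P b = -(psi R P b * psi R P a) := by
  refine end_ext fun q v => ?_
  have h : gen R a * gen R b = -(gen R b * gen R a) := 
    eq_neg_of_add_eq_zero_left (ExteriorAlgebra.ι_add_mul_swap _ _)
  simp [← mul_assoc, h, TensorProduct.tmul_neg]

theorem coef_mul_psi (p : P) (a : Fin d) : coef R d p * psi R P a = psi R P a * coef R d p :=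
  end_ext fun q v => by simp

theorem par_mul_psi (a : Fin d) : par R P d * psi R P a = -(psi R P a * par R P d) :=
  end_ext fun q v => by simp [involute_gen, TensorProduct.tmul_neg]

theorem par_mul_coef (p : P) : par R P d * coef R d p = coef R d p * par R P d :=
  end_ext fun q v => by simp

theorem par_mul_par : par R P d * par R P d = 1 :=
  end_ext fun q v => by simp

/-- The coefficient functional of the top degree on the exterior algebra. -/
def topExt : ExteriorAlgebra R (Fin d → R) →ₗ[R] R :=
  ExteriorAlgebra.liftAlternating (Pi.single d Matrix.detRowAlternating)

variable (R P d) in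
/-- The coefficient of the top degree. -/
def top : Fock R P d →ₗ[R] P := (TensorProduct.rid R P).toLinearMap ∘ₗ LinearMap.lTensor P topExt

theorem top_tmul (q : P) (v : ExteriorAlgebra R (Fin d → R)) :
    top R P d (q ⊗ₜ v) = topExt v • q := by
  simp [top]

theorem top_coef (p : P) (h : Fock R P d) : top R P d (coef R d p h) = p * top R P d h := by
  induction h using TensorProduct.induction_on with
  | zero => simp
  | tmul q v => simp [top_tmul]
  | add x y hx hy => simp [hx, hy, mul_add]

theorem topExt_ofFn {k : ℕ} (f : Fin k → Fin d) (hk : k ≠ d) :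
    topExt (List.ofFn fun i => gen R (f i)).prod = 0 := by
  have h := ExteriorAlgebra.ιMulti_apply (R := R) (fun i => (Pi.single (f i) 1 : Fin d → R))
  simp only [gen, ← h, topExt, ExteriorAlgebra.liftAlternating_apply_ιMulti]
  rw [Pi.single_eq_of_ne hk]
  rfl

/-- The value is the determinant of the matrix with rows e_{f(i)}, and only σ = f survives in the
Leibniz formula. It is kept as a sum over permutations so that summing over all f afterwards selects
exactly the terms of `cdet`. -/
theorem topExt_ofFn_self (f : Fin d → Fin d) :
    topExt (List.ofFn fun i => gen R (f i)).prod =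
      ∑ σ : Equiv.Perm (Fin d), if (σ : Fin d → Fin d) = f then ((Equiv.Perm.sign σ : ℤ) : R) else 0 := by
  have h := ExteriorAlgebra.ιMulti_apply (R := R) (fun i => (Pi.single (f i) 1 : Fin d → R))
  simp only [gen, ← h, topExt, ExteriorAlgebra.liftAlternating_apply_ιMulti, Pi.single_eq_same]
  change Matrix.det (Matrix.of fun i => (Pi.single (f i) 1 : Fin d → R)) = _
  rw [← Matrix.det_transpose, Matrix.det_apply']
  refine Finset.sum_congr rfl fun σ _ => ?_
  simp only [Matrix.transpose_apply, Matrix.of_apply, Pi.single_apply, Finset.prod_ite_zero, Finset.prod_const_one,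
    Finset.mem_univ, true_implies, funext_iff]
  split_ifs <;> simp

/-- The span of the products of generators whose number lies in `S`. -/
def graded (R P : Type*) [CommRing R] [Ring P] [Algebra R P] (d : ℕ) (S : Set ℕ) : AddSubgroup (Fock R P d) :=
  AddSubgroup.closure {h | ∃ (q : P) (k : ℕ) (f : Fin k → Fin d), k ∈ S ∧
    h = q ⊗ₜ (List.ofFn fun i => gen R (f i)).prod}

theorem map_mem_graded {S T : Set ℕ} (F : Module.End R (Fock R P d))
    (hF : ∀ (q : P) (k : ℕ) (f : Fin k → Fin d), k ∈ S →
      F (q ⊗ₜ (List.ofFn fun i => gen R (f i)).prod) ∈ graded R P d T) {h : Fock R P d}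
    (hh : h ∈ graded R P d S) : F h ∈ graded R P d T := by
  induction hh using AddSubgroup.closure_induction with
  | mem x hx => obtain ⟨q, k, f, hk, rfl⟩ := hx; exact hF q k f hk
  | zero => rw [map_zero]; exact zero_mem _
  | add x y _ _ hx hy => rw [map_add]; exact add_mem hx hy
  | neg x _ hx => rw [map_neg]; exact neg_mem hx

theorem tmul_mem_graded {S : Set ℕ} (q : P) {k : ℕ} (f : Fin k → Fin d) (hk : k ∈ S) :
    q ⊗ₜ (List.ofFn fun i => gen R (f i)).prod ∈ graded R P d S :=
  AddSubgroup.subset_closure ⟨q, k, f, hk, rfl⟩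

theorem coef_mem_graded {S : Set ℕ} (p : P) {h : Fock R P d} (hh : h ∈ graded R P d S) :
    coef R d p h ∈ graded R P d S :=
  map_mem_graded _ (fun q k f hk => by rw [coef_tmul]; exact tmul_mem_graded _ f hk) hh

theorem psi_mem_graded {S T : Set ℕ} (hST : ∀ k ∈ S, k + 1 ∈ T) (a : Fin d) {h : Fock R P d}
    (hh : h ∈ graded R P d S) : psi R P a h ∈ graded R P d T := by
  refine map_mem_graded _ (fun q k f hk => ?_) hh
  have := tmul_mem_graded (R := R) q (Fin.cons a f : Fin (k + 1) → Fin d) (hST k hk)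
  simpa [List.ofFn_succ] using this

theorem par_mem_graded {S : Set ℕ} {h : Fock R P d} (hh : h ∈ graded R P d S) :
    par R P d h ∈ graded R P d S := by
  refine map_mem_graded _ (fun q k f hk => ?_) hh
  have h1 : ∀ l : List (Fin d), CliffordAlgebra.involute
      (Q := (0 : QuadraticForm R (Fin d → R))) (l.map (gen R)).prod =
        (-1 : R) ^ l.length • (l.map (gen R)).prod := by
    intro l
    induction l with
    | nil => simp
    | cons a l ih =>
      simp only [List.map_cons, List.prod_cons, map_mul, ih, involute_gen, List.length_cons]
      rw [pow_succ, mul_smul_comm]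
      simp
  have h2 := h1 (List.ofFn f)
  rw [List.map_ofFn, List.length_ofFn] at h2
  rw [par_tmul]
  have h3 := tmul_mem_graded (R := R) ((-1 : R) ^ k • q) f hk
  rw [TensorProduct.smul_tmul] at h3
  have h4 : (gen R ∘ f) = fun i => gen R (f i) := rfl
  rw [h4] at h2
  rw [h2]
  exact h3

theorem top_eq_zero {S : Set ℕ} (hS : d ∉ S) {h : Fock R P d} (hh : h ∈ graded R P d S) :
    top R P d h = 0 := by
  induction hh using AddSubgroup.closure_induction with
  | mem x hx =>
    obtain ⟨q, k, f, hk, rfl⟩ := hx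
    rw [top_tmul, topExt_ofFn f (by rintro rfl; exact hS hk), zero_smul]
  | zero => rw [map_zero]
  | add x y _ _ hx hy => rw [map_add, hx, hy, add_zero]
  | neg x _ hx => rw [map_neg, hx, neg_zero]

/-- More than d generators must repeat one, by the pigeonhole principle. -/
theorem eq_zero_of_mem_graded {S : Set ℕ} (hS : ∀ k ∈ S, d < k) {h : Fock R P d}
    (hh : h ∈ graded R P d S) : h = 0 := by
  induction hh using AddSubgroup.closure_induction with
  | mem x hx =>
    obtain ⟨q, k, f, hk, rfl⟩ := hx
    have h1 := ExteriorAlgebra.ιMulti_apply (R := R) (fun i => (Pi.single (f i) 1 : Fin d → R))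
    simp only [gen, ← h1]
    rw [ExteriorAlgebra.ιMulti_eq_zero_of_not_inj, TensorProduct.tmul_zero]
    intro hinj
    have h2 : Function.Injective f := fun i j hij => hinj (by simp [hij])
    have := Fintype.card_le_of_injective f h2
    simp only [Fintype.card_fin] at this
    have := hS k hk
    omega
  | zero => rfl
  | add x y _ _ hx hy => rw [hx, hy, add_zero]
  | neg x _ hx => rw [hx, neg_zero]

theorem graded_mono {S T : Set ℕ} (hST : S ⊆ T) : graded R P d S ≤ graded R P d T :=
  AddSubgroup.closure_mono fun _ ⟨q, k, f, hk, h⟩ => ⟨q, k, f, hST hk, h⟩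

theorem vac_mem_graded (p : P) : (p ⊗ₜ 1 : Fock R P d) ∈ graded R P d {0} := by
  simpa using tmul_mem_graded (d := d) (S := {0}) p (Fin.elim0 : Fin 0 → Fin d) rfl

/-- Needed to start the degree-raising argument for injectivity in `cdet_odd` at an arbitrary
vector. -/
theorem mem_graded_univ (h : Fock R P d) : h ∈ graded R P d Set.univ := by
  have hsmul : ∀ (r : R), ∀ x ∈ graded R P d Set.univ, r • x ∈ graded R P d Set.univ := by
    intro r x hx
    have := coef_mem_graded (algebraMap R P r) hx
    have h1 : coef R d (algebraMap R P r) x = r • x := by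
      have h2 : coef R d (algebraMap R P r) = algebraMap R (Module.End R (Fock R P d)) r :=
        end_ext fun q v => by
          rw [coef_tmul, ← Algebra.smul_def, ← TensorProduct.smul_tmul',
            Module.algebraMap_end_apply]
      rw [h2, Module.algebraMap_end_apply]
    rwa [h1] at this
  -- The induction is on the left multiplier acting on the whole span, so that products compose
  -- without expanding them.
  have key : ∀ v : ExteriorAlgebra R (Fin d → R), ∀ x ∈ graded R P d Set.univ,
      (1 ⊗ₜ v * x : Fock R P d) ∈ graded R P d Set.univ := by
    intro v
    induction v using ExteriorAlgebra.induction with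
    | algebraMap r =>
      intro x hx
      rw [Algebra.algebraMap_eq_smul_one, TensorProduct.tmul_smul, smul_mul_assoc]
      refine hsmul _ _ ?_
      rw [← Algebra.TensorProduct.one_def, one_mul]
      exact hx
    | ι m =>
      intro x hx
      have h1 : ExteriorAlgebra.ι R m = ∑ a, m a • gen R a := by
        simp only [gen, ← map_smul, ← map_sum]
        congr 1
        ext b
        simp [Pi.single_apply]
      rw [h1, TensorProduct.tmul_sum, Finset.sum_mul]
      refine AddSubgroup.sum_mem _ fun a _ => ?_
      rw [TensorProduct.tmul_smul, smul_mul_assoc]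
      exact hsmul _ _ (psi_mem_graded (T := Set.univ) (fun _ _ => trivial) a hx)
    | mul v w hv hw =>
      intro x hx
      have : ((1 : P) ⊗ₜ[R] (v * w) : Fock R P d) = (1 ⊗ₜ v) * (1 ⊗ₜ w) := by simp
      rw [this, mul_assoc]
      exact hv _ (hw _ hx)
    | add v w hv hw =>
      intro x hx
      rw [TensorProduct.tmul_add, add_mul]
      exact add_mem (hv _ hx) (hw _ hx)
  induction h using TensorProduct.induction_on with
  | zero => exact zero_mem _
  | tmul q v =>
    have := key v _ (graded_mono (Set.subset_univ _) (vac_mem_graded (d := d) q))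
    simpa using this
  | add x y hx hy => exact add_mem hx hy

section Columns

variable (X : Matrix (Fin d) (Fin d) P)

/-- The operator `∑_a ψ_a X_{ab}` attached to the column `b` of a matrix. -/
def colPsi (b : Fin d) : Module.End R (Fock R P d) := ∑ a, psi R P a * coef R d (X a b)

/-- This is the bridge from operators to determinants. The product expands over all maps g choosing
a row in each column; the ψ's commute with coefficients, which therefore keep their column order,
and the top coefficient discards every g that is not a permutation. -/
theorem top_prod_colPsi (p : P) :
    top R P d (((List.finRange d).map (colPsi X)).prod (p ⊗ₜ 1)) = cdet X * p := by
  have hpc : ∀ (l : List (Fin d)) (g : Fin d → Fin d),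
      (l.map fun b => psi R P (g b) * coef R d (X (g b) b)).prod =
        (l.map fun b => psi R P (g b)).prod * coef R d (l.map fun b => X (g b) b).prod := by
    intro l g
    induction l with
    | nil => simp
    | cons b l ih =>
      simp only [List.map_cons, List.prod_cons, map_mul, ih]
      have := mul_prod_of_comm (x := coef R d (X (g b) b)) (f := fun b => psi R P (g b))
        (fun b => coef_mul_psi _ _) l
      simp only [mul_assoc]
      rw [← mul_assoc (coef R d _) (List.prod _), this]
      simp only [mul_assoc]
  have hpv : ∀ (l : List (Fin d)) (g : Fin d → Fin d) (q : P),
      (l.map fun b => psi R P (g b)).prod (q ⊗ₜ 1) = q ⊗ₜ (l.map fun b => gen R (g b)).prod := by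
    intro l g q
    induction l with
    | nil => simp
    | cons b l ih => simp [ih]
  have h1 : ((List.finRange d).map (colPsi X)).prod =
      ∑ g : Fin d → Fin d, ((List.finRange d).map
        fun b => psi R P (g b) * coef R d (X (g b) b)).prod := by
    have := (MultilinearMap.mkPiAlgebraFin R d (Module.End R (Fock R P d))).map_sum
      (fun b a => psi R P a * coef R d (X a b))
    simp only [MultilinearMap.mkPiAlgebraFin_apply, List.ofFn_eq_map] at this
    exact this
  rw [h1]
  simp only [LinearMap.sum_apply, map_sum, hpc, Module.End.mul_apply, coef_tmul, hpv, top_tmul]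
  have h2 : ∀ g : Fin d → Fin d, topExt ((List.finRange d).map fun b => gen R (g b)).prod =
      ∑ σ : Equiv.Perm (Fin d), if (σ : Fin d → Fin d) = g then ((Equiv.Perm.sign σ : ℤ) : R) else 0 := by
    intro g; rw [← topExt_ofFn_self, List.ofFn_eq_map]
  simp only [h2, Finset.sum_smul, ite_smul, zero_smul]
  rw [Finset.sum_comm]
  simp only [Finset.sum_ite_eq, Finset.mem_univ, if_true, cdet, List.ofFn_eq_map, Finset.sum_mul,
    smul_mul_assoc, Int.cast_smul_eq_zsmul]

end Columns

end Fock
end BetheDuality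
end

/-! ### Manin matrices and their rank one updates -/

noncomputable section
namespace BetheDuality

/-- Fermionic creation operators `psi a` in a ring `G`, which commute with the image of a
coefficient ring `P`. -/
structure Fermions (G P : Type*) [Ring G] [Ring P] (d : ℕ) where
  coef : P →+* G
  psi : Fin d → G
  coef_mul_psi : ∀ p a, coef p * psi a = psi a * coef p
  psi_mul_psi : ∀ a b, psi a * psi b = -(psi b * psi a)
  par : G
  par_mul_par : par * par = 1
  par_mul_coef : ∀ p, par * coef p = coef p * par
  par_mul_psi : ∀ a, par * psi a = -(psi a * par)

variable {G P : Type*} [Ring G] [Ring P] {d : ℕ}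

namespace Fermions

/-- The element `∑_a ψ_a X_{ab}` attached to the column `b` of a matrix. -/
def col (F : Fermions G P d) (X : Matrix (Fin d) (Fin d) P) (b : Fin d) : G :=
  ∑ a, F.psi a * F.coef (X a b)

/-- A matrix is a Manin matrix (in columns) if its columns define anticommuting elements. -/
def IsManin (F : Fermions G P d) (X : Matrix (Fin d) (Fin d) P) : Prop :=
  ∀ b c, F.col X b * F.col X c = -(F.col X c * F.col X b)

end Fermions

/-- The commutation relations between a matrix `X`, a row `ρ`, a column `χ` and an invertible `Δ`
(with inverse `D`) under which `X` may be bordered by `ρ`, `χ` and `Δ`; the sign `ε` is the parity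
of the bordering index. -/
structure Bordering (ε : ℤ) (X : Matrix (Fin d) (Fin d) P) (ρ χ : Fin d → P) (Δ D : P) :
    Prop where
  sign : ε * ε = 1
  mul_inv : Δ * D = 1
  inv_mul : D * Δ = 1
  row_entry : ∀ a b c, ρ c * X a b = X a b * ρ c
  col_entry : ∀ a b c, χ c * X a b = X a b * χ c
  delta_row : ∀ b, Δ * ρ b = ρ b * Δ
  delta_col : ∀ a, Δ * χ a = χ a * Δ
  delta_entry : ∀ a b, Δ * X a b = X a b * Δ + if a = b then 1 else 0
  row_row : ∀ a b, ρ a * ρ b = ε • (ρ b * ρ a)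
  col_col : ∀ a b, χ a * χ b = ε • (χ b * χ a)
  col_row : ∀ a b, χ a * ρ b = ε • (ρ b * χ a) + if a = b then 1 else 0

/-- The rank one update `X - ε χ D ρ`. -/
def border (ε : ℤ) (X : Matrix (Fin d) (Fin d) P) (ρ χ : Fin d → P) (D : P) :
    Matrix (Fin d) (Fin d) P := fun a b => X a b - ε • (χ a * D * ρ b)

/-- Exchanging the ψ's contributes -1 and moving x past ψ contributes ε. It serves both for γ
against a column and for γ against itself. -/
theorem sum_psi_mul_sum_psi (F : Fermions G P d) {ε : ℤ} (x y : Fin d → G)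
    (hx : ∀ a c, x a * F.psi c = ε • (F.psi c * x a))
    (hy : ∀ a c, y c * F.psi a = F.psi a * y c) (hxy : ∀ a c, x a * y c = y c * x a) :
    (∑ a, F.psi a * x a) * (∑ c, F.psi c * y c) =
      -ε • ((∑ c, F.psi c * y c) * (∑ a, F.psi a * x a)) := by
  rw [Finset.sum_mul_sum, Finset.sum_mul_sum, Finset.sum_comm, Finset.smul_sum]
  refine Finset.sum_congr rfl fun c _ => ?_
  rw [Finset.smul_sum]
  refine Finset.sum_congr rfl fun a _ => ?_
  calc F.psi a * x a * (F.psi c * y c) = F.psi a * (x a * F.psi c) * y c := by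
        noncomm_ring
    _ = ε • ((F.psi a * F.psi c) * (x a * y c)) := by
        rw [hx, mul_smul_comm, smul_mul_assoc]; noncomm_ring
    _ = -ε • (F.psi c * (F.psi a * y c) * x a) := by
        rw [F.psi_mul_psi, hxy, neg_mul, smul_neg, neg_smul]; noncomm_ring
    _ = _ := by rw [← hy]; noncomm_ring

namespace Bordering

variable (F : Fermions G P d) {ε : ℤ} {X : Matrix (Fin d) (Fin d) P} {ρ χ : Fin d → P} {Δ D : P}

section

variable (h : Bordering ε X ρ χ Δ D) {e : G}
  (hee : e * e = 1) (hec : ∀ p : P, e * F.coef p = F.coef p * e)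
  (hep : ∀ a, e * F.psi a = ε • (F.psi a * e))
include h hec

include hep in
-- Both parities are handled at once through `e`, which is 1 if ε = 1 and the degree parity if ε =
-- -1. Dressing ρ and χ with `e` gives them the sign ε against the ψ's, matching the sign they have
-- among themselves.
theorem gamma_colPsi (b : Fin d) :
    (∑ a, F.psi a * (e * F.coef (χ a))) * F.col X b =
      -ε • (F.col X b * ∑ a, F.psi a * (e * F.coef (χ a))) := by
  refine sum_psi_mul_sum_psi F _ _ (fun a c => ?_) (fun a c => ?_) fun a c => ?_
  · rw [mul_assoc, F.coef_mul_psi, ← mul_assoc, hep, smul_mul_assoc, mul_assoc]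
  · exact F.coef_mul_psi _ _
  · rw [mul_assoc, ← map_mul, h.col_entry, map_mul, ← mul_assoc, hec, mul_assoc]

include hee hep in
-- The canonical relation between χ_a and ρ_b contributes only for a = b, leaving the single term
-- ψ_b.
theorem row_gamma (b : Fin d) :
    (e * F.coef (ρ b)) * (∑ a, F.psi a * (e * F.coef (χ a))) =
      (∑ a, F.psi a * (e * F.coef (χ a))) * (e * F.coef (ρ b)) - F.psi b := by
  have hee' : ∀ x, e * (e * x) = x := fun x => by rw [← mul_assoc, hee, one_mul]
  have key : ∀ a, (e * F.coef (ρ b)) * (F.psi a * (e * F.coef (χ a))) =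
      F.psi a * (e * F.coef (χ a)) * (e * F.coef (ρ b)) -
        if a = b then F.psi b else 0 := by
    intro a
    have h1 : (e * F.coef (ρ b)) * (F.psi a * (e * F.coef (χ a))) =
        F.psi a * F.coef (ε • (ρ b * χ a)) := by
      calc (e * F.coef (ρ b)) * (F.psi a * (e * F.coef (χ a))) =
            e * (F.coef (ρ b) * F.psi a) * (e * F.coef (χ a)) := by noncomm_ring
        _ = (e * F.psi a) * (F.coef (ρ b) * e) * F.coef (χ a) := by
            rw [F.coef_mul_psi]; noncomm_ring
        _ = ε • (F.psi a * (e * (e * (F.coef (ρ b) * F.coef (χ a))))) := by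
            rw [hep, ← hec, smul_mul_assoc, smul_mul_assoc]; simp only [mul_assoc]
        _ = _ := by rw [hee', ← map_mul, map_zsmul, mul_smul_comm]
    have h2 : F.psi a * (e * F.coef (χ a)) * (e * F.coef (ρ b)) =
        F.psi a * F.coef (χ a * ρ b) := by
      rw [mul_assoc, mul_assoc e, ← mul_assoc (F.coef _) e, ← hec, mul_assoc e, hee', map_mul]
    rw [h1, h2, h.col_row, map_add, mul_add]
    split_ifs with hab
    · subst hab; simp
    · simp
  rw [Finset.mul_sum, Finset.sum_mul]
  simp only [key, Finset.sum_sub_distrib, Finset.sum_ite_eq', Finset.mem_univ, if_true]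

include hep in
theorem row_colPsi (b c : Fin d) :
    (e * F.coef (ρ b)) * F.col X c = ε • (F.col X c * (e * F.coef (ρ b))) := by
  rw [Fermions.col, Finset.mul_sum, Finset.sum_mul, Finset.smul_sum]
  refine Finset.sum_congr rfl fun a _ => ?_
  calc (e * F.coef (ρ b)) * (F.psi a * F.coef (X a c)) =
        e * (F.coef (ρ b) * F.psi a) * F.coef (X a c) := by noncomm_ring
    _ = (e * F.psi a) * (F.coef (ρ b) * F.coef (X a c)) := by
        rw [F.coef_mul_psi]; noncomm_ring
    _ = ε • (F.psi a * (e * F.coef (X a c)) * F.coef (ρ b)) := by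
        rw [hep, ← map_mul, h.row_entry, map_mul, smul_mul_assoc]; simp only [mul_assoc]
    _ = _ := by rw [hec]; simp only [mul_assoc]

include hee in
theorem row_row' (b c : Fin d) :
    (e * F.coef (ρ b)) * (e * F.coef (ρ c)) =
      ε • ((e * F.coef (ρ c)) * (e * F.coef (ρ b))) := by
  have key : ∀ b c, (e * F.coef (ρ b)) * (e * F.coef (ρ c)) = F.coef (ρ b * ρ c) := by
    intro b c
    rw [mul_assoc, ← mul_assoc (F.coef _) e, ← hec, mul_assoc e, ← mul_assoc, hee, one_mul,
      map_mul]
  rw [key, key, h.row_row, map_zsmul]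

omit hec in
-- The commutator with Δ sends X to the identity matrix, hence column b of X to the generator ψ_b.
theorem delta_colPsi (b : Fin d) :
    F.coef Δ * F.col X b = F.col X b * F.coef Δ + F.psi b := by
  have key : ∀ a, F.coef Δ * (F.psi a * F.coef (X a b)) =
      F.psi a * F.coef (X a b) * F.coef Δ + if a = b then F.psi b else 0 := by
    intro a
    rw [← mul_assoc, F.coef_mul_psi, mul_assoc, ← map_mul, h.delta_entry, map_add, map_mul, mul_add,
      mul_assoc]
    split_ifs with hab
    · subst hab; simp
    · simp
  rw [Fermions.col, Finset.mul_sum, Finset.sum_mul]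
  simp only [key, Finset.sum_add_distrib, Finset.sum_ite_eq', Finset.mem_univ, if_true]

theorem delta_row' (b : Fin d) :
    F.coef Δ * (e * F.coef (ρ b)) = e * F.coef (ρ b) * F.coef Δ := by
  rw [← mul_assoc, ← hec, mul_assoc, ← map_mul, h.delta_row, map_mul, mul_assoc]

theorem delta_gamma :
    F.coef Δ * (∑ a, F.psi a * (e * F.coef (χ a))) =
      (∑ a, F.psi a * (e * F.coef (χ a))) * F.coef Δ := by
  rw [Finset.mul_sum, Finset.sum_mul]
  refine Finset.sum_congr rfl fun a _ => ?_
  rw [← mul_assoc, F.coef_mul_psi, mul_assoc, ← mul_assoc _ e, ← hec, mul_assoc e, ← map_mul,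
    h.delta_col, map_mul]
  simp only [mul_assoc]

include hee in
omit h in
theorem colPsi_border (b : Fin d) :
    F.col (border ε X ρ χ D) b = F.col X b -
      ε • ((∑ a, F.psi a * (e * F.coef (χ a))) * F.coef D * (e * F.coef (ρ b))) := by
  simp only [Fermions.col, border, map_sub, mul_sub, Finset.sum_sub_distrib, Finset.sum_mul,
    Finset.smul_sum]
  congr 1
  refine Finset.sum_congr rfl fun a _ => ?_
  have hee' : ∀ x, e * (e * x) = x := fun x => by rw [← mul_assoc, hee, one_mul]
  rw [map_zsmul, mul_smul_comm]
  congr 1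
  have : e * F.coef (χ a) * F.coef D * (e * F.coef (ρ b)) =
      e * (F.coef (χ a * D) * e) * F.coef (ρ b) := by rw [map_mul]; simp only [mul_assoc]
  rw [mul_assoc (F.psi a), mul_assoc (F.psi a), this, ← hec, hee', map_mul, map_mul, ← map_mul,
    ← map_mul]

include hee hep in
-- The formula of `update_mul_update` is antisymmetric in its two columns term by term. The last
-- term needs γ² = 0 in the even case, and in the odd case the anticommutation of the dressed rows.
theorem colPsi_border_mul
    (hsq : (∑ a, F.psi a * (e * F.coef (χ a))) * (∑ a, F.psi a * (e * F.coef (χ a))) = 0 ∨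
      ε = -1) (hX : F.IsManin X) : F.IsManin (border ε X ρ χ D) := by
  intro b c
  set γ := ∑ a, F.psi a * (e * F.coef (χ a)) with hγ
  have key := update_mul_update h.sign (γ := γ) (Δ := F.coef Δ) (D := F.coef D)
    (by rw [← map_mul, h.mul_inv, map_one]) (by rw [← map_mul, h.inv_mul, map_one])
    (Ψ := F.col X) (ψ := F.psi) (r := fun b => e * F.coef (ρ b))
    (h.gamma_colPsi F hec hep) (h.row_gamma F hee hec hep) (h.row_colPsi F hec hep)
    (h.delta_colPsi F) (h.delta_row' F hec) (h.delta_gamma F hec) (F.coef_mul_psi Δ)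
  rw [colPsi_border F hee hec, colPsi_border F hee hec, key, key, hX b c]
  have h2 : γ * γ * (F.coef D * F.coef D) * ((e * F.coef (ρ b)) * (e * F.coef (ρ c))) =
      -(γ * γ * (F.coef D * F.coef D) * ((e * F.coef (ρ c)) * (e * F.coef (ρ b)))) := by
    rcases hsq with h0 | h0
    · simp [h0]
    · rw [h.row_row' F hee hec, h0]; simp
  rw [h2]
  noncomm_ring

end

/-- In the even case γ anticommutes with itself; `h2` then forces its square to vanish. -/
theorem gamma_mul_self (h : Bordering 1 X ρ χ Δ D) (h2 : ∀ x : G, x = -x → x = 0) :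
    (∑ a, F.psi a * (1 * F.coef (χ a))) * (∑ a, F.psi a * (1 * F.coef (χ a))) = 0 := by
  have := sum_psi_mul_sum_psi F (ε := 1) (fun a => 1 * F.coef (χ a)) (fun a => 1 * F.coef (χ a))
    (fun a c => by simp [F.coef_mul_psi]) (fun a c => by simp [F.coef_mul_psi])
    (fun a c => by rw [one_mul, one_mul, ← map_mul, h.col_col, one_smul, map_mul])
  exact h2 _ (by simpa using this)

theorem isManin_even (h : Bordering 1 X ρ χ Δ D) (h2 : ∀ x : G, x = -x → x = 0)
    (hX : F.IsManin X) : F.IsManin (border 1 X ρ χ D) :=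
  h.colPsi_border_mul F (e := 1) (by simp) (by simp) (by simp)
    (Or.inl (h.gamma_mul_self F h2)) hX

theorem isManin_odd (h : Bordering (-1) X ρ χ Δ D) (hX : F.IsManin X) :
    F.IsManin (border (-1) X ρ χ D) :=
  h.colPsi_border_mul F F.par_mul_par F.par_mul_coef (by simpa using F.par_mul_psi)
    (Or.inr rfl) hX

theorem prod_col_even (h : Bordering 1 X ρ χ Δ D) (h2 : ∀ x : G, x = -x → x = 0)
    (hX : F.IsManin X) {u : Fin d → P} (hu : ∀ a, ∑ b, X a b * u b = χ a) :
    ((List.finRange d).map (F.col X)).prod * F.coef (Δ - ∑ b, ρ b * u b) =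
      F.coef Δ * ((List.finRange d).map (F.col (border 1 X ρ χ D))).prod := by
  -- The extra fermion κ is adjoined by passing to 2×2 matrices. It is strictly upper triangular, so
  -- κ² = 0, and its entry `par` makes it anticommute with the columns while commuting with
  -- coefficients.
  let S : G →+* Matrix (Fin 2) (Fin 2) G := Matrix.scalar (Fin 2)
  let κ : Matrix (Fin 2) (Fin 2) G := !![0, F.par; 0, 0]
  have hS : ∀ x, S x = !![x, 0; 0, x] := by
    intro x
    ext i j
    fin_cases i <;> fin_cases j <;> simp [S]
  have hκ : ∀ x y : G, F.par * x = y * F.par → κ * S x = S y * κ := by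
    intro x y hxy
    ext i j
    fin_cases i <;> fin_cases j <;> simp [hS, κ, hxy]
  have hκ' : ∀ x y : G, F.par * x = -(y * F.par) → κ * S x = -(S y * κ) := by
    intro x y hxy
    rw [hκ x (-y) (by rw [hxy, neg_mul]), map_neg, neg_mul]
  set γ := ∑ a, F.psi a * (1 * F.coef (χ a)) with hγ
  have hγu : γ = ∑ b, F.col X b * F.coef (u b) := by
    simp only [hγ, Fermions.col, Finset.sum_mul, ← hu, map_sum, one_mul, Finset.mul_sum, map_mul]
    rw [Finset.sum_comm]
    simp only [mul_assoc]
  have hpar : ∀ x : Fin d → P, F.par * (∑ a, F.psi a * F.coef (x a)) =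
      -((∑ a, F.psi a * F.coef (x a)) * F.par) := by
    intro x
    rw [Finset.mul_sum, Finset.sum_mul, ← Finset.sum_neg_distrib]
    refine Finset.sum_congr rfl fun a _ => ?_
    rw [← mul_assoc, F.par_mul_psi, mul_assoc, ← F.par_mul_coef]
    noncomm_ring
  have key := even_exchange (Ψ := fun b => S (F.col X b)) (ψ := fun b => S (F.psi b))
    (r := fun b => S (1 * F.coef (ρ b))) (u := fun b => S (F.coef (u b))) (κ := κ) (γ := S γ)
    (Δ := S (F.coef Δ)) (D := S (F.coef D)) (List.finRange d) (List.mem_finRange)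
    (fun b => hκ' _ _ (hpar _)) (fun b => hκ _ _ (by rw [one_mul, F.par_mul_coef]))
    (by ext i j; fin_cases i <;> fin_cases j <;> simp [κ])
    (hκ' _ _ (by simpa [hγ] using hpar χ)) (hκ _ _ (F.par_mul_coef _))
    (by rw [← map_mul, ← map_mul, h.mul_inv, map_one, map_one])
    (fun b c => by rw [← map_mul, ← map_mul, ← map_neg, hX b c])
    (fun b => by rw [← map_mul, h2 _ (hX b b), map_zero])
    (fun b c => by
      rw [← map_mul, ← map_mul, h.row_colPsi F (e := 1) (by simp) (by simp), one_smul])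
    (by rw [← map_mul, h.gamma_mul_self F h2, map_zero])
    (by rw [← map_mul, ← map_mul, h.delta_gamma F (e := 1) (by simp)])
    (fun b => by
      rw [← map_mul, ← map_mul, ← map_neg, h.gamma_colPsi F (e := 1) (by simp) (by simp), neg_smul,
        one_smul])
    (fun b => by
      rw [← map_mul, ← map_mul, ← map_sub, h.row_gamma F (e := 1) (by simp) (by simp) (by simp)])
    (fun b => by rw [← map_mul, ← map_mul, ← map_add, h.delta_colPsi F])
    (by rw [hγu, map_sum]; simp only [map_mul])
  have e1 : (fun b => S (F.col X b) - S γ * S (F.coef D) * S (1 * F.coef (ρ b))) =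
      fun b => S (F.col (border 1 X ρ χ D) b) := by
    funext b
    rw [colPsi_border F (e := 1) (by simp) (by simp), one_smul, ← hγ, map_sub,
      map_mul S (γ * _), map_mul S γ]
  have e2 : S (F.coef Δ) - ∑ b, S (1 * F.coef (ρ b)) * S (F.coef (u b)) =
      S (F.coef (Δ - ∑ b, ρ b * u b)) := by
    simp only [map_sub, map_sum, map_mul, one_mul]
  have e3 : ∀ f : Fin d → G, ((List.finRange d).map fun b => S (f b)).prod =
      S ((List.finRange d).map f).prod := by
    intro f
    rw [map_list_prod, List.map_map]
    rfl
  rw [e1, e2, e3, e3, ← map_mul, add_mul, mul_assoc, ← map_mul, ← map_mul] at key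
  -- The upper right entry is the coefficient of κ; the γ-term is a scalar matrix and does not
  -- contribute. The common factor `par` is then cancelled.
  have k2 := congrFun (congrFun key 0) 1
  simp only [hS, κ] at k2
  simp only [Matrix.add_apply, Matrix.mul_apply, Fin.sum_univ_two, Matrix.of_apply,
    Matrix.cons_val', Matrix.cons_val_zero, Matrix.cons_val_one, Matrix.cons_val_fin_one,
    mul_zero, zero_add] at k2
  have k3 := congrArg (F.par * ·) k2
  simpa only [← mul_assoc, F.par_mul_par, one_mul] using k3

end Bordering

end BetheDuality
end

/-! ### The bordering identities for column determinants -/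

noncomputable section
namespace BetheDuality

open Fock
open scoped TensorProduct

variable {R P : Type*} [CommRing R] [Ring P] [Algebra R P] {d : ℕ}

variable (R P d) in
/-- The fermions acting on the Fock module. -/
def fock : Fermions (Module.End R (Fock R P d)) P d where
  coef := coef R d
  psi := psi R P
  coef_mul_psi := coef_mul_psi
  psi_mul_psi := psi_mul_psi
  par := par R P d
  par_mul_par := par_mul_par
  par_mul_coef := par_mul_coef
  par_mul_psi := par_mul_psi

theorem eq_zero_of_eq_neg (h2 : IsUnit (2 : P)) (x : Module.End R (Fock R P d)) (hx : x = -x) :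
    x = 0 := by
  have h3 : IsUnit (2 : Module.End R (Fock R P d)) := by
    have := h2.map (coef R d); rwa [map_ofNat] at this
  have h4 : 2 * x = 2 * 0 := by rw [two_mul, mul_zero]; nth_rw 2 [hx]; exact add_neg_cancel x
  exact h3.mul_left_cancel h4

namespace Bordering

variable {X : Matrix (Fin d) (Fin d) P} {ρ χ : Fin d → P} {Δ D : P}

/-- The determinant of the matrix with blocks X, χ, ρ, Δ is expanded through either Schur
complement. The operator identity `prod_col_even` is applied to the vacuum and its top coefficient
is taken. -/
theorem cdet_even (h : Bordering 1 X ρ χ Δ D) (h2 : IsUnit (2 : P))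
    (hX : (fock R P d).IsManin X) {u : Fin d → P} (hu : ∀ a, ∑ b, X a b * u b = χ a) :
    cdet X * (Δ - ∑ b, ρ b * u b) = Δ * cdet (border 1 X ρ χ D) := by
  have key := h.prod_col_even (fock R P d) (fun x => eq_zero_of_eq_neg h2 x) hX hu
  have k2 := congrArg (fun f : Module.End R (Fock R P d) => top R P d (f (1 ⊗ₜ 1))) key
  have e := fun X p => top_prod_colPsi (R := R) (P := P) (d := d) X p
  simp only [Module.End.mul_apply] at k2
  have e1 : (fock R P d).coef (Δ - ∑ b, ρ b * u b) (1 ⊗ₜ 1) = (Δ - ∑ b, ρ b * u b) ⊗ₜ 1 := by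
    change coef R d _ _ = _
    rw [coef_tmul, mul_one]
  rw [e1] at k2
  have e2 := e X (Δ - ∑ b, ρ b * u b)
  have e3 := e (border 1 X ρ χ D) 1
  change top R P d (((List.finRange d).map (colPsi X)).prod _) =
    top R P d (coef R d Δ (((List.finRange d).map (colPsi _)).prod _)) at k2
  rw [e2, top_coef, e3, mul_one] at k2
  exact k2

variable (h : Bordering (-1) X ρ χ Δ D)

theorem col_mem_graded {S T : Set ℕ} (hST : ∀ k ∈ S, k + 1 ∈ T) (x : Fin d → Module.End R (Fock R P d))
    (hx : ∀ a, ∀ v ∈ graded R P d S, x a v ∈ graded R P d S) {v : Fock R P d}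
    (hv : v ∈ graded R P d S) : (∑ a, psi R P a * x a) v ∈ graded R P d T := by
  rw [LinearMap.sum_apply]
  exact AddSubgroup.sum_mem _ fun a _ => psi_mem_graded hST a (hx a v hv)

theorem prod_mem_graded {f : Fin d → Module.End R (Fock R P d)}
    (hf : ∀ b k, ∀ v ∈ graded R P d {k}, f b v ∈ graded R P d {k + 1}) (l : List (Fin d))
    {v : Fock R P d} (hv : v ∈ graded R P d {0}) :
    (l.map f).prod v ∈ graded R P d {l.length} := by
  induction l with
  | nil => simpa using hv
  | cons b l ih => exact hf b _ _ ih

/-- Each f raises the degree by one and each g preserves it, so every term involving some g falls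
short of the maximal degree. -/
theorem prod_sub_mem_graded {f g : Fin d → Module.End R (Fock R P d)}
    (hf : ∀ b k, ∀ v ∈ graded R P d {k}, f b v ∈ graded R P d {k + 1})
    (hf' : ∀ b k, ∀ v ∈ graded R P d {i | i < k}, f b v ∈ graded R P d {i | i < k + 1})
    (hg : ∀ b S, ∀ v ∈ graded R P d S, g b v ∈ graded R P d S) (l : List (Fin d))
    {v : Fock R P d} (hv : v ∈ graded R P d {0}) :
    (l.map fun b => f b - g b).prod v - (l.map f).prod v ∈ graded R P d {i | i < l.length} := by
  induction l with
  | nil => simp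
  | cons b l ih =>
    simp only [List.map_cons, List.prod_cons, Module.End.mul_apply, List.length_cons]
    set x := (l.map fun b => f b - g b).prod v
    set y := (l.map f).prod v with hy
    have e : (f b - g b) x - f b y = f b (x - y) - g b (x - y) - g b y := by
      simp only [LinearMap.sub_apply, map_sub]; abel
    rw [e]
    refine sub_mem (sub_mem (hf' b _ _ ih) (graded_mono (fun i hi => ?_) (hg b _ _ ih)))
      (graded_mono (fun i hi => ?_) (hg b _ _ (prod_mem_graded hf l hv)))
    · simp only [Set.mem_ofPred_eq] at hi ⊢; omega
    · simp only [Set.mem_ofPred_eq, Set.mem_singleton_iff] at hi ⊢; omega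

/-- Replacing the factors `f b` by `f b + Φ g_b`, where `Φ` commutes with the `f b`, changes the
product by a multiple of `Φ` of lower degree. -/
theorem exists_prod_sub {f g f' : Fin d → Module.End R (Fock R P d)} {Φ : Module.End R (Fock R P d)}
    (hΦ : ∀ b, Φ * f b = f b * Φ) (hf' : ∀ b, f' b = f b + Φ * g b)
    (hf : ∀ b k, ∀ v ∈ graded R P d {i | i < k}, f b v ∈ graded R P d {i | i < k + 1})
    (hd : ∀ b k, ∀ v ∈ graded R P d {k}, f' b v ∈ graded R P d {k + 1})
    (hg : ∀ b S, ∀ v ∈ graded R P d S, g b v ∈ graded R P d S) (l : List (Fin d))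
    {v : Fock R P d} (hv : v ∈ graded R P d {0}) :
    ∃ x ∈ graded R P d {i | i < l.length}, (l.map f).prod v - (l.map f').prod v = Φ x := by
  induction l with
  | nil => exact ⟨0, zero_mem _, by simp⟩
  | cons b l ih =>
    obtain ⟨x, hx, hxe⟩ := ih
    refine ⟨f b x - g b ((l.map f').prod v), sub_mem (hf b _ _ hx)
      (graded_mono (fun i hi => ?_) (hg b _ _ (prod_mem_graded hd l hv))), ?_⟩
    · simp only [Set.mem_ofPred_eq, Set.mem_singleton_iff, List.length_cons] at hi ⊢; omega
    · simp only [List.map_cons, List.prod_cons, Module.End.mul_apply]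
      have e : Φ (f b x) = f b (Φ x) := LinearMap.congr_fun (hΦ b) x
      rw [map_sub, e, ← hxe, hf', map_sub, LinearMap.add_apply, Module.End.mul_apply]
      abel

include h in
-- Here Φ = Δ + γ is not nilpotent, so the updated columns cannot simply be absorbed behind it.
-- Instead the exchange identity determines Φ applied to the product of shifted columns, and Φ is
-- inverted on the relevant vectors: Δ is invertible and γ raises the degree, which is bounded by d.
theorem cdet_odd (h2 : IsUnit (2 : P))
    (hX : (fock R P d).IsManin X) {u : Fin d → P} (hu : ∀ a, ∑ b, X a b * u b = χ a) :
    cdet (border (-1) X ρ χ D) * (Δ + ∑ b, ρ b * u b) = Δ * cdet X := by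
  let F := fock R P d
  set θ := Δ + ∑ b, ρ b * u b with hθ
  set Ψ : Fin d → Module.End R (Fock R P d) := F.col X with hΨ
  set r : Fin d → Module.End R (Fock R P d) := fun b => F.par * F.coef (ρ b) with hr
  set γ : Module.End R (Fock R P d) := ∑ a, F.psi a * (F.par * F.coef (χ a)) with hγ
  set Ψ' : Fin d → Module.End R (Fock R P d) := F.col (border (-1) X ρ χ D) with hΨ'
  set Φ : Module.End R (Fock R P d) := F.coef Δ + γ with hΦ
  have hep : ∀ a, F.par * F.psi a = (-1 : ℤ) • (F.psi a * F.par) := by simpa using F.par_mul_psi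
  have hcomm : ∀ b, Φ * (Ψ b - r b) = (Ψ b - r b) * Φ :=
    odd_shift_comm (ψ := F.psi) (h.delta_row' F F.par_mul_coef)
      (fun b => by simpa using h.gamma_colPsi F F.par_mul_coef hep b)
      (h.row_gamma F F.par_mul_par F.par_mul_coef hep) (h.delta_colPsi F)
  have hanti : ∀ b c, (Ψ b - r b) * (Ψ c - r c) = -((Ψ c - r c) * (Ψ b - r b)) :=
    odd_shift_anticomm hX (fun b c => by simpa using h.row_row' F F.par_mul_par F.par_mul_coef b c)
      (fun b c => by simpa using h.row_colPsi F F.par_mul_coef hep b c)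
  have hpp : ∀ x y : P, F.par * F.coef x * (F.par * F.coef y) = F.coef (x * y) := by
    intro x y
    rw [F.par_mul_coef x, mul_assoc, ← mul_assoc F.par, F.par_mul_par, one_mul, map_mul]
  have hγu : γ = ∑ b, Ψ b * (F.par * F.coef (u b)) := by
    simp only [hγ, hΨ, Fermions.col, Finset.sum_mul, ← hu, map_sum, Finset.mul_sum, map_mul]
    rw [Finset.sum_comm]
    refine Finset.sum_congr rfl fun b _ => Finset.sum_congr rfl fun a _ => ?_
    rw [← mul_assoc F.par, F.par_mul_coef]
    simp only [mul_assoc]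
  have hex := odd_exchange (List.finRange d) (List.mem_finRange) hcomm hanti
    (fun b => eq_zero_of_eq_neg h2 _ (hanti b b)) hγu
  -- The two parity operators, one in r and one in the dressed u, cancel and leave θ.
  have hθ' : F.coef Δ + ∑ b, r b * (F.par * F.coef (u b)) = F.coef θ := by
    simp only [hr, hpp, hθ, map_add, map_sum]
  rw [hθ'] at hex
  have hcoef : ∀ (p : P) (S : Set ℕ), ∀ v ∈ graded R P d S, F.coef p v ∈ graded R P d S :=
    fun p S v hv => coef_mem_graded p hv
  have hpar : ∀ (p : P) (S : Set ℕ), ∀ v ∈ graded R P d S,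
      (F.par * F.coef p) v ∈ graded R P d S :=
    fun p S v hv => par_mem_graded (coef_mem_graded p hv)
  have hcol : ∀ (Y : Matrix (Fin d) (Fin d) P) b (S T : Set ℕ), (∀ k ∈ S, k + 1 ∈ T) →
      ∀ v ∈ graded R P d S, F.col Y b v ∈ graded R P d T :=
    fun Y b S T hST v hv => col_mem_graded hST _ (fun a v hv => hcoef _ _ v hv) hv
  have hγm : ∀ (S T : Set ℕ), (∀ k ∈ S, k + 1 ∈ T) →
      ∀ v ∈ graded R P d S, γ v ∈ graded R P d T :=
    fun S T hST v hv => col_mem_graded hST _ (fun a v hv => hpar _ _ v hv) hv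
  have hlt : ∀ k, ∀ i ∈ {i : ℕ | i < k}, i + 1 ∈ {i : ℕ | i < k + 1} := by
    intro k i hi; simp only [Set.mem_ofPred_eq] at hi ⊢; omega
  have hsing : ∀ k, ∀ i ∈ ({k} : Set ℕ), i + 1 ∈ ({k + 1} : Set ℕ) := by
    rintro k i rfl; rfl
  have hDΔ : F.coef D * F.coef Δ = 1 := by rw [← map_mul, h.inv_mul, map_one]
  have hΔD : F.coef Δ * F.coef D = 1 := by rw [← map_mul, h.mul_inv, map_one]
  -- The updated column is Ψ_b + γ D r_b = (Ψ_b - r_b) + Φ D r_b, so passing to updated columns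
  -- costs Φ x with x of degree below d.
  obtain ⟨x, hx, hxe⟩ := exists_prod_sub (f := fun b => Ψ b - r b) (f' := Ψ')
    (g := fun b => F.coef D * r b) hcomm (fun b => by
      have e1 : Ψ' b = Ψ b + γ * F.coef D * r b := by
        have := colPsi_border F (ε := -1) (X := X) (ρ := ρ) (χ := χ) (D := D) F.par_mul_par F.par_mul_coef b
        rw [hΨ', this]
        simp [hΨ, hγ, hr]
      have e2 : Φ * (F.coef D * r b) = r b + γ * F.coef D * r b := by
        rw [hΦ, add_mul, ← mul_assoc, hΔD, one_mul, mul_assoc]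
      rw [e1, e2]; abel)
    (fun b k v hv => by
      refine sub_mem (hcol X b _ _ (hlt k) v hv) (graded_mono (fun i hi => ?_) (hpar _ _ v hv))
      simp only [Set.mem_ofPred_eq] at hi ⊢; omega)
    (fun b k v hv => hcol _ b _ _ (hsing k) v hv)
    (fun b S v hv => hcoef D _ _ (hpar _ _ v hv)) (List.finRange d) (vac_mem_graded θ)
  rw [List.length_finRange] at hx
  set w : Fock R P d := 1 ⊗ₜ 1 with hw
  set t := ((List.finRange d).map Ψ').prod (θ ⊗ₜ 1) with ht
  have htm : t ∈ graded R P d {d} := by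
    have := prod_mem_graded (f := Ψ') (fun b k v hv => hcol _ b _ _ (hsing k) v hv)
      (List.finRange d) (vac_mem_graded (R := R) (d := d) θ)
    rwa [List.length_finRange] at this
  have hvw : (θ ⊗ₜ 1 : Fock R P d) = F.coef θ w := by
    change _ = coef R d θ w
    rw [hw, coef_tmul, mul_one]
  have e1 : Φ (((List.finRange d).map fun b => Ψ b - r b).prod w - x) = t := by
    have := LinearMap.congr_fun hex w
    rw [map_sub, ← hxe]
    simp only [Module.End.mul_apply] at this
    rw [this, hvw]
    abel
  -- t already has top degree d, so γ annihilates D t.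
  have e2 : Φ (F.coef D t) = t := by
    have h0 : γ (F.coef D t) = 0 :=
      eq_zero_of_mem_graded (S := {d + 1}) (by rintro k rfl; exact Nat.lt_succ_self d)
        (hγm _ _ (hsing d) _ (hcoef _ _ _ htm))
    rw [hΦ, LinearMap.add_apply, h0, add_zero]
    exact LinearMap.congr_fun hΔD t
  -- A kernel vector satisfies y = -D γ y; iterating pushes y into degrees above d, where everything
  -- is zero.
  have hinj : ∀ y, Φ y = 0 → y = 0 := by
    intro y hy
    have h1 : y = -F.coef D (γ y) := by
      have h3 := congrArg (F.coef D) hy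
      rw [hΦ, LinearMap.add_apply, map_add, map_zero] at h3
      have h4 : F.coef D (F.coef Δ y) = y := LinearMap.congr_fun hDΔ y
      rw [h4] at h3
      exact eq_neg_of_add_eq_zero_left h3
    have h5 : ∀ k : ℕ, y ∈ graded R P d {i | k ≤ i} := by
      intro k
      induction k with
      | zero => simpa using mem_graded_univ y
      | succ k ih =>
        rw [h1]
        refine neg_mem (hcoef _ _ _ (hγm _ _ (fun i hi => ?_) _ ih))
        simp only [Set.mem_ofPred_eq] at hi ⊢; omega
    exact eq_zero_of_mem_graded (fun k hk => hk) (h5 (d + 1))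
  have e3 : ((List.finRange d).map fun b => Ψ b - r b).prod w - x = F.coef D t := by
    rw [← sub_eq_zero]
    exact hinj _ (by rw [map_sub, e1, e2, sub_self])
  -- In top degree neither the shifts r nor the vector x is visible, so the equality of vectors `e3`
  -- becomes cdet X = D · cdet(X') · θ.
  have e4 := prod_sub_mem_graded (f := Ψ) (g := r) (fun b k v hv => hcol _ b _ _ (hsing k) v hv)
    (fun b k v hv => hcol _ b _ _ (hlt k) v hv) (fun b S v hv => hpar _ _ v hv) (List.finRange d)
    (vac_mem_graded (R := R) (d := d) (1 : P))
  rw [List.length_finRange] at e4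
  have e5 := top_eq_zero (by simp) e4
  have e6 := top_eq_zero (by simp) hx
  have e7 := congrArg (top R P d) e3
  have e8 : top R P d (((List.finRange d).map Ψ).prod w) = cdet X * 1 := top_prod_colPsi X 1
  have e9 : top R P d t = cdet (border (-1) X ρ χ D) * θ := top_prod_colPsi _ θ
  have e10 : top R P d (F.coef D t) = D * top R P d t := top_coef D t
  rw [map_sub, e6, e10, e9, sub_zero] at e7
  rw [map_sub, e8, mul_one, sub_eq_zero] at e5
  rw [← e5, e7, ← mul_assoc, h.mul_inv, one_mul]

end Bordering

end BetheDuality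
end

/-! ### Duality for abstract oscillators -/

noncomputable section
namespace BetheDuality

/-- The sign `(-1)^a` of a parity as an integer. -/
def intSign (a : ZMod 2) : ℤ := if a = 0 then 1 else -1

theorem intSign_mul_self (a : ZMod 2) : intSign a * intSign a = 1 := by
  rw [intSign]; split_ifs <;> norm_num

theorem intSign_sq (a : ZMod 2) : intSign (a * a) = intSign a := by
  have h : ∀ x : ZMod 2, x * x = x := by decide
  rw [h]

/-- Oscillators `ρ`, `χ` with parities `s`, together with invertible elements `Δ i` (with inverses
`D i`) and elements `W a` such that `[Δ i, W a] = 1`. -/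
structure Oscillators (P : Type*) [Ring P] (N d : ℕ) where
  s : Fin N → ZMod 2
  ρ : Fin N → Fin d → P
  χ : Fin N → Fin d → P
  Δ : Fin N → P
  D : Fin N → P
  W : Fin d → P
  Δ_mul_D : ∀ i, Δ i * D i = 1
  D_mul_Δ : ∀ i, D i * Δ i = 1
  Δ_comm : ∀ i j, Δ i * Δ j = Δ j * Δ i
  Δ_ρ : ∀ i j a, Commute (Δ i) (ρ j a)
  Δ_χ : ∀ i j a, Commute (Δ i) (χ j a)
  W_ρ : ∀ a j b, Commute (W a) (ρ j b)
  W_χ : ∀ a j b, Commute (W a) (χ j b)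
  W_comm : ∀ a b, W a * W b = W b * W a
  Δ_W : ∀ i a, Δ i * W a = W a * Δ i + 1
  ρ_ρ : ∀ i a j b, ρ i a * ρ j b = intSign (s i * s j) • (ρ j b * ρ i a)
  χ_χ : ∀ i a j b, χ i a * χ j b = intSign (s i * s j) • (χ j b * χ i a)
  χ_ρ : ∀ i a j b, χ i a * ρ j b = intSign (s i * s j) • (ρ j b * χ i a) +
    if (i, a) = (j, b) then 1 else 0

namespace Oscillators

variable {P : Type*} [Ring P] {N d : ℕ} (O : Oscillators P N d)

/-- The matrix `W - ∑_{i < k} (-1)^{s i} χ_i (Δ i)⁻¹ ρ_i`. -/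
def lax (k : ℕ) : Matrix (Fin d) (Fin d) P := fun a b =>
  (if a = b then O.W a else 0) - ∑ i with (i : Fin N).val < k,
    intSign (O.s i) • (O.χ i a * O.D i * O.ρ i b)

theorem lax_succ (k : Fin N) :
    O.lax (k + 1) = border (intSign (O.s k)) (O.lax k) (O.ρ k) (O.χ k) (O.D k) := by
  ext a b
  have h : Finset.univ.filter (fun i : Fin N => i.val < k + 1) =
      insert k (Finset.univ.filter (fun i : Fin N => i.val < k)) := by
    ext i
    simp only [Finset.mem_filter, Finset.mem_univ, true_and, Finset.mem_insert, Fin.ext_iff]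
    omega
  simp only [lax, border, h]
  rw [Finset.sum_insert (by simp)]
  abel

theorem D_comm {i : Fin N} {x : P} (h : Commute (O.Δ i) x) : Commute (O.D i) x := by
  let v : Pˣ := ⟨O.Δ i, O.D i, O.Δ_mul_D i, O.D_mul_Δ i⟩
  have : Commute (v : P) x := h
  exact this.units_inv_left

/-- Passing x and then y yields the same sign twice, so the bilinear x D y commutes with z even
though its factors may not. -/
theorem pair_comm {x y z D : P} {ε : ℤ} (hε : ε * ε = 1) (hD : Commute D z)
    (hx : z * x = ε • (x * z)) (hy : z * y = ε • (y * z)) : z * (x * D * y) = x * D * y * z := by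
  calc z * (x * D * y) = (z * x) * D * y := by noncomm_ring
    _ = ε • (x * (z * D) * y) := by rw [hx]; simp only [smul_mul_assoc, mul_assoc]
    _ = ε • (x * D * (z * y)) := by rw [← hD.eq]; simp only [mul_assoc]
    _ = _ := by rw [hy, mul_smul_comm, smul_smul, hε, one_smul, mul_assoc (x * D)]

theorem comm_lax {k : ℕ} {z : P} (hW : ∀ a, Commute (O.W a) z)
    (h : ∀ i : Fin N, i.val < k → ∀ a b,
      z * (O.χ i a * O.D i * O.ρ i b) = O.χ i a * O.D i * O.ρ i b * z) (a b : Fin d) :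
    z * O.lax k a b = O.lax k a b * z := by
  rw [lax, mul_sub, sub_mul, Finset.mul_sum, Finset.sum_mul]
  congr 1
  · split_ifs
    · exact (hW a).symm
    · simp
  · refine Finset.sum_congr rfl fun i hi => ?_
    rw [mul_smul_comm, h i (Finset.mem_filter.1 hi).2, smul_mul_assoc]

/-- The k-th oscillator does not occur in `lax k`, where only indices i < k enter. It therefore
supercommutes with each χ_i and ρ_i separately and commutes with the bilinears χ_i D_i ρ_i. -/
theorem bordering (k : Fin N) :
    Bordering (intSign (O.s k)) (O.lax k) (O.ρ k) (O.χ k) (O.Δ k) (O.D k) where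
  sign := intSign_mul_self _
  mul_inv := O.Δ_mul_D k
  inv_mul := O.D_mul_Δ k
  row_entry a b c := by
    refine O.comm_lax (fun a => O.W_ρ a k c) (fun i hi a b => ?_) a b
    have hne : ¬ ((i, a) : Fin N × Fin d) = (k, c) := by rintro ⟨⟩; exact lt_irrefl _ hi
    refine pair_comm (intSign_mul_self (O.s k * O.s i)) (O.D_comm (O.Δ_ρ i k c)) ?_ (O.ρ_ρ _ _ _ _)
    rw [O.χ_ρ, if_neg hne, add_zero, smul_smul, mul_comm (O.s i), intSign_mul_self, one_smul]
  col_entry a b c := by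
    refine O.comm_lax (fun a => O.W_χ a k c) (fun i hi a b => ?_) a b
    have hne : ¬ ((k, c) : Fin N × Fin d) = (i, b) := by rintro ⟨⟩; exact lt_irrefl _ hi
    refine pair_comm (intSign_mul_self (O.s k * O.s i)) (O.D_comm (O.Δ_χ i k c)) (O.χ_χ _ _ _ _) ?_
    rw [O.χ_ρ, if_neg hne, add_zero]
  delta_row b := O.Δ_ρ k k b
  delta_col a := O.Δ_χ k k a
  delta_entry a b := by
    have h1 : O.Δ k * (∑ i with (i : Fin N).val < k, intSign (O.s i) • (O.χ i a * O.D i * O.ρ i b)) =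
        (∑ i with (i : Fin N).val < k, intSign (O.s i) • (O.χ i a * O.D i * O.ρ i b)) * O.Δ k := by
      rw [Finset.mul_sum, Finset.sum_mul]
      refine Finset.sum_congr rfl fun i _ => ?_
      have hD : Commute (O.D i) (O.Δ k) := O.D_comm (O.Δ_comm i k)
      rw [mul_smul_comm, smul_mul_assoc,
        ((O.Δ_χ k i a).mul_right hD.symm).mul_right (O.Δ_ρ k i b)]
    rw [lax, mul_sub, h1, sub_mul]
    split_ifs
    · rw [O.Δ_W]; abel
    · simp
  row_row a b := by rw [O.ρ_ρ k a k b, intSign_sq]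
  col_col a b := by rw [O.χ_χ k a k b, intSign_sq]
  col_row a b := by rw [O.χ_ρ k a k b, intSign_sq]; simp

/-- The matrix is diagonal with commuting entries, so the signs come from the ψ's alone. This starts
the induction. -/
theorem isManin_lax_zero {G : Type*} [Ring G] (F : Fermions G P d) : F.IsManin (O.lax 0) := by
  have h : ∀ b, F.col (O.lax 0) b = F.psi b * F.coef (O.W b) := by
    intro b
    simp only [Fermions.col, lax]
    rw [Finset.sum_eq_single b]
    · simp
    · intro a _ hab; simp [hab]
    · simp
  intro b c
  have key : ∀ b c, F.col (O.lax 0) b * F.col (O.lax 0) c =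
      F.psi b * F.psi c * F.coef (O.W b * O.W c) := by
    intro b c
    rw [h, h, mul_assoc, ← mul_assoc (Fermions.coef _ _), F.coef_mul_psi, map_mul]
    simp only [mul_assoc]
  rw [key, key, F.psi_mul_psi b c, O.W_comm]
  rw [neg_mul]

/-- The duality for oscillators: the elements `θ k` are the bordering Schur complements. -/
theorem cdet_mul_prod (h2 : IsUnit (2 : P)) (u : Fin N → Fin d → P)
    (hu : ∀ (k : Fin N) a, ∑ b, O.lax k a b * u k b = O.χ k a) (θ : Fin N → P) (hθ : ∀ k, IsUnit (θ k))
    (hθu : ∀ k, θ k = O.Δ k - intSign (O.s k) • ∑ b, O.ρ k b * u k b) :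
    cdet (O.lax 0) *
        (List.ofFn fun k => if O.s k = 0 then θ k else Ring.inverse (θ k)).prod =
      (List.ofFn fun k => if O.s k = 0 then O.Δ k else O.D k).prod * cdet (O.lax N) := by
  -- The Manin property is carried along because each bordering step requires it. The Fock module is
  -- taken over ℤ, since P is only assumed to be a ring.
  have key : ∀ (k : ℕ) (hk : k ≤ N), (fock ℤ P d).IsManin (O.lax k) ∧
      cdet (O.lax 0) * (List.ofFn fun i : Fin k => if O.s (i.castLE hk) = 0 then θ (i.castLE hk)
          else Ring.inverse (θ (i.castLE hk))).prod =
        (List.ofFn fun i : Fin k => if O.s (i.castLE hk) = 0 then O.Δ (i.castLE hk)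
          else O.D (i.castLE hk)).prod * cdet (O.lax k) := by
    intro k
    induction k with
    | zero => exact fun _ => ⟨O.isManin_lax_zero _, by simp⟩
    | succ k ih =>
      intro hk
      obtain ⟨ih1, ih2⟩ := ih (Nat.le_of_succ_le hk)
      set j : Fin N := ⟨k, hk⟩ with hj
      have hlast : Fin.castLE hk (Fin.last k) = j := rfl
      have hcast : ∀ i : Fin k, Fin.castLE hk i.castSucc = Fin.castLE (Nat.le_of_succ_le hk) i :=
        fun i => rfl
      have hB := O.bordering j
      have hS : O.lax (k + 1) = _ := O.lax_succ j
      have hjv : O.lax k = O.lax j := rfl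
      rw [List.ofFn_succ', List.ofFn_succ', List.prod_concat, List.prod_concat]
      simp only [hlast, hcast]
      rw [← mul_assoc, ih2, mul_assoc, mul_assoc, hS]
      rw [hjv] at ih1 ⊢
      by_cases hs : O.s j = 0
      · have hε : intSign (O.s j) = 1 := by simp [intSign, hs]
        rw [hε] at hB ⊢
        refine ⟨hB.isManin_even _ (fun x => eq_zero_of_eq_neg h2 x) ih1, ?_⟩
        have := hB.cdet_even h2 ih1 (hu j)
        rw [if_pos hs, if_pos hs, hθu, hε, one_smul, this]
      · have hε : intSign (O.s j) = -1 := by simp [intSign, hs]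
        rw [hε] at hB ⊢
        refine ⟨hB.isManin_odd _ ih1, ?_⟩
        have := hB.cdet_odd h2 ih1 (hu j)
        rw [if_neg hs, if_neg hs]
        have h3 : O.Δ j + ∑ b, O.ρ j b * u j b = θ j := by rw [hθu, hε, neg_smul, one_smul]; abel
        rw [h3] at this
        congr 1
        -- The odd identity reads cdet(X') θ = Δ cdet(X); multiplying by D on the left and θ⁻¹ on
        -- the right puts it in the form of the induction.
        calc cdet (O.lax j) * Ring.inverse (θ j) =
              O.D j * (O.Δ j * cdet (O.lax j)) * Ring.inverse (θ j) := by
              rw [← mul_assoc (O.D j), O.D_mul_Δ, one_mul]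
          _ = _ := by
              rw [← this, mul_assoc, mul_assoc, Ring.mul_inverse_cancel _ (hθ j), mul_one]
  exact (key N le_rfl).2

/-- The matrix `Δ - (-1)^s ρ W⁻¹ χ` over the oscillator indices. -/
def dual (Wi : Fin d → P) : Matrix (Fin N) (Fin N) P := fun i j =>
  (if i = j then O.Δ i else 0) - intSign (O.s i) • ∑ a, O.ρ i a * Wi a * O.χ j a

/-- The Schur complement is read off from one linear system: a vector x with last entry 1 is found
such that A x vanishes except for θ in the last row. Applying A⁻¹ and taking the last entry gives
(A⁻¹)_{kk} θ = 1, so the quasiminor is θ. -/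
theorem quasiminor_dual {Wi : Fin d → P} (hWi : ∀ a, Wi a * O.W a = 1) (k : Fin N)
    (hk : QuasidetDefined (leading (O.dual Wi) k) (Fin.last k) (Fin.last k)) (u : Fin d → P)
    (hu : ∀ a, ∑ b, O.lax k a b * u b = O.χ k a) :
    IsUnit (quasiminor (O.dual Wi) k) ∧
    quasiminor (O.dual Wi) k = O.Δ k - intSign (O.s k) • ∑ b, O.ρ k b * u b := by
  set A := leading (O.dual Wi) k with hA
  set B := Ring.inverse A with hB
  set θ := O.Δ k - intSign (O.s k) • ∑ b, O.ρ k b * u b with hθ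
  have hBA : B * A = 1 := Ring.inverse_mul_cancel _ hk.1
  let c : Fin (k + 1) → Fin N := Fin.castLE k.isLt
  -- Chosen to solve the equations of the rows i < k, namely Δ_i y_i = (-1)^{s_i} ∑ ρ_{ib} u_b.
  let y : Fin N → P := fun i => O.D i * (intSign (O.s i) • ∑ b, O.ρ i b * u b)
  let x : Fin (k + 1) → P := Fin.snoc (fun i : Fin k => y (c i.castSucc)) 1
  have hclast : c (Fin.last k) = k := rfl
  have hfilt : ∀ f : Fin N → P, ∑ i with (i : Fin N).val < k, f i = ∑ i : Fin k, f (c i.castSucc) := by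
    intro f
    symm
    refine Finset.sum_bij (fun i _ => c i.castSucc) ?_ ?_ ?_ (fun _ _ => rfl)
    · intro i _; exact Finset.mem_filter.2 ⟨Finset.mem_univ _, i.isLt⟩
    · intro i _ j _ hij; ext; simpa [c, Fin.ext_iff] using hij
    · intro i hi
      exact ⟨⟨i, (Finset.mem_filter.1 hi).2⟩, Finset.mem_univ _, rfl⟩
  -- The equation X u = χ_k, with the terms χ_i Δ_i⁻¹ ρ_i u moved to the other side, says that W⁻¹ χ
  -- x = u; the dual matrix acts on x through this vector.
  have hWu : ∀ a, ∑ j, O.χ (c j) a * x j = O.W a * u a := by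
    intro a
    have h := hu a
    simp only [lax, sub_mul, Finset.sum_sub_distrib, ite_mul, zero_mul, Finset.sum_ite_eq,
      Finset.mem_univ, if_true] at h
    rw [Fin.sum_univ_castSucc, hclast, ← h]
    simp only [x, Fin.snoc_castSucc, Fin.snoc_last, mul_one]
    rw [← hfilt (fun i => O.χ i a * y i)]
    have : ∑ i with (i : Fin N).val < k, O.χ i a * y i = ∑ b, (∑ i with (i : Fin N).val < k,
        intSign (O.s i) • (O.χ i a * O.D i * O.ρ i b)) * u b := by
      simp only [y, Finset.sum_mul]
      rw [Finset.sum_comm]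
      refine Finset.sum_congr rfl fun i _ => ?_
      rw [mul_smul_comm, mul_smul_comm, Finset.mul_sum, Finset.mul_sum, Finset.smul_sum]
      refine Finset.sum_congr rfl fun b _ => ?_
      rw [smul_mul_assoc]
      simp only [mul_assoc]
    rw [this]
    abel
  have hAx : ∀ i, ∑ j, A i j * x j = if i = Fin.last k then θ else 0 := by
    intro i
    have h1 : ∑ j, A i j * x j = O.Δ (c i) * x i -
        intSign (O.s (c i)) • ∑ a, O.ρ (c i) a * u a := by
      have hinj : ∀ j, c i = c j ↔ i = j := fun j =>
        (Fin.castLE_injective _).eq_iff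
      simp only [hA, leading, Matrix.submatrix_apply, dual, sub_mul, Finset.sum_sub_distrib]
      congr 1
      · change ∑ j, (if c i = c j then _ else _) * x j = _
        simp only [hinj, ite_mul, zero_mul, Finset.sum_ite_eq, Finset.mem_univ, if_true]
        rfl
      · simp only [smul_mul_assoc, ← Finset.smul_sum]
        congr 1
        simp only [Finset.sum_mul]
        rw [Finset.sum_comm]
        refine Finset.sum_congr rfl fun a _ => ?_
        have := hWu a
        simp only [mul_assoc, ← Finset.mul_sum]
        change O.ρ (c i) a * (Wi a * ∑ j, O.χ (c j) a * x j) = _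
        rw [this, ← mul_assoc (Wi a), hWi, one_mul]
    rw [h1]
    induction i using Fin.lastCases with
    | last => simp [x, hclast, hθ]
    | cast i =>
      have hne : i.castSucc ≠ Fin.last k := (Fin.castSucc_lt_last i).ne
      simp only [x, Fin.snoc_castSucc, y, hne, if_false]
      rw [← mul_assoc, O.Δ_mul_D, one_mul, sub_self]
  have h1 : B (Fin.last k) (Fin.last k) * θ = 1 := by
    have h2 : ∑ i, B (Fin.last k) i * ∑ j, A i j * x j = x (Fin.last k) := by
      simp only [Finset.mul_sum, ← mul_assoc]
      rw [Finset.sum_comm]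
      simp only [← Finset.sum_mul]
      have h3 : ∀ j, ∑ i, B (Fin.last k) i * A i j = (1 : Matrix _ _ P) (Fin.last k) j := by
        intro j; rw [← hBA, Matrix.mul_apply]
      simp [h3, Matrix.one_apply]
    simp only [hAx, mul_ite, mul_zero, Finset.sum_ite_eq', Finset.mem_univ, if_true] at h2
    rw [h2]
    simp [x]
  have hu2 : IsUnit (B (Fin.last k) (Fin.last k)) := hk.2
  refine ⟨hu2.ringInverse, ?_⟩
  change Ring.inverse (B (Fin.last k) (Fin.last k)) = θ
  rw [← mul_one (Ring.inverse _), ← h1, Ring.inverse_mul_cancel_left _ _ hu2]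

end Oscillators

end BetheDuality
end

/-! ### Arithmetic of pseudo-differential operators -/

noncomputable section
namespace BetheDuality

open scoped Nat

namespace PseudoDiff

variable {A : Type*} [Ring A]

variable (A) in
/-- The coefficient of `z^i ∂^j` as an additive map. -/
def coeffHom (i j : ℤ) : PseudoDiff A →+ A where
  toFun f := f.coeff i j
  map_zero' := rfl
  map_add' _ _ := rfl

theorem coeff_sub (f g : PseudoDiff A) (i j : ℤ) :
    (f - g).coeff i j = f.coeff i j - g.coeff i j := map_sub (coeffHom A i j) f g

theorem coeff_sum {κ : Type*} (s : Finset κ) (f : κ → PseudoDiff A) (i j : ℤ) :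
    (∑ k ∈ s, f k).coeff i j = ∑ k ∈ s, (f k).coeff i j := map_sum (coeffHom A i j) f s

theorem coeff_zsmul (n : ℤ) (f : PseudoDiff A) (i j : ℤ) :
    (n • f).coeff i j = n • f.coeff i j := map_zsmul (coeffHom A i j) n f

theorem coeff_mono (a : A) (i j M N : ℤ) :
    (mono a i j).coeff M N = if M = i ∧ N = j then a else 0 := rfl

/-- No power of ∂ stands on the left, so only the term t = 0 of the expansion survives. -/
theorem coeff_mono_mul (a : A) (i : ℤ) (f : PseudoDiff A) (M N : ℤ) :
    (mono a i 0 * f).coeff M N = a * f.coeff (M - i) N := by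
  rw [coeff_mul, mulCoeff, finsum_eq_single _ (0, i, 0)]
  · simp [contr_zero, coeff_mono]
  · rintro ⟨t, k, l⟩ hx
    by_cases h : k = i ∧ l = 0
    · obtain ⟨rfl, rfl⟩ := h
      have ht : t ≠ 0 := by rintro rfl; exact hx rfl
      simp [contr_zero_left _ _ ht]
    · simp [coeff_mono, h]

theorem coeff_mul_mono (a : A) (j : ℤ) (f : PseudoDiff A) (M N : ℤ) :
    (f * mono a 0 j).coeff M N = f.coeff M (N - j) * a := by
  rw [coeff_mul, mulCoeff, finsum_eq_single _ (0, M, N - j)]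
  · simp [contr_zero, coeff_mono]
  · rintro ⟨t, k, l⟩ hx
    by_cases h : M - k + t = 0 ∧ N - l + t = j
    · have ht : t ≠ 0 := by
        rintro rfl
        refine hx ?_
        simp only [Prod.mk.injEq, true_and]
        simp only [Nat.cast_zero] at h
        omega
      simp only [h.1]
      simp [contr_zero_right _ _ ht]
    · simp [coeff_mono, h]

theorem mono_mul_mono (a b : A) (i j : ℤ) : mono a i 0 * mono b 0 j = mono (a * b) i j := by
  refine ext_coeff fun M N => ?_
  rw [coeff_mono_mul]
  simp only [coeff_mono]
  by_cases h : M = i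
  · simp [h]
  · simp [h, sub_eq_zero]

theorem mono_mul_mono_z (a b : A) (i k : ℤ) :
    mono a i 0 * mono b k 0 = mono (a * b) (i + k) 0 := by
  refine ext_coeff fun M N => ?_
  rw [coeff_mono_mul]
  simp only [coeff_mono]
  by_cases h : M = i + k ∧ N = 0
  · have : M - i = k := by omega
    simp [h]
  · have : ¬ (M - i = k ∧ N = 0) := by omega
    simp [h, this]

theorem mono_mul_mono_d (a b : A) (j l : ℤ) :
    mono a 0 j * mono b 0 l = mono (a * b) 0 (j + l) := by
  refine ext_coeff fun M N => ?_
  rw [coeff_mul_mono]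
  simp only [coeff_mono]
  by_cases h : M = 0 ∧ N = j + l
  · have : N - l = j := by omega
    simp [h]
  · have : ¬ (M = 0 ∧ N - l = j) := by omega
    simp [h, this]

/-- Constants as pseudo-differential operators. -/
def const : A →+* PseudoDiff A where
  toFun a := mono a 0 0
  map_one' := rfl
  map_zero' := ext_coeff fun i j => by simp [coeff_mono]
  map_add' a b := ext_coeff fun i j => by
    simp only [coeff_mono, coeff_add]; split_ifs <;> simp
  map_mul' a b := by rw [mono_mul_mono]

theorem const_apply (a : A) : const a = mono a 0 0 := rfl

theorem coeff_const_mul (a : A) (f : PseudoDiff A) (i j : ℤ) :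
    (const a * f).coeff i j = a * f.coeff i j := by
  rw [const_apply, coeff_mono_mul, sub_zero]

theorem coeff_mul_const (a : A) (f : PseudoDiff A) (i j : ℤ) :
    (f * const a).coeff i j = f.coeff i j * a := by
  rw [const_apply, coeff_mul_mono, sub_zero]

theorem const_comm {a : A} {f : PseudoDiff A} (h : ∀ i j, a * f.coeff i j = f.coeff i j * a) :
    Commute (const a) f :=
  ext_coeff fun i j => by rw [coeff_const_mul, coeff_mul_const, h]

theorem mono_one_comm_const (a : A) (i j : ℤ) : Commute (mono 1 i j) (const a) :=
  (const_comm fun k l => by simp only [coeff_mono]; split_ifs <;> simp).symm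

/-- Since binom(1, t) = 0 for t ≥ 2, only t = 0 and t = 1 contribute; the second gives the constant
1. -/
theorem d_mul_z : (mono 1 0 1 : PseudoDiff A) * mono 1 1 0 = mono 1 1 0 * mono 1 0 1 + 1 := by
  refine ext_coeff fun M N => ?_
  rw [mono_mul_mono, coeff_mul, mulCoeff, finsum_eq_sum_of_support_subset
    (s := {((0 : ℕ), (0 : ℤ), (1 : ℤ)), (1, 0, 1)})]
  · rw [Finset.sum_pair (by simp)]
    simp only [coeff_add, coeff_one, coeff_mono, contr, and_self, if_true, one_mul, sub_zero,
      Nat.cast_zero, add_zero, Nat.cast_one]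
    have e1 : ∀ x : ℤ, Ring.choose x 0 = 1 := fun x => Ring.choose_zero_right x
    have e2 : ∀ x : ℤ, Ring.choose x 1 = x := fun x => Ring.choose_one_right x
    simp only [e1, e2]
    simp only [Nat.factorial_zero, Nat.factorial_one, Nat.cast_one, mul_one, one_mul, one_smul]
    by_cases h1 : M = 1 ∧ N = 1
    · obtain ⟨rfl, rfl⟩ := h1; simp
    by_cases h2 : M = 0 ∧ N = 0
    · obtain ⟨rfl, rfl⟩ := h2; simp
    have h3 : ¬ (M = 1 ∧ N - 1 = 0) := by omega
    simp [h1, h2, h3]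
  · rintro ⟨t, k, l⟩ hx
    rw [Function.mem_support] at hx
    have h0 := right_ne_zero_of_smul hx
    have h1 := left_ne_zero_of_smul hx
    have h2 := left_ne_zero_of_mul h0
    have h3 := right_ne_zero_of_mul h0
    simp only [coeff_mono, ne_eq, ite_eq_right_iff, Classical.not_imp] at h2 h3
    obtain ⟨⟨rfl, rfl⟩, -⟩ := h2
    simp only [contr] at h1
    have h4 := left_ne_zero_of_mul (left_ne_zero_of_mul h1)
    have h5 : Ring.choose (1 : ℤ) t = ((1 : ℕ).choose t : ℤ) := by
      have := Ring.choose_natCast (R := ℤ) 1 t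
      exact_mod_cast this
    rw [h5] at h4
    have h6 : t ≤ 1 := by
      by_contra hc
      exact h4 (by rw [Nat.choose_eq_zero_of_lt (by omega)]; rfl)
    interval_cases t <;> simp

/-- Coefficientwise extension of a homomorphism, as a homomorphism. -/
def mapHom {A' : Type*} [Ring A'] (F : A →+* A') : PseudoDiff A →+* PseudoDiff A' where
  toFun := map F
  map_one' := ext_coeff fun i j => by
    change F ((1 : PseudoDiff A).coeff i j) = _
    rw [coeff_one, coeff_one]; split_ifs <;> simp
  map_zero' := ext_coeff fun _ _ => map_zero F
  map_add' _ _ := ext_coeff fun _ _ => map_add F _ _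
  map_mul' f g := ext_coeff fun M N => by
    obtain ⟨r, s, hf⟩ := bdd_coeff f
    obtain ⟨r', s', hg⟩ := bdd_coeff g
    change F ((f * g).coeff M N) = (map F f * map F g).coeff M N
    rw [coeff_mul, coeff_mul, mulCoeff, mulCoeff]
    have := (F : A →+ A').map_finsum (finite_mul_support hf hg M N)
    refine this.trans (finsum_congr fun x => ?_)
    change F _ = _
    rw [map_zsmul, map_mul]
    rfl

theorem contr_comm (j k : ℤ) (t : ℕ) : contr j k t = contr k j t := by
  rw [contr, contr]; ring

/-- The structure constants `contr j k t` are symmetric in j and k, which is exactly compatibility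
with exchanging z and ∂ and reversing products. -/
theorem swap_mul {ω : A →+ A} (hω : ∀ a b, ω (a * b) = ω b * ω a) (f g : PseudoDiff A) :
    swap ω (f * g) = swap ω g * swap ω f := by
  refine ext_coeff fun M N => ?_
  obtain ⟨r, s, hf⟩ := bdd_coeff f
  obtain ⟨r', s', hg⟩ := bdd_coeff g
  change ω ((f * g).coeff N M) = _
  rw [coeff_mul, coeff_mul, mulCoeff, mulCoeff]
  have := ω.map_finsum (finite_mul_support hf hg N M)
  refine this.trans ?_
  let e : ℕ × ℤ × ℤ ≃ ℕ × ℤ × ℤ :=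
    { toFun := fun x => (x.1, N - x.2.2 + x.1, M - x.2.1 + x.1)
      invFun := fun x => (x.1, M - x.2.2 + x.1, N - x.2.1 + x.1)
      left_inv := by rintro ⟨t, i, j⟩; ext <;> simp <;> ring
      right_inv := by rintro ⟨t, i, j⟩; ext <;> simp <;> ring }
  rw [← finsum_comp_equiv e]
  refine finsum_congr fun x => ?_
  obtain ⟨t, i, j⟩ := x
  have e1 : N - (N - j + t) + t = j := by ring
  have e2 : M - (M - i + t) + t = i := by ring
  simp only [e, Equiv.coe_fn_mk, e1, e2]
  rw [map_zsmul, hω, contr_comm]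
  rfl

/-- `swap` as an additive map. -/
def swapHom (ω : A →+ A) : PseudoDiff A →+ PseudoDiff A where
  toFun := swap ω
  map_zero' := ext_coeff fun _ _ => map_zero ω
  map_add' _ _ := ext_coeff fun _ _ => map_add ω _ _

theorem swap_mono (ω : A →+ A) (a : A) (i j : ℤ) : swap ω (mono a i j) = mono (ω a) j i := by
  refine ext_coeff fun M N => ?_
  change ω ((mono a i j).coeff N M) = _
  simp only [coeff_mono, and_comm]
  split_ifs <;> simp

theorem swap_one {ω : A →+ A} (hω : ω 1 = 1) : swap ω 1 = 1 := by
  change swap ω (mono 1 0 0) = mono 1 0 0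
  rw [swap_mono, hω]

section NegSeries

theorem coeff_negSeries (a : ℕ → A) (i j : ℤ) :
    (negSeries a).coeff i j = if i < 0 ∧ j = 0 then a (-i - 1).toNat else 0 := rfl

theorem map_negSeries {A' : Type*} [Ring A'] (F : A →+* A') (a : ℕ → A) :
    map F (negSeries a) = negSeries fun r => F (a r) := by
  refine ext_coeff fun i j => ?_
  change F ((negSeries a).coeff i j) = _
  simp only [coeff_negSeries]
  split_ifs <;> simp

theorem negSeries_add (a b : ℕ → A) :
    negSeries (fun r => a r + b r) = negSeries a + negSeries b := by
  refine ext_coeff fun i j => ?_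
  simp only [coeff_negSeries, coeff_add]
  split_ifs <;> simp

theorem negSeries_sum {κ : Type*} (s : Finset κ) (a : κ → ℕ → A) :
    negSeries (fun r => ∑ k ∈ s, a k r) = ∑ k ∈ s, negSeries (a k) := by
  refine ext_coeff fun i j => ?_
  simp only [coeff_negSeries, coeff_sum]
  split_ifs <;> simp

theorem negSeries_zsmul (n : ℤ) (a : ℕ → A) :
    negSeries (fun r => n • a r) = n • negSeries a := by
  refine ext_coeff fun i j => ?_
  simp only [coeff_negSeries, coeff_zsmul]
  split_ifs <;> simp

theorem negSeries_zero : negSeries (fun _ => (0 : A)) = 0 := by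
  refine ext_coeff fun i j => ?_
  simp [coeff_negSeries]

variable [Algebra ℂ A]

theorem negSeries_pow_smul (c : ℂ) (a : A) :
    negSeries (fun r => c ^ r • a) = const a * zSubInv A c := by
  refine ext_coeff fun i j => ?_
  rw [coeff_const_mul]
  simp only [zSubInv, coeff_negSeries]
  split_ifs with h
  · rw [← Algebra.commutes, Algebra.smul_def]
  · simp

theorem zSub_eq (c : ℂ) : zSub A c = mono 1 1 0 - const (algebraMap ℂ A c) := rfl

theorem dSub_eq (c : ℂ) : dSub A c = mono 1 0 1 - const (algebraMap ℂ A c) := rfl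

theorem zSub_mul_zSubInv (c : ℂ) : zSub A c * zSubInv A c = 1 := by
  refine ext_coeff fun i j => ?_
  rw [zSub_eq, sub_mul, coeff_sub, coeff_mono_mul, coeff_const_mul, one_mul, coeff_one]
  simp only [zSubInv, coeff_negSeries]
  by_cases hj : j = 0
  · rcases lt_trichotomy i 0 with h | h | h
    · have h1 : (-(i - 1) - 1).toNat = (-i - 1).toNat + 1 := by omega
      have h2 : i - 1 < 0 := by omega
      simp only [hj, h, h2, h.ne, and_self, if_true, false_and, if_false, h1, pow_succ', map_mul,
        sub_self]
    · subst h; simp [hj]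
    · have h2 : ¬ i - 1 < 0 := by omega
      simp [hj, h.ne', h2, h.not_gt]
  · simp [hj]

theorem zSubInv_comm_const (c : ℂ) (a : A) : Commute (zSubInv A c) (const a) :=
  (const_comm fun i j => by
    simp only [zSubInv, coeff_negSeries]
    split_ifs
    · rw [Algebra.commutes]
    · simp).symm

theorem const_algebraMap_comm (c : ℂ) (f : PseudoDiff A) : Commute (const (algebraMap ℂ A c)) f :=
  const_comm fun _ _ => Algebra.commutes _ _

theorem zSubInv_comm_z (c : ℂ) : Commute (mono 1 1 0) (zSubInv A c) := by
  have key : ∀ k : ℤ, (zSubInv A c * mono 1 1 0) = mono 1 1 0 * zSubInv A c := by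
    intro _
    refine ext_coeff fun M N => ?_
    rw [coeff_mono_mul, one_mul, coeff_mul, mulCoeff, finsum_eq_single _ (0, M - 1, N)]
    · simp [contr_zero, coeff_mono]
    · rintro ⟨t, i, j⟩ hx
      by_cases hj : j = 0
      · subst hj
        by_cases ht : t = 0
        · subst ht
          by_cases h : M - i = 1 ∧ N = 0
          · exact absurd (by simp only [Prod.mk.injEq, true_and]; omega) hx
          · simp [coeff_mono, h]
        · simp [contr_zero_left _ _ ht]
      · simp [zSubInv, coeff_negSeries, hj]
  exact (key 0).symm

theorem zSubInv_mul_zSub (c : ℂ) : zSubInv A c * zSub A c = 1 := by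
  have h : Commute (zSub A c) (zSubInv A c) :=
    (zSubInv_comm_z c).sub_left (const_algebraMap_comm _ _)
  rw [← h.eq, zSub_mul_zSubInv]

end NegSeries

/-! ### Filtration by total degree and geometric series -/

section Filtration

/-- Operators with nonpositive exponents and total degree at most `-T`. -/
def filt (A : Type*) [Ring A] (T : ℤ) : AddSubgroup (PseudoDiff A) where
  carrier := {f | ∀ i j, (0 < i ∨ 0 < j ∨ -T < i + j) → f.coeff i j = 0}
  zero_mem' _ _ _ := rfl
  add_mem' hf hg i j h := by rw [coeff_add, hf i j h, hg i j h, add_zero]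
  neg_mem' hf i j h := by rw [coeff_neg, hf i j h, neg_zero]

theorem filt_mono {S T : ℤ} (h : T ≤ S) : filt A S ≤ filt A T := fun _ hf i j hij =>
  hf i j (by omega)

/-- Each contraction lowers the exponents of z and ∂ by one, so the total degree never exceeds the
sum of the two degrees. -/
theorem mul_mem_filt {S T : ℤ} {f g : PseudoDiff A} (hf : f ∈ filt A S) (hg : g ∈ filt A T) :
    f * g ∈ filt A (S + T) := by
  intro M N h
  rw [coeff_mul]
  refine finsum_eq_zero_of_forall_eq_zero ?_
  rintro ⟨t, i, j⟩
  by_contra hx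
  have h0 := right_ne_zero_of_smul hx
  have h1 : ¬ (0 < i ∨ 0 < j ∨ -S < i + j) := fun h => left_ne_zero_of_mul h0 (hf _ _ h)
  have h2 : ¬ (0 < M - i + t ∨ 0 < N - j + t ∨ -T < (M - i + t) + (N - j + t)) :=
    fun h => right_ne_zero_of_mul h0 (hg _ _ h)
  omega

theorem mono_mem_filt {T : ℤ} (a : A) {i j : ℤ} (hi : i ≤ 0) (hj : j ≤ 0) (h : i + j ≤ -T) :
    mono a i j ∈ filt A T := fun k l hkl => if_neg (by omega)

theorem one_mem_filt : (1 : PseudoDiff A) ∈ filt A 0 := mono_mem_filt 1 le_rfl le_rfl (by simp)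

theorem negSeries_mem_filt (a : ℕ → A) : negSeries a ∈ filt A 0 := fun i j h =>
  if_neg (by omega)

/-- The filtration is separated: the coefficient at (i, j) vanishes once T exceeds -(i + j). -/
theorem eq_zero_of_mem_filt {f : PseudoDiff A} (h : ∀ T : ℕ, f ∈ filt A T) : f = 0 := by
  refine ext_coeff fun i j => ?_
  exact h ((-(i + j)).toNat + 1) i j (by omega)

variable {κ : Type*} [Fintype κ] [DecidableEq κ]

omit [DecidableEq κ] in
theorem matrix_mul_mem_filt {S T : ℤ} {M N : Matrix κ κ (PseudoDiff A)}
    (hM : ∀ a b, M a b ∈ filt A S) (hN : ∀ a b, N a b ∈ filt A T) (a b : κ) :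
    (M * N) a b ∈ filt A (S + T) := by
  rw [Matrix.mul_apply]
  exact AddSubgroup.sum_mem _ fun c _ => mul_mem_filt (hM a c) (hN c b)

omit [Fintype κ] in
theorem matrix_one_mem_filt (a b : κ) : (1 : Matrix κ κ (PseudoDiff A)) a b ∈ filt A 0 := by
  rw [Matrix.one_apply]
  split_ifs
  · exact one_mem_filt
  · exact zero_mem _

theorem matrix_pow_mem_filt {N : Matrix κ κ (PseudoDiff A)} (hN : ∀ a b, N a b ∈ filt A 1)
    (t : ℕ) (a b : κ) : (N ^ t) a b ∈ filt A t := by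
  induction t generalizing a b with
  | zero => simpa using matrix_one_mem_filt a b
  | succ t ih =>
    rw [pow_succ]
    exact_mod_cast matrix_mul_mem_filt ih hN a b

/-- The geometric series. -/
theorem exists_inverse_one_sub {N : Matrix κ κ (PseudoDiff A)} (hN : ∀ a b, N a b ∈ filt A 1) :
    ∃ B : Matrix κ κ (PseudoDiff A), (1 - N) * B = 1 ∧ B * (1 - N) = 1 ∧
      ∀ a b, (B - 1) a b ∈ filt A 1 := by
  have hpow := matrix_pow_mem_filt hN
  -- The power N^t has total degree at most -t, so the coefficient at (i, j) receives contributions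
  -- only from t ≤ -(i + j), and the geometric series is a finite sum there.
  let B : Matrix κ κ (PseudoDiff A) := fun a b =>
    ⟨fun i j => ∑ t ∈ Finset.range ((-(i + j)).toNat + 1), ((N ^ t) a b).coeff i j, 0, 0,
      fun i j h => Finset.sum_eq_zero fun t _ => hpow t a b i j (by omega)⟩
  have hB : ∀ (T : ℕ) a b, (B - ∑ t ∈ Finset.range T, N ^ t) a b ∈ filt A T := by
    intro T a b i j h
    rw [Matrix.sub_apply, Matrix.sum_apply, coeff_sub, coeff_sum, sub_eq_zero]
    change ∑ t ∈ Finset.range ((-(i + j)).toNat + 1), ((N ^ t) a b).coeff i j = _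
    by_cases h' : 0 < i ∨ 0 < j
    · rw [Finset.sum_eq_zero fun t _ => hpow t a b i j (by omega),
        Finset.sum_eq_zero fun t _ => hpow t a b i j (by omega)]
    · refine Finset.sum_subset (fun t ht => ?_) fun t _ ht => hpow t a b i j ?_
      · simp only [Finset.mem_range] at ht ⊢; omega
      · simp only [Finset.mem_range] at ht; omega
  have h1N : ∀ a b, (1 - N) a b ∈ filt A 0 := fun a b =>
    sub_mem (matrix_one_mem_filt a b) (filt_mono (by norm_num) (hN a b))
  refine ⟨B, ?_, ?_, fun a b => ?_⟩
  · rw [← sub_eq_zero]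
    ext1 a b
    refine eq_zero_of_mem_filt fun T => ?_
    have e : (1 - N) * B - 1 = (1 - N) * (B - ∑ t ∈ Finset.range T, N ^ t) - N ^ T := by
      rw [mul_sub, mul_neg_geom_sum]; abel
    rw [e]
    have := matrix_mul_mem_filt h1N (hB T) a b
    rw [zero_add] at this
    exact sub_mem this (hpow T a b)
  · rw [← sub_eq_zero]
    ext1 a b
    refine eq_zero_of_mem_filt fun T => ?_
    have e : B * (1 - N) - 1 = (B - ∑ t ∈ Finset.range T, N ^ t) * (1 - N) - N ^ T := by
      rw [sub_mul, geom_sum_mul_neg]; abel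
    rw [e]
    have := matrix_mul_mem_filt (hB T) h1N a b
    rw [add_zero] at this
    exact sub_mem this (hpow T a b)
  · simpa using hB 1 a b

theorem isUnit_one_add {f : PseudoDiff A} (hf : f ∈ filt A 1) : IsUnit (1 + f) := by
  obtain ⟨B, h1, h2, -⟩ := exists_inverse_one_sub (κ := Unit) (N := Matrix.of fun _ _ => -f)
    fun _ _ => neg_mem hf
  have e1 := congrFun (congrFun h1 ()) ()
  have e2 := congrFun (congrFun h2 ()) ()
  simp only [Matrix.mul_apply, Finset.univ_unique, Finset.sum_singleton, Matrix.sub_apply,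
    Matrix.of_apply, Matrix.one_apply_eq, sub_neg_eq_add] at e1 e2
  exact ⟨⟨1 + f, _, e1, e2⟩, rfl⟩

/-- Matrices `v - M` with `v` of positive degree and `M` of degree zero are invertible, and their
inverses have invertible diagonal entries. -/
theorem isUnit_sub {v v' : PseudoDiff A} (hv : v * v' = 1) (hv' : v' * v = 1) (hf : v' ∈ filt A 1)
    {L : Matrix κ κ (PseudoDiff A)} (hL : ∀ a b, (if a = b then v else 0) - L a b ∈ filt A 0) :
    IsUnit L ∧ ∀ a, IsUnit (Ring.inverse L a a) := by
  let M : Matrix κ κ (PseudoDiff A) := Matrix.of fun a b => (if a = b then v else 0) - L a b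
  let V : Matrix κ κ (PseudoDiff A) := Matrix.diagonal fun _ => v
  let V' : Matrix κ κ (PseudoDiff A) := Matrix.diagonal fun _ => v'
  have hVV : V * V' = 1 := by simp [V, V', hv]
  have hVV' : V' * V = 1 := by simp [V, V', hv']
  have hN : ∀ a b, (V' * M) a b ∈ filt A 1 := by
    intro a b
    have := mul_mem_filt hf (hL a b)
    rw [add_zero] at this
    rwa [Matrix.diagonal_mul]
  obtain ⟨B, h1, h2, h3⟩ := exists_inverse_one_sub hN
  -- Factoring out the leading scalar matrix leaves 1 minus a matrix of negative total degree.
  have hLV : L = V * (1 - V' * M) := by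
    rw [mul_sub, mul_one, ← mul_assoc, hVV, one_mul]
    ext1 a b
    change L a b = (Matrix.diagonal (fun _ => v) : Matrix κ κ (PseudoDiff A)) a b -
      ((if a = b then v else 0) - L a b)
    rw [Matrix.diagonal_apply, sub_sub_cancel]
  let U : (Matrix κ κ (PseudoDiff A))ˣ :=
    ⟨L, B * V', by rw [hLV, mul_assoc, ← mul_assoc _ B, h1, one_mul, hVV],
      by rw [hLV, mul_assoc, ← mul_assoc V', hVV', one_mul, h2]⟩
  refine ⟨U.isUnit, fun a => ?_⟩
  have hinv : Ring.inverse L = B * V' := Ring.inverse_unit U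
  -- A diagonal entry of the inverse is (1 + element of negative degree) · v', a product of units.
  rw [hinv, Matrix.mul_diagonal]
  have h4 := isUnit_one_add (h3 a a)
  rw [Matrix.sub_apply, Matrix.one_apply_eq, add_sub_cancel] at h4
  exact h4.mul ⟨⟨v', v, hv', hv⟩, rfl⟩

end Filtration

end PseudoDiff

end BetheDuality
end

/-! ### Functoriality of Berezinian and column determinant, and the action of ω -/

noncomputable section
namespace BetheDuality

theorem map_ringInverse {A B : Type*} [Ring A] [Ring B] (f : A →+* B) {a : A} (ha : IsUnit a) :
    f (Ring.inverse a) = Ring.inverse (f a) := by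
  obtain ⟨u, rfl⟩ := ha
  rw [Ring.inverse_unit]
  exact (Ring.inverse_unit (Units.map (f : A →* B) u)).symm

section Determinants

variable {A B : Type*} [Ring A] [Ring B] {k : ℕ}

theorem ringInverse_map_matrix (f : A →+* B) {n : ℕ} {M : Matrix (Fin n) (Fin n) A}
    (hM : IsUnit M) : Ring.inverse (M.map f) = (Ring.inverse M).map f :=
  (map_ringInverse f.mapMatrix hM).symm

theorem QuasidetDefined.map (f : A →+* B) {M : Matrix (Fin k) (Fin k) A} {i j : Fin k}
    (h : QuasidetDefined M i j) : QuasidetDefined (M.map f) i j := by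
  refine ⟨h.1.map f.mapMatrix, ?_⟩
  rw [ringInverse_map_matrix f h.1]
  exact h.2.map f

theorem quasidet_map (f : A →+* B) {M : Matrix (Fin k) (Fin k) A} {i j : Fin k}
    (h : QuasidetDefined M i j) : f (quasidet M i j) = quasidet (M.map f) i j := by
  rw [quasidet, quasidet, ringInverse_map_matrix f h.1, map_ringInverse f h.2, Matrix.map_apply]

/-- Invertibility is essential: `Ring.inverse` has the default value 0 on nonunits, and only on
units is it known to be preserved by the homomorphism. -/
theorem map_Ber (f : A →+* B) (s : Fin k → ZMod 2) {M : Matrix (Fin k) (Fin k) A}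
    (h : SufficientlyInvertible M) : f (Ber s M) = Ber s (M.map f) := by
  rw [Ber, Ber, map_list_prod, List.map_ofFn]
  congr 2
  funext i
  have h1 : f (quasiminor M i) = quasiminor (M.map f) i := quasidet_map f (h i)
  have h2 : IsUnit (quasiminor M i) := (h i).2.ringInverse
  simp only [Function.comp_apply]
  split_ifs
  · exact h1
  · rw [map_ringInverse f h2, h1]

theorem map_cdet (f : A →+* B) (M : Matrix (Fin k) (Fin k) A) : f (cdet M) = cdet (M.map f) := by
  simp only [cdet, map_sum, map_zsmul, map_list_prod, List.map_ofFn]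
  rfl

theorem cdet_diagonal (w : Fin k → A) : cdet (Matrix.diagonal w) = (List.ofFn w).prod := by
  rw [cdet, Finset.sum_eq_single 1]
  · simp
  · intro σ _ hσ
    obtain ⟨i, hi⟩ : ∃ i, σ i ≠ i := by
      by_contra! h
      exact hσ (Equiv.ext h)
    rw [List.prod_eq_zero, smul_zero]
    rw [List.mem_ofFn]
    exact ⟨i, by rw [Matrix.diagonal_apply_ne _ hi]⟩
  · simp

/-- The element x passes through every ordered product entry by entry, so no commutation among the
entries is needed. -/
theorem mul_cdet_of_intertwine {x : A} {M M' : Matrix (Fin k) (Fin k) A}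
    (h : ∀ a b, x * M a b = M' a b * x) : x * cdet M = cdet M' * x := by
  have hl : ∀ (l : List (Fin k)) (f : Fin k → Fin k),
      x * (l.map fun i => M (f i) i).prod = (l.map fun i => M' (f i) i).prod * x := by
    intro l f
    induction l with
    | nil => simp
    | cons i l ih =>
      simp only [List.map_cons, List.prod_cons]
      rw [← mul_assoc, h, mul_assoc, ih, mul_assoc]
  simp only [cdet, List.ofFn_eq_map, Finset.mul_sum, Finset.sum_mul, mul_smul_comm, smul_mul_assoc,
    hl]

end Determinants

theorem ofFn_comp_rev {α : Type*} {n : ℕ} (f : Fin n → α) :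
    (List.ofFn fun i => f i.rev) = (List.ofFn f).reverse := by
  refine List.ext_getElem (by simp) fun i h1 h2 => ?_
  simp only [List.getElem_ofFn, List.getElem_reverse, List.length_ofFn]
  congr 1
  ext
  simp only [Fin.val_rev]
  omega

theorem prod_reverse_of_comm {M : Type*} [Monoid M] {l : List M} (h : l.Pairwise Commute) :
    l.reverse.prod = l.prod := ((List.reverse_perm l).symm.prod_eq' h).symm

namespace PseudoDiff

variable {A : Type*} [Ring A] {ω : A →+ A}

theorem swap_list_prod (h1 : ω 1 = 1) (hω : ∀ a b, ω (a * b) = ω b * ω a)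
    (l : List (PseudoDiff A)) : swap ω l.prod = (l.map (swap ω)).reverse.prod := by
  induction l with
  | nil => simpa using swap_one h1
  | cons x l ih => simp [swap_mul hω, ih]

/-- An antihomomorphism reverses the order of the columns in each product. Reversing both index sets
restores it, and replacing σ by its conjugate under the reversal does not change the sign. -/
theorem swap_cdet (h1 : ω 1 = 1) (hω : ∀ a b, ω (a * b) = ω b * ω a) {d : ℕ}
    (M : Matrix (Fin d) (Fin d) (PseudoDiff A)) :
    swap ω (cdet M) = cdet fun a b => swap ω (M a.rev b.rev) := by
  have e1 : swap ω (cdet M) = ∑ σ : Equiv.Perm (Fin d), (Equiv.Perm.sign σ : ℤ) •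
      (List.ofFn fun i : Fin d => swap ω (M (σ i.rev) i.rev)).prod := by
    change swapHom ω _ = _
    rw [cdet, map_sum]
    refine Finset.sum_congr rfl fun σ _ => ?_
    rw [map_zsmul, ofFn_comp_rev (fun i => swap ω (M (σ i) i))]
    congr 1
    refine (swap_list_prod h1 hω _).trans ?_
    rw [List.map_ofFn]
    rfl
  rw [e1]
  change _ = ∑ σ : Equiv.Perm (Fin d), (Equiv.Perm.sign σ : ℤ) •
    (List.ofFn fun i => swap ω (M (σ i).rev i.rev)).prod
  rw [← Equiv.sum_comp (MulAut.conj (Fin.revPerm : Equiv.Perm (Fin d))).toEquiv]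
  refine Finset.sum_congr rfl fun σ _ => ?_
  have e2 : Equiv.Perm.sign ((MulAut.conj (Fin.revPerm : Equiv.Perm (Fin d))).toEquiv σ) =
      Equiv.Perm.sign σ := by
    simp [mul_comm]
    rw [mul_left_comm, Int.units_mul_self, mul_one]
  rw [e2]
  congr 2
  refine congrArg List.ofFn (funext fun i => ?_)
  simp [MulAut.conj_apply]

theorem swap_mem_filt {T : ℤ} {f : PseudoDiff A} (hf : f ∈ filt A T) : swap ω f ∈ filt A T := by
  intro i j h
  change ω (f.coeff j i) = 0
  rw [hf j i (by omega), map_zero]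

variable [Algebra ℂ A] (hc : ∀ c, ω (algebraMap ℂ A c) = algebraMap ℂ A c)
include hc

theorem swap_zSub (c : ℂ) : swap ω (zSub A c) = dSub A c := by
  have h1 : ω 1 = 1 := by simpa using hc 1
  rw [zSub, dSub]
  refine (map_sub (swapHom ω) _ _).trans ?_
  exact congrArg₂ _ ((swap_mono _ _ _ _).trans (by rw [h1])) ((swap_mono _ _ _ _).trans (by rw [hc]))

theorem swap_dSub (c : ℂ) : swap ω (dSub A c) = zSub A c := by
  have h1 : ω 1 = 1 := by simpa using hc 1
  rw [zSub, dSub]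
  refine (map_sub (swapHom ω) _ _).trans ?_
  exact congrArg₂ _ ((swap_mono _ _ _ _).trans (by rw [h1])) ((swap_mono _ _ _ _).trans (by rw [hc]))

theorem dSub_mul_swap (hω : ∀ a b, ω (a * b) = ω b * ω a) (c : ℂ) :
    dSub A c * swap ω (zSubInv A c) = 1 := by
  rw [← swap_zSub hc, ← swap_mul hω, zSubInv_mul_zSub, swap_one (by simpa using hc 1)]

theorem swap_mul_dSub (hω : ∀ a b, ω (a * b) = ω b * ω a) (c : ℂ) :
    swap ω (zSubInv A c) * dSub A c = 1 := by
  rw [← swap_zSub hc, ← swap_mul hω, zSub_mul_zSubInv, swap_one (by simpa using hc 1)]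

omit hc

theorem dSub_mul_zSub (c c' : ℂ) : dSub A c * zSub A c' = zSub A c' * dSub A c + 1 := by
  have h1 := (const_algebraMap_comm (A := A) c (mono 1 1 0)).eq
  have h2 := (const_algebraMap_comm (A := A) c' (mono 1 0 1)).eq
  have h3 := (const_algebraMap_comm (A := A) c (const (algebraMap ℂ A c'))).eq
  rw [dSub_eq, zSub_eq, mul_sub, sub_mul, sub_mul, mul_sub, sub_mul, sub_mul, d_mul_z, h1, h2, h3]
  abel

theorem dSub_comm_dSub (c c' : ℂ) : Commute (dSub A c) (dSub A c') := by
  have h := const_algebraMap_comm (A := A)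
  exact ((Commute.refl _).sub_left (h c _)).sub_right (h c' _).symm

theorem zSub_comm_zSub (c c' : ℂ) : Commute (zSub A c) (zSub A c') := by
  have h := const_algebraMap_comm (A := A)
  exact ((Commute.refl _).sub_left (h c _)).sub_right (h c' _).symm

theorem dSub_comm_const (c : ℂ) (a : A) : Commute (dSub A c) (const a) :=
  (mono_one_comm_const a 0 1).sub_left (const_algebraMap_comm c _)

theorem zSub_comm_const (c : ℂ) (a : A) : Commute (zSub A c) (const a) :=
  (mono_one_comm_const a 1 0).sub_left (const_algebraMap_comm c _)

theorem map_dSub {B : Type*} [Ring B] [Algebra ℂ B] (F : A →ₐ[ℂ] B) (c : ℂ) :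
    map (F : A →+* B) (dSub A c) = dSub B c := by
  have hm : ∀ (a : A) i j, map (F : A →+* B) (mono a i j) = mono (F a) i j := by
    intro a i j
    refine ext_coeff fun k l => ?_
    change F ((mono a i j).coeff k l) = _
    simp only [coeff_mono]
    split_ifs <;> simp
  refine (map_sub (mapHom (F : A →+* B)) _ _).trans ?_
  exact congrArg₂ _ ((hm _ _ _).trans (by rw [map_one])) ((hm _ _ _).trans (by rw [F.commutes]))

theorem isUnit_two : IsUnit (2 : PseudoDiff A) := by
  have h : IsUnit (2 : A) := by
    have := (isUnit_iff_ne_zero.2 (two_ne_zero : (2 : ℂ) ≠ 0)).map (algebraMap ℂ A)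
    rwa [map_ofNat] at this
  have := h.map (const : A →+* PseudoDiff A)
  rwa [map_ofNat] at this

end PseudoDiff

end BetheDuality
end

/-! ### The oscillators of the Weyl superalgebra and the two matrices -/

noncomputable section
namespace BetheDuality

open PseudoDiff

namespace Weyl

variable {κ : Type} [DecidableEq κ] (s : κ → ZMod 2)

theorem omega_algebraMap (c : ℂ) : omega s (algebraMap ℂ (Weyl s) c) = algebraMap ℂ (Weyl s) c := by
  simp [omega]

theorem omega_smul (c : ℂ) (x : Weyl s) : omega s (c • x) = c • omega s x := by
  simp [omega]

theorem superSign_smul (a : ZMod 2) (x : Weyl s) : superSign a • x = intSign a • x := by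
  rw [superSign, intSign]
  split_ifs
  · simp
  · exact (neg_smul (1 : ℂ) x).trans (by simp)

theorem omega_one : omega s 1 = 1 := by simpa using omega_algebraMap s 1

end Weyl

section Duality

variable (p q m n d : ℕ) (z : Fin (p + q + m + n) → ℂ) (w : Fin d → ℂ)

/-- The inverse of `∂ - c`. -/
def dSubInv (c : ℂ) : PseudoDiff (WeylD p q m n d) := swap (Weyl.omega _) (zSubInv _ c)

theorem dSubInv_comm {c : ℂ} {x : PseudoDiff (WeylD p q m n d)} (h : Commute (dSub _ c) x) :
    Commute (dSubInv p q m n d c) x := by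
  let v : (PseudoDiff (WeylD p q m n d))ˣ := ⟨dSub _ c, dSubInv p q m n d c,
    dSub_mul_swap (Weyl.omega_algebraMap _) (Weyl.omega_mul _) c,
    swap_mul_dSub (Weyl.omega_algebraMap _) (Weyl.omega_mul _) c⟩
  have : Commute (v : PseudoDiff (WeylD p q m n d)) x := h
  exact this.units_inv_left

theorem dSubInv_mem_filt (c : ℂ) : dSubInv p q m n d c ∈ filt _ 0 :=
  swap_mem_filt (negSeries_mem_filt _)

/-- The oscillators of the duality, with reversed order of the indices `1, …, d`. -/
def oscillators : Oscillators (PseudoDiff (WeylD p q m n d)) (p + q + m + n) d where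
  s := superType p q m n
  ρ i a := const (rowOp p q m n d i a.rev)
  χ i a := const (colOp p q m n d i a.rev)
  Δ i := dSub _ (z i)
  D i := dSubInv p q m n d (z i)
  W a := zSub _ (w a.rev)
  Δ_mul_D i := dSub_mul_swap (Weyl.omega_algebraMap _) (Weyl.omega_mul _) _
  D_mul_Δ i := swap_mul_dSub (Weyl.omega_algebraMap _) (Weyl.omega_mul _) _
  Δ_comm i j := dSub_comm_dSub _ _
  Δ_ρ i j a := dSub_comm_const _ _
  Δ_χ i j a := dSub_comm_const _ _
  W_ρ a j b := zSub_comm_const _ _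
  W_χ a j b := zSub_comm_const _ _
  W_comm a b := zSub_comm_zSub _ _
  Δ_W i a := dSub_mul_zSub _ _
  ρ_ρ i a j b := by
    rw [← map_mul, row_row p q m n d (i, a.rev) (j, b.rev), Weyl.superSign_smul, map_zsmul, map_mul]
  χ_χ i a j b := by
    rw [← map_mul, col_col p q m n d (i, a.rev) (j, b.rev), Weyl.superSign_smul, map_zsmul, map_mul]
  χ_ρ i a j b := by
    rw [← map_mul, col_row p q m n d (i, a.rev) (j, b.rev), Weyl.superSign_smul, map_add, map_zsmul,
      map_mul]
    congr 1
    simp only [Prod.mk.injEq, Fin.rev_inj]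
    split_ifs <;> simp

/-- The leading term is z on the diagonal; the constants and the terms χ (∂ - z_i)⁻¹ ρ have
nonpositive exponents. -/
theorem isUnit_lax (k : ℕ) : IsUnit ((oscillators p q m n d z w).lax k) := by
  refine (isUnit_sub (v := mono 1 1 0) (v' := mono 1 (-1) 0) ?_ ?_ ?_ fun a b => ?_).1
  · rw [mono_mul_mono_z]; simp; rfl
  · rw [mono_mul_mono_z]; simp; rfl
  · exact mono_mem_filt 1 (by norm_num) le_rfl (by norm_num)
  · have h : (if a = b then (mono 1 1 0 : PseudoDiff (WeylD p q m n d)) else 0) -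
        (oscillators p q m n d z w).lax k a b =
        (if a = b then const (algebraMap ℂ _ (w a.rev)) else 0) +
        ∑ i with (i : Fin (p + q + m + n)).val < k, intSign (superType p q m n i) •
          (const (colOp p q m n d i a.rev) * dSubInv p q m n d (z i) *
            const (rowOp p q m n d i b.rev)) := by
      simp only [Oscillators.lax, oscillators, zSub_eq]
      split_ifs <;> abel
    rw [h]
    have hconst : ∀ x : WeylD p q m n d, const x ∈ filt (WeylD p q m n d) 0 :=
      fun x => mono_mem_filt x le_rfl le_rfl (by simp)
    refine add_mem ?_ (AddSubgroup.sum_mem _ fun i _ => AddSubgroup.zsmul_mem _ ?_ _)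
    · split_ifs
      · exact hconst _
      · exact zero_mem _
    · have := mul_mem_filt (mul_mem_filt (hconst (colOp p q m n d i a.rev))
        (dSubInv_mem_filt p q m n d (z i))) (hconst (rowOp p q m n d i b.rev))
      simpa using this

/-- Every leading submatrix is ∂ on the diagonal minus entries with nonpositive exponents, so the
geometric series argument applies to each. -/
theorem sufficientlyInvertible_Lsuper : SufficientlyInvertible (Lsuper p q m n z) := by
  intro k
  have h := isUnit_sub (A := CurrentEnv (superType p q m n)) (v := mono 1 0 1)
    (v' := mono 1 0 (-1)) (by rw [mono_mul_mono_d]; simp; rfl) (by rw [mono_mul_mono_d]; simp; rfl)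
    (mono_mem_filt 1 le_rfl (by norm_num) (by norm_num)) (L := leading (Lsuper p q m n z) k)
    fun a b => by
      have h : (if a = b then (mono 1 0 1 : PseudoDiff (CurrentEnv (superType p q m n))) else 0) -
          leading (Lsuper p q m n z) k a b =
          (if a = b then const (algebraMap ℂ _ (z (Fin.castLE k.isLt a))) else 0) +
          negSeries fun r => superSign (superType p q m n (Fin.castLE k.isLt a)) •
            CurrentEnv.E (superType p q m n) (Fin.castLE k.isLt a) (Fin.castLE k.isLt b) r := by
        simp only [leading, Matrix.submatrix_apply, Lsuper, dSub_eq,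
          (Fin.castLE_injective k.isLt).eq_iff]
        split_ifs <;> abel
      rw [h]
      refine add_mem ?_ (negSeries_mem_filt _)
      split_ifs
      · exact mono_mem_filt _ le_rfl le_rfl (by simp)
      · exact zero_mem _
  exact ⟨h.1, h.2 _⟩

/-- Summing w_a^r z^{-r-1} over r gives (z - w_a)⁻¹, which commutes with constants and can be placed
between ρ and χ. -/
theorem map_Lsuper : (Lsuper p q m n z).map
      (mapHom (varphi p q m n d w : CurrentEnv (superType p q m n) →+* WeylD p q m n d)) =
    (oscillators p q m n d z w).dual fun a => zSubInv _ (w a.rev) := by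
  ext1 i j
  rw [Matrix.map_apply, Lsuper, map_sub, Oscillators.dual]
  congr 1
  · rw [apply_ite (mapHom _), map_zero]
    congr 1
    exact map_dSub _ _
  · refine (map_negSeries _ _).trans ?_
    have h1 : (fun r => (varphi p q m n d w : CurrentEnv (superType p q m n) →+* WeylD p q m n d)
        (superSign (superType p q m n i) • CurrentEnv.E (superType p q m n) i j r)) =
        fun r => intSign (superType p q m n i) •
          ∑ a, w a ^ r • (rowOp p q m n d i a * colOp p q m n d j a) := by
      funext r
      change varphi p q m n d w _ = _
      rw [map_smul, varphi_E, Weyl.superSign_smul]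
      rfl
    rw [h1, negSeries_zsmul, negSeries_sum]
    change _ = intSign (superType p q m n i) • _
    congr 1
    rw [← Equiv.sum_comp Fin.revPerm]
    refine Finset.sum_congr rfl fun a _ => ?_
    rw [negSeries_pow_smul, map_mul, mul_assoc, ← (zSubInv_comm_const _ _).eq, ← mul_assoc]
    rfl

/-- Both factors carry the same index i, so the scalar sign in `colOp` stays with the variable y_i;
only a and b are interchanged. -/
theorem omega_row_mul_col (i : Fin (p + q + m + n)) (a b : Fin d) :
    Weyl.omega _ (rowOp p q m n d i a * colOp p q m n d i b) =
      rowOp p q m n d i b * colOp p q m n d i a := by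
  rw [Weyl.omega_mul]
  simp only [rowOp, colOp]
  split_ifs
  · rw [Weyl.omega_smul, Weyl.omega_var, Weyl.omega_der, smul_mul_assoc, mul_smul_comm]
  · rw [Weyl.omega_var, Weyl.omega_der]

/-- After ω the terms appear as Δ_i⁻¹ ρ_i χ_i. Reordering them to χ_i Δ_i⁻¹ ρ_i costs (-1)^{s_i}
Δ_i⁻¹ on the diagonal for every i. For i < p + q the normal ordering in `phiGen` already
compensates, so only the x-indices contribute the shift. -/
theorem swap_phi_Lgl (a b : Fin d) :
    swap (Weyl.omega _) (mapHom (phi p q m n d z : _ →+* WeylD p q m n d) (Lgl w a.rev b.rev)) =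
      (oscillators p q m n d z w).lax (p + q + m + n) a b +
        if a = b then ∑ i with p + q ≤ (i : Fin (p + q + m + n)).val,
          intSign (superType p q m n i) • dSubInv p q m n d (z i) else 0 := by
  have h1 : mapHom (phi p q m n d z : _ →+* WeylD p q m n d) (Lgl w a.rev b.rev) =
      (if a = b then dSub _ (w a.rev) else 0) -
        negSeries fun r => phiGen p q m n d z a.rev b.rev r := by
    rw [Lgl, map_sub]
    congr 1
    · rw [apply_ite (mapHom _), map_zero]
      simp only [Fin.rev_inj]
      congr 1
      exact map_dSub _ _
    · refine (map_negSeries _ _).trans ?_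
      congr 1
      funext r
      exact phi_E p q m n d z _ _ r
  set O := oscillators p q m n d z w with hO
  have h2 : (negSeries fun r => phiGen p q m n d z a.rev b.rev r) =
      (∑ i, const (rowOp p q m n d i a.rev * colOp p q m n d i b.rev) * zSubInv _ (z i)) +
        if a = b then ∑ i with (i : Fin (p + q + m + n)).val < p + q,
          intSign (superType p q m n i) • zSubInv _ (z i) else 0 := by
    simp only [phiGen_eq]
    rw [negSeries_add, negSeries_sum]
    congr 1
    · exact Finset.sum_congr rfl fun i _ => negSeries_pow_smul _ _
    · simp only [Fin.rev_inj, Finset.sum_filter]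
      split_ifs
      · rw [negSeries_sum]
        refine Finset.sum_congr rfl fun i _ => ?_
        split_ifs
        · simp only [mul_comm (superSign _), mul_smul, Weyl.superSign_smul]
          rw [negSeries_pow_smul, map_zsmul, map_one, smul_mul_assoc, one_mul]
        · exact negSeries_zero
      · exact negSeries_zero
  have h3 : ∀ i, swap (Weyl.omega _)
      (const (rowOp p q m n d i a.rev * colOp p q m n d i b.rev) * zSubInv _ (z i)) =
      intSign (O.s i) • (O.χ i a * O.D i * O.ρ i b) -
        if a = b then intSign (O.s i) • O.D i else 0 := by
    intro i
    have e1 : O.ρ i b * O.χ i a = intSign (O.s i) • (O.χ i a * O.ρ i b) -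
        if a = b then intSign (O.s i) • (1 : PseudoDiff (WeylD p q m n d)) else 0 := by
      rw [O.χ_ρ i a i b, intSign_sq, smul_add, smul_smul, intSign_mul_self, one_smul]
      simp only [Prod.mk.injEq, true_and]
      split_ifs <;> simp
    have e2 : swap (Weyl.omega _)
        (const (rowOp p q m n d i a.rev * colOp p q m n d i b.rev) * zSubInv _ (z i)) =
        O.D i * (O.ρ i b * O.χ i a) := by
      rw [swap_mul (Weyl.omega_mul _), const_apply, swap_mono, omega_row_mul_col, ← const_apply,
        map_mul]
      rfl
    have hD : Commute (O.D i) (O.χ i a) := O.D_comm (O.Δ_χ i i a)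
    rw [e2, e1, mul_sub, mul_smul_comm, ← mul_assoc, hD.eq, mul_ite, mul_zero, mul_smul_comm,
      mul_one]
  have h4 : swap (Weyl.omega _) (dSub (WeylD p q m n d) (w a.rev)) = O.W a :=
    swap_dSub (Weyl.omega_algebraMap _) _
  rw [h1, h2]
  change swapHom (Weyl.omega _) _ = _
  rw [map_sub, map_add, map_sum, apply_ite (swapHom _), apply_ite (swapHom _), map_zero, map_sum]
  simp only [map_zsmul]
  have h5 : ∑ i, swapHom (Weyl.omega _)
      (const (rowOp p q m n d i a.rev * colOp p q m n d i b.rev) * zSubInv _ (z i)) =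
      (∑ i, intSign (O.s i) • (O.χ i a * O.D i * O.ρ i b)) -
        if a = b then ∑ i, intSign (O.s i) • O.D i else 0 := by
    refine (Finset.sum_congr rfl fun i _ => h3 i).trans ?_
    rw [Finset.sum_sub_distrib]
    congr 1
    split_ifs <;> simp
  -- The part with i < p + q cancels against the constant term of `phiGen_eq`.
  have h6 : ∑ i, intSign (O.s i) • O.D i =
      (∑ i with (i : Fin (p + q + m + n)).val < p + q, intSign (O.s i) • O.D i) +
        ∑ i with p + q ≤ (i : Fin (p + q + m + n)).val, intSign (O.s i) • O.D i := by
    rw [← Finset.sum_filter_add_sum_filter_not _ fun i : Fin (p + q + m + n) => i.val < p + q]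
    simp only [not_lt]
  have h7 : O.lax (p + q + m + n) a b = (if a = b then O.W a else 0) -
      ∑ i, intSign (O.s i) • (O.χ i a * O.D i * O.ρ i b) := by
    rw [Oscillators.lax]
    congr 2
    exact Finset.filter_true_of_mem fun i _ => i.isLt
  rw [h5, h6, h7]
  by_cases hab : a = b
  · subst hab
    simp only [if_true]
    have h8 : swapHom (Weyl.omega _) (dSub (WeylD p q m n d) (w a.rev)) = O.W a := h4
    rw [h8]
    change _ - (_ - _ + ∑ i with (i : Fin (p + q + m + n)).val < p + q, intSign (O.s i) • O.D i) =
      _ + ∑ i with p + q ≤ (i : Fin (p + q + m + n)).val, intSign (O.s i) • O.D i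
    abel
  · simp [hab]

end Duality

end BetheDuality
end

/-! ### Conjugation by R'(∂) and the final comparison -/

noncomputable section
namespace BetheDuality

open PseudoDiff

/-- Conjugation by a product adds up the shifts of its factors, as for a logarithmic derivative. -/
theorem prod_mul_eq_add_mul_prod {P : Type*} [Ring P] {Z : P} {k : ℕ} {f e : Fin k → P}
    (h : ∀ i, f i * Z = (Z + e i) * f i) (hc : ∀ i j, Commute (f i) (e j)) :
    (List.ofFn f).prod * Z = (Z + ∑ i, e i) * (List.ofFn f).prod := by
  induction k with
  | zero => simp
  | succ k ih =>
    have hs : Commute (f 0) (∑ i : Fin k, e i.succ) := Commute.sum_right _ _ _ fun i _ => hc _ _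
    rw [List.ofFn_succ, List.prod_cons, mul_assoc, ih (fun i => h i.succ) fun i j => hc _ _,
      Fin.sum_univ_succ, ← mul_assoc, mul_add, h, hs.eq, ← add_mul, mul_assoc, add_assoc]

theorem prod_ofFn_reverse {P : Type*} [Monoid P] {k : ℕ} {f : Fin k → P}
    (h : ∀ i j, Commute (f i) (f j)) : (List.ofFn f).reverse.prod = (List.ofFn f).prod :=
  prod_reverse_of_comm (List.pairwise_ofFn.2 fun i j _ => h i j)

section Duality

variable (p q m n d : ℕ) (z : Fin (p + q + m + n) → ℂ) (w : Fin d → ℂ)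

theorem dSubInv_comm_dSub (c c' : ℂ) : Commute (dSubInv p q m n d c) (dSub _ c') :=
  dSubInv_comm p q m n d (dSub_comm_dSub _ _)

theorem dSubInv_comm_dSubInv (c c' : ℂ) :
    Commute (dSubInv p q m n d c) (dSubInv p q m n d c') :=
  dSubInv_comm p q m n d (dSubInv_comm_dSub p q m n d c' c).symm

theorem dSub_mul_zSub_eq (c c' : ℂ) : dSub (WeylD p q m n d) c * zSub _ c' =
    (zSub _ c' + dSubInv p q m n d c) * dSub _ c := by
  have h : dSubInv p q m n d c * dSub _ c = 1 :=
    swap_mul_dSub (Weyl.omega_algebraMap _) (Weyl.omega_mul _) c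
  rw [dSub_mul_zSub, add_mul, h]

theorem dSubInv_mul_zSub_eq (c c' : ℂ) : dSubInv p q m n d c * zSub _ c' =
    (zSub _ c' + -dSubInv p q m n d c) * dSubInv p q m n d c := by
  have h1 : dSubInv p q m n d c * dSub _ c = 1 :=
    swap_mul_dSub (Weyl.omega_algebraMap _) (Weyl.omega_mul _) c
  have h2 : dSub _ c * dSubInv p q m n d c = 1 :=
    dSub_mul_swap (Weyl.omega_algebraMap _) (Weyl.omega_mul _) c
  have h3 : dSubInv p q m n d c * (dSub _ c * zSub _ c') * dSubInv p q m n d c =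
      zSub _ c' * dSubInv p q m n d c := by rw [← mul_assoc, h1, one_mul]
  rw [dSub_mul_zSub, mul_add, mul_one, add_mul, mul_assoc, mul_assoc, h2, mul_one] at h3
  rw [add_mul, ← h3]
  noncomm_ring

theorem swap_prod_zSub {k : ℕ} (c : Fin k → ℂ) :
    swap (Weyl.omega _) (List.ofFn fun i => zSub (WeylD p q m n d) (c i)).prod =
      (List.ofFn fun i => dSub _ (c i)).prod := by
  rw [swap_list_prod (Weyl.omega_one _) (Weyl.omega_mul _), List.map_ofFn]
  have : (swap (Weyl.omega _) ∘ fun i => zSub (WeylD p q m n d) (c i)) = fun i => dSub _ (c i) :=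
    funext fun i => swap_zSub (Weyl.omega_algebraMap _) _
  rw [this]
  exact prod_ofFn_reverse fun i j => dSub_comm_dSub _ _

theorem swap_prod_zSubInv {k : ℕ} (c : Fin k → ℂ) :
    swap (Weyl.omega _) (List.ofFn fun i => zSubInv (WeylD p q m n d) (c i)).prod =
      (List.ofFn fun i => dSubInv p q m n d (c i)).prod := by
  rw [swap_list_prod (Weyl.omega_one _) (Weyl.omega_mul _), List.map_ofFn]
  exact prod_ofFn_reverse fun i j => dSubInv_comm_dSubInv p q m n d _ _

theorem prod_dSubInv_comm_prod_dSub {k l : ℕ} (c : Fin k → ℂ) (e : Fin l → ℂ) :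
    Commute (List.ofFn fun i => dSubInv p q m n d (c i)).prod
      (List.ofFn fun i => dSub (WeylD p q m n d) (e i)).prod := by
  refine Commute.list_prod_left _ _ fun x hx => Commute.list_prod_right _ _ fun y hy => ?_
  obtain ⟨i, rfl⟩ := List.mem_ofFn.1 hx
  obtain ⟨j, rfl⟩ := List.mem_ofFn.1 hy
  exact dSubInv_comm_dSub p q m n d _ _

theorem swap_ratR : swap (Weyl.omega _) (ratR p q m n d z) =
    (List.ofFn fun r : Fin p => dSub (WeylD p q m n d) (z ⟨r, by omega⟩)).prod *
      (List.ofFn fun s : Fin q => dSubInv p q m n d (z ⟨p + s, by omega⟩)).prod := by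
  rw [ratR, swap_mul (Weyl.omega_mul _), swap_prod_zSub, swap_prod_zSubInv]
  exact prod_dSubInv_comm_prod_dSub p q m n d _ _

theorem swap_ratRPrime : swap (Weyl.omega _) (ratRPrime p q m n d z) =
    (List.ofFn fun i : Fin m => dSub (WeylD p q m n d) (z ⟨p + q + i, by omega⟩)).prod *
      (List.ofFn fun j : Fin n => dSubInv p q m n d (z ⟨p + q + m + j, by omega⟩)).prod := by
  rw [ratRPrime, swap_mul (Weyl.omega_mul _), swap_prod_zSub, swap_prod_zSubInv]
  exact prod_dSubInv_comm_prod_dSub p q m n d _ _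

/-- The ranges p, q, m, n of the two rational functions, concatenated, are exactly the index ranges
with parities 0, 1, 0, 1. -/
theorem swap_ratR_mul_swap_ratRPrime :
    swap (Weyl.omega _) (ratR p q m n d z) * swap (Weyl.omega _) (ratRPrime p q m n d z) =
      (List.ofFn fun k => if (oscillators p q m n d z w).s k = 0 then
        (oscillators p q m n d z w).Δ k else (oscillators p q m n d z w).D k).prod := by
  rw [swap_ratR, swap_ratRPrime, List.ofFn_add, List.ofFn_add, List.ofFn_add, List.prod_append,
    List.prod_append, List.prod_append, ← mul_assoc]
  refine congrArg₂ _ (congrArg₂ _ (congrArg₂ _ ?_ ?_) ?_) ?_ <;>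
    refine congrArg (fun f => (List.ofFn f).prod) (funext fun i => ?_)
  · exact (if_pos (if_pos (by simp))).symm
  · exact (if_neg (ne_of_eq_of_ne (if_neg (by simp)) one_ne_zero)).symm
  · exact (if_pos (if_pos (by simp))).symm
  · exact (if_neg (ne_of_eq_of_ne (if_neg (by simp; omega)) one_ne_zero)).symm

theorem sum_intSign_dSubInv :
    ∑ i with p + q ≤ (i : Fin (p + q + m + n)).val,
      intSign (superType p q m n i) • dSubInv p q m n d (z i) =
    (∑ i : Fin m, dSubInv p q m n d (z ⟨p + q + i, by omega⟩)) +
      ∑ j : Fin n, -dSubInv p q m n d (z ⟨p + q + m + j, by omega⟩) := by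
  rw [Finset.sum_filter, Fin.sum_univ_add, Fin.sum_univ_add]
  congr 1
  · rw [Finset.sum_eq_zero, zero_add]
    · refine Finset.sum_congr rfl fun i _ => ?_
      rw [if_pos (by simp), intSign, superType, if_pos (by simp), one_smul]; rfl
    · intro i _
      rw [if_neg (by simp)]
  · refine Finset.sum_congr rfl fun i _ => ?_
    rw [if_pos (by simp; omega), intSign, superType, if_neg (by simp; omega), neg_smul,
      one_smul]; rfl

/-- Since [∂, z] = 1, conjugating z by R'(∂) adds the logarithmic derivative of R' at ∂, which is
the shift found in `swap_phi_Lgl`. -/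
theorem swap_ratRPrime_mul_zSub (c : ℂ) :
    swap (Weyl.omega _) (ratRPrime p q m n d z) * zSub _ c =
      (zSub _ c + ∑ i with p + q ≤ (i : Fin (p + q + m + n)).val,
        intSign (superType p q m n i) • dSubInv p q m n d (z i)) *
      swap (Weyl.omega _) (ratRPrime p q m n d z) := by
  rw [sum_intSign_dSubInv, swap_ratRPrime]
  set X := (List.ofFn fun i : Fin m => dSub (WeylD p q m n d) (z ⟨p + q + i, by omega⟩)).prod
    with hX
  have h1 := prod_mul_eq_add_mul_prod (Z := zSub (WeylD p q m n d) c)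
    (fun i : Fin m => dSub_mul_zSub_eq p q m n d (z ⟨p + q + i, by omega⟩) c)
    fun i j => (dSubInv_comm_dSub p q m n d _ _).symm
  have h2 := prod_mul_eq_add_mul_prod (Z := zSub (WeylD p q m n d) c)
    (fun i : Fin n => dSubInv_mul_zSub_eq p q m n d (z ⟨p + q + m + i, by omega⟩) c)
    fun i j => (dSubInv_comm_dSubInv p q m n d _ _).neg_right
  have h3 : Commute X (∑ j : Fin n, -dSubInv p q m n d (z ⟨p + q + m + j, by omega⟩)) := by
    refine Commute.sum_right _ _ _ fun j _ => Commute.neg_right ?_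
    refine Commute.list_prod_left _ _ fun x hx => ?_
    obtain ⟨i, rfl⟩ := List.mem_ofFn.1 hx
    exact (dSubInv_comm_dSub p q m n d _ _).symm
  rw [mul_assoc, h2, ← mul_assoc, mul_add, h1, h3.eq, ← add_mul, mul_assoc, add_assoc (zSub _ c)]

theorem swap_ratRPrime_comm {x : PseudoDiff (WeylD p q m n d)}
    (hx : ∀ c, Commute (dSub _ c) x) :
    Commute (swap (Weyl.omega _) (ratRPrime p q m n d z)) x := by
  rw [swap_ratRPrime]
  refine Commute.mul_left ?_ ?_ <;> refine Commute.list_prod_left _ _ fun y hy => ?_ <;>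
    obtain ⟨i, rfl⟩ := List.mem_ofFn.1 hy
  · exact hx _
  · exact dSubInv_comm p q m n d (hx _)

theorem swap_ratRPrime_mul_lax (a b : Fin d) :
    swap (Weyl.omega _) (ratRPrime p q m n d z) *
        (oscillators p q m n d z w).lax (p + q + m + n) a b =
      swap (Weyl.omega _) (mapHom (phi p q m n d z : _ →+* WeylD p q m n d)
        (Lgl w a.rev b.rev)) * swap (Weyl.omega _) (ratRPrime p q m n d z) := by
  rw [swap_phi_Lgl]
  set K := swap (Weyl.omega _) (ratRPrime p q m n d z) with hK
  set e := ∑ i with p + q ≤ (i : Fin (p + q + m + n)).val,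
          intSign (superType p q m n i) • dSubInv p q m n d (z i) with he
  set O := oscillators p q m n d z w
  set S := ∑ i with (i : Fin (p + q + m + n)).val < p + q + m + n,
    intSign (O.s i) • (O.χ i a * O.D i * O.ρ i b) with hS
  -- S contains only constants and functions of ∂, so the conjugation affects nothing but z on the
  -- diagonal.
  have hKS : K * S = S * K := by
    refine (swap_ratRPrime_comm p q m n d z fun c => Commute.sum_right _ _ _ fun i _ =>
      Commute.smul_right ?_ _).eq
    exact ((dSub_comm_const _ _).mul_right (dSubInv_comm_dSub p q m n d _ _).symm).mul_right
      (dSub_comm_const _ _)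
  have hlax : O.lax (p + q + m + n) a b = (if a = b then O.W a else 0) - S := rfl
  rw [hlax, mul_sub, hKS]
  by_cases hab : a = b
  · have := swap_ratRPrime_mul_zSub p q m n d z (w a.rev)
    have h2 : K * O.W a = (O.W a + e) * K := this
    rw [if_pos hab, if_pos hab, h2]
    noncomm_ring
  · rw [if_neg hab, if_neg hab]
    noncomm_ring

/-- The map ω reverses the three factors, so R'(∂) ends up on the right of the determinant and is
moved through it by the intertwining relation, where it joins R(∂). -/
theorem swap_map_phi_cdet :
    swap (Weyl.omega _) (ratRPrime p q m n d z *
        mapHom (phi p q m n d z : _ →+* WeylD p q m n d) (cdet (Lgl w)) * ratR p q m n d z) =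
      (List.ofFn fun k => if (oscillators p q m n d z w).s k = 0 then
        (oscillators p q m n d z w).Δ k else (oscillators p q m n d z w).D k).prod *
      cdet ((oscillators p q m n d z w).lax (p + q + m + n)) := by
  rw [← swap_ratR_mul_swap_ratRPrime, mul_assoc _ _ (cdet _),
    mul_cdet_of_intertwine (swap_ratRPrime_mul_lax p q m n d z w), map_cdet]
  rw [swap_mul (Weyl.omega_mul _), swap_mul (Weyl.omega_mul _),
    swap_cdet (Weyl.omega_one _) (Weyl.omega_mul _)]
  rfl

theorem cdet_lax_zero : cdet ((oscillators p q m n d z w).lax 0) =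
    (List.ofFn fun a => zSub (WeylD p q m n d) (w a)).prod := by
  have h : (oscillators p q m n d z w).lax 0 =
      Matrix.diagonal fun a => zSub (WeylD p q m n d) (w a.rev) := by
    ext1 a b
    simp [Oscillators.lax, Matrix.diagonal_apply, oscillators]
  rw [h, cdet_diagonal, ofFn_comp_rev fun a => zSub (WeylD p q m n d) (w a)]
  exact prod_ofFn_reverse fun i j => zSub_comm_zSub _ _

theorem zSub_prod_mul_map_Ber :
    (List.ofFn fun a => zSub (WeylD p q m n d) (w a)).prod *
        mapHom (varphi p q m n d w : _ →+* WeylD p q m n d)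
          (Ber (superType p q m n) (Lsuper p q m n z)) =
      (List.ofFn fun k => if (oscillators p q m n d z w).s k = 0 then
        (oscillators p q m n d z w).Δ k else (oscillators p q m n d z w).D k).prod *
      cdet ((oscillators p q m n d z w).lax (p + q + m + n)) := by
  have hs := sufficientlyInvertible_Lsuper p q m n z
  set O := oscillators p q m n d z w with hO
  set Wi : Fin d → PseudoDiff (WeylD p q m n d) := fun a => zSubInv _ (w a.rev) with hWi
  -- The solution X⁻¹ χ_k of the linear system in the bordering step.
  set u : Fin (p + q + m + n) → Fin d → PseudoDiff (WeylD p q m n d) := fun k a =>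
    ∑ b, Ring.inverse (O.lax k) a b * O.χ k b with hu
  have hu' : ∀ (k : Fin (p + q + m + n)) a, ∑ b, O.lax k a b * u k b = O.χ k a := by
    intro k
    have h : (O.lax k).mulVec ((Ring.inverse (O.lax k)).mulVec (O.χ k)) = O.χ k := by
      rw [Matrix.mulVec_mulVec, Ring.mul_inverse_cancel _ (isUnit_lax p q m n d z w k),
        Matrix.one_mulVec]
    exact congrFun h
  have hq : ∀ k, QuasidetDefined (leading (O.dual Wi) k) (Fin.last k) (Fin.last k) := by
    intro k
    rw [← map_Lsuper]
    exact QuasidetDefined.map (mapHom (varphi p q m n d w : _ →+* WeylD p q m n d)) (hs k)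
  have hθ := fun k => O.quasiminor_dual (Wi := Wi) (fun a => zSubInv_mul_zSub (w a.rev)) k (hq k) (u k)
    (hu' k)
  rw [map_Ber _ _ hs, map_Lsuper, ← cdet_lax_zero p q m n d z w]
  exact O.cdet_mul_prod isUnit_two u hu' (quasiminor (O.dual Wi)) (fun k => (hθ k).1)
    fun k => (hθ k).2

end Duality

end BetheDuality
end

theorem proposition4p6 (p q m n d : ℕ) (z : Fin (p + q + m + n) → ℂ) (w : Fin d → ℂ) :
    SufficientlyInvertible (Lsuper p q m n z) ∧
    (List.ofFn fun a : Fin d => PseudoDiff.zSub (WeylD p q m n d) (w a)).prod *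
        PseudoDiff.map (varphi p q m n d w : _ →+* WeylD p q m n d)
          (Ber (superType p q m n) (Lsuper p q m n z)) =
      PseudoDiff.swap (Weyl.omega _)
        (ratRPrime p q m n d z *
          PseudoDiff.map (phi p q m n d z : _ →+* WeylD p q m n d) (cdet (Lgl w)) *
          ratR p q m n d z) :=
  ⟨sufficientlyInvertible_Lsuper p q m n z,
    (zSub_prod_mul_map_Ber p q m n d z w).trans (swap_map_phi_cdet p q m n d z w).symm⟩
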